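/- Let $K=(K,+,\cdot,0,1)$ be a nontrivial ($0\neq1$) commutative semiring, possibly equipped with an order, i.e. a partial order $\le$ with $a\le b\Rightarrow a+c\le b+c$ and $0\le a,\,0\le b\Rightarrow 0\le ab$. Let $O\subseteq\{=,\neq,\le,\not\le\}$, where $K$ is assumed ordered if $\le\,\in O$ or $\not\le\,\in O$. **Logic.** Let $\tau$ be a finite relational vocabulary. Formulas of $\mathrm{FO}(O)$ over $\tau$ are given by $\phi ::= \alpha\mid \alpha\circ\alpha\mid(\phi\wedge\phi)\mid(\phi\vee\phi)\mid\exists x\,\phi\mid\forall x\,\phi$ with $\circ\in O$, where $\alpha::= x=y\mid x\neq y\mid R(\bar x)\mid\neg R(\bar x)\mid(\alpha\wedge\alpha)\mid(\alpha\vee\alpha)\mid\exists x\,\alpha\mid\forall x\,\alpha$. For a finite nonempty set $A$, a $K$-interpretation is a map $\pi$ from the set of literals $R(\bar a),\neg R(\bar a)$ ($R\in\tau$, $\bar a\in A^{\mathrm{ar}(R)}$) to $K$. The value $[[\phi]]_{\pi,s}\in K$ of $\phi$ under $\pi$ and an assignment $s$ in $A$ is defined by: literals $R(\bar x)$, $\neg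 R(\bar x)$ take the value of $\pi$ at $R(s(\bar x))$, $\neg R(s(\bar x))$; $x=y$, $x\ne y$ and $\alpha\circ\beta$ take the value $1$ if the (in)equality holds between $s(x),s(y)$, respectively between $[[\alpha]]_{\pi,s},[[\beta]]_{\pi,s}$, and $0$ otherwise; $\wedge,\vee$ are product and sum; $\forall x,\exists x$ are the product and the sum over all $a\in A$ of the values under $s(a/x)$. **Machines.** A BSS$_K$ machine has states $x=(x_i)_{i\in\mathbb Z}$ of finite support in $K$ and finitely many nodes $1,\dots,N$: the only input node $1$, the only output node $N$ (where it halts), computation nodes (assigning to one fixed coordinate $x_i$ the value $x_j+x_k$, $x_jx_k$ or a constant $c\in K$, for fixed $j,k$), branch nodes (testing $x_1=x_2$ if $K$ carries no order, and $x_1\le x_2$ if $K$ is ordered), and shift nodes (left or right by one coordinate). On input $(w_1,\dots,w_n)\in K^*$ it starts with $x_i=w_i$ for $1\le i\le n$, $x_i=1$ for $-n\le i\le-1$ and $x_i=0$ otherwise; the output is $(x_1,\dots,x_l)$, where $l$ is the number of consecutive ones in the coordinates $-1,-2,\dots$. The class $\mathrm P_K$ consists of all $L\subseteq K^*$ whose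 characteristic function (with values $(1)$, $(0)$) is computed by a BSS$_K$ machine that reaches the output node within $p(|w|)$ steps on every input $w\in K^*$, for some polynomial $p$. **Encoding.** Finite nonempty sets $A\subset\mathbb N$ and the values of $s$ on $k$ variables $x_0,\dots,x_{k-1}$ that include the free variables of $\varphi$ are given as lists of numbers in binary: a number is coded by its binary digits $b$ (least significant first, no leading zeros), each written as $1\,b$, followed by $0$; a list is coded by the codes of its entries, each preceded by $1$, followed by $0$. The set $A$ is listed in increasing order. $\mathrm{enc}(\pi)$ is the sequence of the values of $\pi$ at all literals: relation symbol after relation symbol, first the positive and then the negated literals, each in lexicographic order of the tuples; for a relation symbol of arity $0$ each of the two values is written $|A|$ times. The instance $(A,s,\pi)$ is encoded by the concatenation of the codes of $A$, of $s$ and of $\pi$, in this order. **Statement.** For every $K$ and $O$ as above, every $\tau$ and every fixed formula $\varphi$ of $\mathrm{FO}(O)$ over $\tau$, the model checking problem $$\mathrm{FO}_K(O)\text{-}\mathrm{MC}(\varphi)=\{\text{encodings of }(A,s,\pi)\;:\;[[\varphi]]_{\pi,s}\neq0\}\subseteq K^*$$ belongs to $\mathrm P_K$. -/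

import Mathlib

namespace SemiringMC

/-! ### Orders on semirings -/

/-- An order making the semiring `K` an ordered semiring: a partial order with
`a ≤ b → a + c ≤ b + c` and `0 ≤ a → 0 ≤ b → 0 ≤ a * b`. -/
structure SemiringOrder (K : Type*) [Semiring K] extends PartialOrder K where
  le_add : ∀ a b c : K, a ≤ b → a + c ≤ b + c
  nonneg_mul : ∀ a b : K, 0 ≤ a → 0 ≤ b → 0 ≤ a * b

/-! ### BSS machines over a semiring

A possibly ordered semiring is a semiring `K` with `ord : Option (SemiringOrder K)`; the value
`none` means that `K` carries no order. -/

/-- The right-hand side of the assignment made by a computation node. -/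
inductive BSSOp (K : Type*)
  | add (j k : ℤ)
  | mul (j k : ℤ)
  | const (c : K)

/-- The nodes of a BSS machine whose labels range over `L`. -/
inductive BSSNode (K : Type*) (L : Type)
  | input (next : L)
  | output
  | comp (i : ℤ) (op : BSSOp K) (next : L)
  | branch (nextMinus nextPlus : L)
  | shiftLeft (next : L)
  | shiftRight (next : L)

/-- A BSS machine over `K`. The nodes are labelled by `Fin (N + 2)`; the node with the first label
is the only input node, the node with the last label is the only output node. -/
structure BSSMachine (K : Type*) where
  N : ℕ
  node : Fin (N + 2) → BSSNode K (Fin (N + 2))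
  input_iff : ∀ m, (∃ n, node m = BSSNode.input n) ↔ m = 0
  output_iff : ∀ m, node m = BSSNode.output ↔ m = Fin.last (N + 1)

/-- The state space `K_*`: families `(x_i)` indexed by `ℤ` with finite support. -/
abbrev State (K : Type*) [Zero K] := ℤ →₀ K

section Machines

variable {K : Type*} [Semiring K]

/-- Shift left: coordinate `i` of the result is `x (i + 1)`. -/
noncomputable def shiftL (x : State K) : State K :=
  Finsupp.equivMapDomain (Equiv.subRight (1 : ℤ)) x

/-- Shift right: coordinate `i` of the result is `x (i - 1)`. -/
noncomputable def shiftR (x : State K) : State K :=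
  Finsupp.equivMapDomain (Equiv.addRight (1 : ℤ)) x

theorem shiftL_apply (x : State K) (i : ℤ) : shiftL x i = x (i + 1) := rfl

theorem shiftR_apply (x : State K) (i : ℤ) : shiftR x i = x (i - 1) := rfl

/-- The coordinates of the initial state on input `w = (x₁, …, xₙ)`: coordinate `i` is `xᵢ` for
`1 ≤ i ≤ n`, it is `1` for `-n ≤ i ≤ -1`, and `0` otherwise. -/
def inputCoord (w : List K) (i : ℤ) : K :=
  if 1 ≤ i ∧ i ≤ w.length then w.getD (i - 1).toNat 0
  else if -(w.length : ℤ) ≤ i ∧ i ≤ -1 then 1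
  else 0

/-- The input mapping. -/
noncomputable def inputMap (w : List K) : State K :=
  Finsupp.ofSupportFinite (inputCoord w) <| by
    refine (Set.finite_Icc (-(w.length : ℤ)) w.length).subset fun i hi => ?_
    by_contra h
    rw [Set.mem_Icc] at h
    refine hi ?_
    unfold inputCoord
    rw [if_neg (by omega), if_neg (by omega)]

/-- The number of consecutive ones in the coordinates `-1, -2, …`, starting from `-1`. -/
noncomputable def outputLength (x : State K) : ℕ :=
  sInf {l : ℕ | x (-((l : ℤ) + 1)) ≠ 1}

/-- The output mapping: the first `outputLength x` positive coordinates. -/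
noncomputable def outputMap (x : State K) : List K :=
  List.ofFn fun i : Fin (outputLength x) => x ((i : ℤ) + 1)

/-- The value computed by a computation node from the state `x`. -/
def BSSOp.value (x : State K) : BSSOp K → K
  | .add j k => x j + x k
  | .mul j k => x j * x k
  | .const c => c

/-- The test made at branch nodes: equality if `K` carries no order, and `≤` if `K` is ordered. -/
def branchRel (ord : Option (SemiringOrder K)) (a b : K) : Prop :=
  match ord with
  | none => a = b
  | some o => o.le a b

/-- A configuration: a current node and a current state. -/
abbrev BSSMachine.Config (M : BSSMachine K) := Fin (M.N + 2) × State K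

/-- One computation step. At the output node the machine has halted, and the configuration does not
change any more. -/
noncomputable def BSSMachine.step (ord : Option (SemiringOrder K)) (M : BSSMachine K)
    (c : M.Config) : M.Config :=
  open Classical in
  match M.node c.1 with
  | .input next => (next, c.2)
  | .output => c
  | .comp i op next => (next, Finsupp.update c.2 i (op.value c.2))
  | .branch nextMinus nextPlus =>
      (if branchRel ord (c.2 1) (c.2 2) then nextMinus else nextPlus, c.2)
  | .shiftLeft next => (next, shiftL c.2)
  | .shiftRight next => (next, shiftR c.2)

/-- The configuration reached from the input `w` after `t` steps. -/
noncomputable def BSSMachine.run (ord : Option (SemiringOrder K)) (M : BSSMachine K)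
    (w : List K) (t : ℕ) : M.Config :=
  (M.step ord)^[t] (0, inputMap w)

/-- `M` computes the (total) function `f`: on every input `w` it reaches the output node, in a state
that the output mapping takes to `f w`. -/
def BSSMachine.Computes (ord : Option (SemiringOrder K)) (M : BSSMachine K)
    (f : List K → List K) : Prop :=
  ∀ w, ∃ t, (M.run ord w t).1 = Fin.last (M.N + 1) ∧ outputMap (M.run ord w t).2 = f w

/-- `M` runs in time `T`: on every input `w` the output node is reached within `T |w|` steps. -/
def BSSMachine.RunsInTime (ord : Option (SemiringOrder K)) (M : BSSMachine K)
    (T : ℕ → ℕ) : Prop :=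
  ∀ w, ∃ t ≤ T w.length, (M.run ord w t).1 = Fin.last (M.N + 1)

open Classical in
/-- The characteristic function of a language, with values the one-letter strings `1` and `0`. -/
noncomputable def charFun (L : Set (List K)) (w : List K) : List K :=
  if w ∈ L then [1] else [0]

/-- The class `P_K` of all languages decided by a BSS machine running in polynomial time. -/
def PClass (ord : Option (SemiringOrder K)) : Set (Set (List K)) :=
  {L | ∃ M : BSSMachine K, M.Computes ord (charFun L) ∧
    ∃ p : Polynomial ℕ, M.RunsInTime ord fun n => p.eval n}

end Machines

/-! ### First-order logic with semiring semantics -/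

/-- A finite relational vocabulary: relation symbols indexed by `Fin num`, with their arities. -/
structure Vocab where
  num : ℕ
  ar : Fin num → ℕ

/-- The literals over `A`: facts and negated facts. -/
inductive Lit (τ : Vocab) (A : Type*)
  | pos (R : Fin τ.num) (a : Fin (τ.ar R) → A)
  | neg (R : Fin τ.num) (a : Fin (τ.ar R) → A)

/-- The comparison symbols `=`, `≠`, `≤`, `≰`. -/
inductive Cmp
  | eq
  | ne
  | le
  | nle

/-- `FO τ k`: first-order formulas in negation normal form over `τ` with free variables among
`x₀, …, x₍ₖ₋₁₎`. A quantifier in front of a formula with free variables among `x₀, …, xₖ` binds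
`xₖ`; this is first-order syntax up to the names of bound variables. -/
inductive FO (τ : Vocab) : ℕ → Type
  | eq {k : ℕ} (x y : Fin k) : FO τ k
  | ne {k : ℕ} (x y : Fin k) : FO τ k
  | rel {k : ℕ} (R : Fin τ.num) (x : Fin (τ.ar R) → Fin k) : FO τ k
  | negRel {k : ℕ} (R : Fin τ.num) (x : Fin (τ.ar R) → Fin k) : FO τ k
  | and {k : ℕ} (α β : FO τ k) : FO τ k
  | or {k : ℕ} (α β : FO τ k) : FO τ k
  | ex {k : ℕ} (α : FO τ (k + 1)) : FO τ k
  | all {k : ℕ} (α : FO τ (k + 1)) : FO τ k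

/-- `FOCmp O τ k`: the formulas of `FO(O)`, first-order logic with formula (in)equality for the
comparison symbols in `O`, with free variables among `x₀, …, x₍ₖ₋₁₎`. -/
inductive FOCmp (O : Set Cmp) (τ : Vocab) : ℕ → Type
  | base {k : ℕ} (α : FO τ k) : FOCmp O τ k
  | cmp {k : ℕ} (c : Cmp) (hc : c ∈ O) (α β : FO τ k) : FOCmp O τ k
  | and {k : ℕ} (φ ψ : FOCmp O τ k) : FOCmp O τ k
  | or {k : ℕ} (φ ψ : FOCmp O τ k) : FOCmp O τ k
  | ex {k : ℕ} (φ : FOCmp O τ (k + 1)) : FOCmp O τ k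
  | all {k : ℕ} (φ : FOCmp O τ (k + 1)) : FOCmp O τ k

section Semantics

variable {K : Type*} [CommSemiring K] {A : Type*} [Fintype A] {τ : Vocab} {O : Set Cmp}

open Classical in
/-- The value `1` if `p` holds, and `0` otherwise. -/
noncomputable def truth (K : Type*) [CommSemiring K] (p : Prop) : K := if p then 1 else 0

/-- The relation on `K` denoted by a comparison symbol. The symbols `≤` and `≰` are only used over
ordered semirings; the values given for `ord = none` are irrelevant. -/
def Cmp.holds (ord : Option (SemiringOrder K)) (c : Cmp) (a b : K) : Prop :=
  match c, ord with
  | .eq, _ => a = b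
  | .ne, _ => a ≠ b
  | .le, some o => o.le a b
  | .nle, some o => ¬ o.le a b
  | .le, none => False
  | .nle, none => False

/-- The value of a formula of `FO` under the `K`-interpretation `π` and the assignment `s`. -/
noncomputable def FO.eval (π : Lit τ A → K) : {k : ℕ} → FO τ k → (Fin k → A) → K
  | _, .eq x y, s => truth K (s x = s y)
  | _, .ne x y, s => truth K (s x ≠ s y)
  | _, .rel R x, s => π (.pos R fun i => s (x i))
  | _, .negRel R x, s => π (.neg R fun i => s (x i))
  | _, .and α β, s => α.eval π s * β.eval π s
  | _, .or α β, s => α.eval π s + β.eval π s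
  | _, .ex α, s => ∑ a : A, α.eval π (Fin.snoc s a)
  | _, .all α, s => ∏ a : A, α.eval π (Fin.snoc s a)

/-- The value of a formula of `FO(O)` under the `K`-interpretation `π` and the assignment `s`. -/
noncomputable def FOCmp.eval (ord : Option (SemiringOrder K)) (π : Lit τ A → K) :
    {k : ℕ} → FOCmp O τ k → (Fin k → A) → K
  | _, .base α, s => α.eval π s
  | _, .cmp c _ α β, s => truth K (c.holds ord (α.eval π s) (β.eval π s))
  | _, .and φ ψ, s => φ.eval ord π s * ψ.eval ord π s
  | _, .or φ ψ, s => φ.eval ord π s + ψ.eval ord π s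
  | _, .ex φ, s => ∑ a : A, φ.eval ord π (Fin.snoc s a)
  | _, .all φ, s => ∏ a : A, φ.eval ord π (Fin.snoc s a)

end Semantics

/-! ### Encodings of the inputs

Universes are finite nonempty sets `A` of natural numbers, with their usual order. -/

section Encoding

variable {K : Type*} [CommSemiring K] {τ : Vocab}

/-- The binary code of a natural number: its binary digits `b`, least significant first, each
written as the pair `1 b`, and an end mark `0`. -/
def encNat (K : Type*) [CommSemiring K] (a : ℕ) : List K :=
  (a.bits.flatMap fun b => [1, if b then 1 else 0]) ++ [0]

/-- The code of a list of natural numbers: the codes of its entries, each after a mark `1`, and an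
end mark `0`. -/
def encNatList (K : Type*) [CommSemiring K] (l : List ℕ) : List K :=
  (l.flatMap fun a => 1 :: encNat K a) ++ [0]

/-- The elements of `A` in increasing order. -/
def elems (A : Finset ℕ) : List A := (Finset.univ : Finset A).sort (· ≤ ·)

/-- The `r`-tuples with entries in the list `l`, in lexicographic order. -/
def tuples {A : Type*} (l : List A) : (r : ℕ) → List (Fin r → A)
  | 0 => [Fin.elim0]
  | r + 1 => l.flatMap fun a => (tuples l r).map fun t => Fin.cons a t

/-- The values of `f` on all `r`-tuples over `A`, in lexicographic order; for `r = 0` the single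
value is repeated `|A|` times. -/
def encBlock (A : Finset ℕ) : (r : ℕ) → ((Fin r → A) → K) → List K
  | 0, f => List.replicate A.card (f Fin.elim0)
  | r + 1, f => (tuples (elems A) (r + 1)).map f

/-- The encoding of a `K`-interpretation: the values of all literals, one relation symbol after the
other, first the positive and then the negated facts. -/
def encInterp (A : Finset ℕ) (π : Lit τ A → K) : List K :=
  (List.finRange τ.num).flatMap fun R =>
    encBlock A (τ.ar R) (fun a => π (.pos R a)) ++ encBlock A (τ.ar R) (fun a => π (.neg R a))

/-- The encoding of an instance: the list of the elements of `A`, the list of the values of the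
assignment `s`, and the encoding of the `K`-interpretation `π`. -/
def encInstance (A : Finset ℕ) {k : ℕ} (π : Lit τ A → K) (s : Fin k → A) : List K :=
  encNatList K ((elems A).map fun a : A => (a : ℕ)) ++
    encNatList K (List.ofFn fun i => (s i : ℕ)) ++ encInterp A π

/-- The model checking problem for a fixed formula `φ` of `FO(O)`, as a language over `K`: the
encodings of all `A`, `π`, `s` such that the value of `φ` under `π` and `s` is not `0`. -/
def MC (ord : Option (SemiringOrder K)) {O : Set Cmp} {k : ℕ} (φ : FOCmp O τ k) :
    Set (List K) :=
  {w | ∃ (A : Finset ℕ) (_ : A.Nonempty) (π : Lit τ A → K) (s : Fin k → A),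
    w = encInstance A π s ∧ φ.eval ord π s ≠ 0}

end Encoding

end SemiringMC

/-!
Evaluating a fixed formula over a universe with `n` elements takes polynomially many semiring
operations, since a quantifier is a sum or a product of `n` terms, and the nesting of the quantifiers
is fixed. What has to be shown is that a BSS machine, which has only finitely many nodes, no
indirect addressing, and no data but elements of `K`, can organize this evaluation, and that it can
decide whether its input is the code of an instance at all.

The machine model is handled in three layers. Flowcharts with one exit (`Frag`) can be composed, and
become machines when an input and an output node are added (`Frag.machine_run`). On the two-sided
infinite state space they simulate a head moving on a tape (`Rep`, `Sim`): the coordinates around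
the origin serve as the head, and the shift nodes move the tape. On the tape, counters in unary,
registers with values in `K`, and the input word are stored in blocks (`Holds`), so that a letter is
found by walking as many blocks as a counter says. This yields loop programs (`LProg`), and
`mem_PClass_of_loopProgram` says that a language is in `P_K` if its characteristic function is
computed by a loop program with polynomially many operations. Two points depend on the order. Over an
ordered semiring equality is tested by two inequalities, which is enough by antisymmetry (`testEq`),
and a branch that is certainly not taken exists since `K` is nontrivial (`exists_not_branchRel`). At
the start the length of the input is known only from the ones at the negative coordinates; it is
found with nothing but the coordinates `1` and `2` as work space (`exec_toOnes`).

Functions computed by such programs (`NComp` for values in `ℕ`, `PComp` for predicates, `KComp` for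
values in `K`) are closed under composition with arithmetic, bounded recursion, search, bounded
quantification, and sums and products over ranges. Numbers in the code of an instance can be
exponentially large, whereas counters are unary. Hence the elements of the universe are never decoded:
they are named by their positions in the list, and their codes are compared digit by digit (`eqAt`,
`ltAt`). With this, being the code of an instance (`Valid`) is in `PComp`, and the value of the
formula is in `KComp` by induction on the formula (`FOCmp.kComp`); `mem_MC_iff` says that these two
determine the model checking problem.
-/
namespace SemiringMC

universe u

/-! ### Flowcharts with one exit -/

/-- The instructions of a flowchart: the computation, branch and shift nodes of a BSS machine, with
successors in `E`. -/
inductive Act (K : Type u) (E : Type)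
  | comp (i : ℤ) (op : BSSOp K) (next : E)
  | branch (nextMinus nextPlus : E)
  | shiftLeft (next : E)
  | shiftRight (next : E)

/-- Relabelling of the successors of an instruction. -/
def Act.map {K : Type u} {E E' : Type} (e : E → E') : Act K E → Act K E'
  | .comp i op n => .comp i op (e n)
  | .branch n n' => .branch (e n) (e n')
  | .shiftLeft n => .shiftLeft (e n)
  | .shiftRight n => .shiftRight (e n)

/-- An instruction as a node of a BSS machine. -/
def Act.toNode {K : Type u} {E : Type} : Act K E → BSSNode K E
  | .comp i op n => .comp i op n
  | .branch n n' => .branch n n'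
  | .shiftLeft n => .shiftLeft n
  | .shiftRight n => .shiftRight n

/-- A flowchart: a finite set of labelled instructions; the successor `none` is the exit. -/
structure Frag (K : Type u) where
  L : Type
  finite : Finite L
  start : Option L
  node : L → Act K (Option L)

section Flowcharts

variable {K : Type u} [Semiring K] {ord : Option (SemiringOrder K)}

open Classical in
/-- The successor chosen by an instruction, and its effect on the state. -/
noncomputable def Act.exec {E : Type} (ord : Option (SemiringOrder K)) (x : State K) :
    Act K E → E × State K
  | .comp i op n => (n, Finsupp.update x i (op.value x))
  | .branch n n' => (if branchRel ord (x 1) (x 2) then n else n', x)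
  | .shiftLeft n => (n, shiftL x)
  | .shiftRight n => (n, shiftR x)

theorem Act.exec_map {E E' : Type} (x : State K) (e : E → E')
    (a : Act K E) : (a.map e).exec ord x = (e (a.exec ord x).1, (a.exec ord x).2) := by
  cases a <;> simp only [Act.map, Act.exec]
  split_ifs <;> rfl

/-- `F.Run ord e x t y`: started at `e` in the state `x`, the flowchart `F` reaches its exit after
`t` steps, in the state `y`. -/
inductive Frag.Run (ord : Option (SemiringOrder K)) (F : Frag K) :
    Option F.L → State K → ℕ → State K → Prop
  | done (x : State K) : F.Run ord none x 0 x
  | step {l : F.L} {x y z : State K} {e : Option F.L} {t : ℕ}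
      (h : (F.node l).exec ord x = (e, y)) (hr : F.Run ord e y t z) : F.Run ord (some l) x (t + 1) z

/-- A run from the start of a flowchart to its exit. -/
def Frag.Exec (ord : Option (SemiringOrder K)) (F : Frag K) (x : State K) (t : ℕ)
    (y : State K) : Prop :=
  F.Run ord F.start x t y

/-- A run of a flowchart `F` embedded into a flowchart `G`, where the exit of `F` becomes the place
`m none` of `G`, followed by a run of `G` from this place. -/
theorem Frag.Run.embed {F G : Frag K} {e : Option F.L} {x y z : State K} {t t' : ℕ}
    (h : F.Run ord e x t y) (m : Option F.L → Option G.L)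
    (hm : ∀ l, ∃ l', m (some l) = some l' ∧ G.node l' = (F.node l).map m)
    (h' : G.Run ord (m none) y t' z) : G.Run ord (m e) x (t + t') z := by
  induction h with
  | done x => simpa using h'
  | @step l x y z e t h _ ih =>
    obtain ⟨l', hl, hn⟩ := hm l
    rw [hl, Nat.add_right_comm]
    refine .step ?_ (ih h')
    rw [hn, Act.exec_map, h]

/-- The empty flowchart. -/
def Frag.skip (K : Type u) : Frag K where
  L := Empty
  finite := inferInstance
  start := none
  node := Empty.elim

theorem Frag.exec_skip (x : State K) : (Frag.skip K).Exec ord x 0 x := .done x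

/-- The flowchart with a single instruction. -/
def Frag.single (a : Act K (Option Unit)) : Frag K where
  L := Unit
  finite := inferInstance
  start := some ()
  node _ := a

theorem Frag.exec_single {a : Act K (Option Unit)} {x y : State K}
    (h : a.exec ord x = (none, y)) : (Frag.single a).Exec ord x 1 y :=
  .step (F := Frag.single a) (l := ()) h (.done y)

/-- First `F`, then `G`. -/
def Frag.seq (F G : Frag K) : Frag K where
  L := F.L ⊕ G.L
  finite := by have := F.finite; have := G.finite; infer_instance
  start := F.start.elim (G.start.map Sum.inr) (some ∘ Sum.inl)
  node := Sum.elim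
    (fun l => (F.node l).map fun e => e.elim (G.start.map Sum.inr) (some ∘ Sum.inl))
    (fun l => (G.node l).map (Option.map Sum.inr))

theorem Frag.Exec.seq {F G : Frag K} {x y z : State K} {t t' : ℕ} (h : F.Exec ord x t y)
    (h' : G.Exec ord y t' z) : (F.seq G).Exec ord x (t + t') z := by
  refine Frag.Run.embed (G := F.seq G) h
    (fun e => e.elim (G.start.map Sum.inr) (some ∘ Sum.inl)) (fun l => ⟨_, rfl, rfl⟩) ?_
  exact Frag.Run.embed (G := F.seq G) h' (Option.map Sum.inr) (fun l => ⟨_, rfl, rfl⟩) (.done z)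

/-- A branch node, with `F` at the exit for a positive answer and `G` at the other one. -/
def Frag.cond (F G : Frag K) : Frag K where
  L := Option (F.L ⊕ G.L)
  finite := by have := F.finite; have := G.finite; infer_instance
  start := some none
  node
    | none => .branch (F.start.map (some ∘ Sum.inl)) (G.start.map (some ∘ Sum.inr))
    | some (.inl l) => (F.node l).map (Option.map (some ∘ Sum.inl))
    | some (.inr l) => (G.node l).map (Option.map (some ∘ Sum.inr))

theorem Frag.Exec.cond_pos {F : Frag K} (G : Frag K) {x y : State K} {t : ℕ}
    (hb : branchRel ord (x 1) (x 2)) (h : F.Exec ord x t y) :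
    (F.cond G).Exec ord x (t + 1) y := by
  refine .step (F := F.cond G) (l := none) (e := F.start.map (some ∘ Sum.inl)) (y := x) ?_ ?_
  · simp [Act.exec, Frag.cond, hb]
  · exact Frag.Run.embed (G := F.cond G) h (Option.map (some ∘ Sum.inl)) (fun l => ⟨_, rfl, rfl⟩)
      (.done y)

theorem Frag.Exec.cond_neg (F : Frag K) {G : Frag K} {x y : State K} {t : ℕ}
    (hb : ¬ branchRel ord (x 1) (x 2)) (h : G.Exec ord x t y) :
    (F.cond G).Exec ord x (t + 1) y := by
  refine .step (F := F.cond G) (l := none) (e := G.start.map (some ∘ Sum.inr)) (y := x) ?_ ?_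
  · simp [Act.exec, Frag.cond, hb]
  · exact Frag.Run.embed (G := F.cond G) h (Option.map (some ∘ Sum.inr)) (fun l => ⟨_, rfl, rfl⟩)
      (.done y)

/-- Run `T`; as long as the branch node after it gives a positive answer, run `F` and start again. -/
def Frag.loop (T F : Frag K) : Frag K where
  L := Option (T.L ⊕ F.L)
  finite := by have := T.finite; have := F.finite; infer_instance
  start := T.start.elim (some none) (some ∘ some ∘ Sum.inl)
  node
    | none => .branch
        (F.start.elim (T.start.elim (some none) (some ∘ some ∘ Sum.inl)) (some ∘ some ∘ Sum.inr)) none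
    | some (.inl l) => (T.node l).map fun e => e.elim (some none) (some ∘ some ∘ Sum.inl)
    | some (.inr l) => (F.node l).map fun e =>
        e.elim (T.start.elim (some none) (some ∘ some ∘ Sum.inl)) (some ∘ some ∘ Sum.inr)

theorem Frag.Exec.loop_neg {T : Frag K} (F : Frag K) {x y : State K} {t : ℕ}
    (h : T.Exec ord x t y) (hb : ¬ branchRel ord (y 1) (y 2)) : (T.loop F).Exec ord x (t + 1) y := by
  refine Frag.Run.embed (G := T.loop F) h (fun e => e.elim (some none) (some ∘ some ∘ Sum.inl))
    (fun l => ⟨_, rfl, rfl⟩) (.step (F := T.loop F) (l := none) (e := none) (y := y) ?_ (.done y))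
  simp [Act.exec, Frag.loop, hb]

theorem Frag.Exec.loop_pos {T F : Frag K} {x y z z' : State K} {t t' t'' : ℕ}
    (h : T.Exec ord x t y) (hb : branchRel ord (y 1) (y 2)) (h' : F.Exec ord y t' z)
    (h'' : (T.loop F).Exec ord z t'' z') : (T.loop F).Exec ord x (t + (t' + t'' + 1)) z' := by
  refine Frag.Run.embed (G := T.loop F) h (fun e => e.elim (some none) (some ∘ some ∘ Sum.inl))
    (fun l => ⟨_, rfl, rfl⟩) (.step (F := T.loop F) (l := none)
      (e := F.start.elim (T.loop F).start (some ∘ some ∘ Sum.inr)) (y := y) ?_ ?_)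
  · simp [Act.exec, Frag.loop, hb]
  · exact Frag.Run.embed (G := T.loop F) h'
      (fun e => e.elim (T.loop F).start (some ∘ some ∘ Sum.inr)) (fun l => ⟨_, rfl, rfl⟩) h''

/-- A list of assignments, one computation node for each. -/
def Frag.line : List (ℤ × BSSOp K) → Frag K
  | [] => Frag.skip K
  | a :: l => (Frag.single (.comp a.1 a.2 none)).seq (Frag.line l)

/-- The effect of a list of assignments. -/
noncomputable def assignAll : List (ℤ × BSSOp K) → State K → State K
  | [], x => x
  | a :: l, x => assignAll l (Finsupp.update x a.1 (a.2.value x))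

theorem Frag.exec_line (l : List (ℤ × BSSOp K)) (x : State K) :
    (Frag.line l).Exec ord x l.length (assignAll l x) := by
  induction l generalizing x with
  | nil => exact Frag.exec_skip x
  | cons a l ih =>
    rw [List.length_cons, add_comm]
    exact Frag.Exec.seq (Frag.exec_single rfl) (ih _)

end Flowcharts

/-! ### From flowcharts to machines -/

section Labels

variable {K : Type u}

/-- The label in a machine that belongs to a place of a flowchart. -/
def place {L : Type} {n : ℕ} (e : L ≃ Fin n) : Option L → Fin (n + 2)
  | none => Fin.last (n + 1)
  | some l => (e l).castSucc.succ

/-- The nodes of a machine that runs the flowchart `node` between input and output. -/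
def machineNode {L : Type} {n : ℕ} (e : L ≃ Fin n) (start : Option L)
    (node : L → Act K (Option L)) : Fin (n + 2) → BSSNode K (Fin (n + 2)) :=
  Fin.cases (.input (place e start)) <|
    Fin.lastCases .output fun i => ((node (e.symm i)).map (place e)).toNode

theorem machineNode_zero {L : Type} {n : ℕ} (e : L ≃ Fin n) (start : Option L)
    (node : L → Act K (Option L)) : machineNode e start node 0 = .input (place e start) := rfl

theorem machineNode_last {L : Type} {n : ℕ} (e : L ≃ Fin n) (start : Option L)
    (node : L → Act K (Option L)) : machineNode e start node (Fin.last (n + 1)) = .output := by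
  rw [← Fin.succ_last, machineNode, Fin.cases_succ, Fin.lastCases_last]

theorem machineNode_place {L : Type} {n : ℕ} (e : L ≃ Fin n) (start : Option L)
    (node : L → Act K (Option L)) (l : L) :
    machineNode e start node (place e (some l)) = ((node l).map (place e)).toNode := by
  rw [place, machineNode, Fin.cases_succ, Fin.lastCases_castSucc, Equiv.symm_apply_apply]

theorem label_cases {L : Type} {n : ℕ} (e : L ≃ Fin n) (m : Fin (n + 2)) :
    m = 0 ∨ m = Fin.last (n + 1) ∨ ∃ l, m = place e (some l) := by
  cases m using Fin.cases with
  | zero => exact .inl rfl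
  | succ i =>
    cases i using Fin.lastCases with
    | last => exact .inr (.inl rfl)
    | cast i => exact .inr (.inr ⟨e.symm i, by rw [place, Equiv.apply_symm_apply]⟩)

theorem place_some_ne_last {L : Type} {n : ℕ} (e : L ≃ Fin n) (l : L) :
    place e (some l) ≠ Fin.last (n + 1) := by
  have := (e l).2
  simp only [place, ne_eq, Fin.ext_iff, Fin.val_succ, Fin.val_castSucc, Fin.val_last]
  omega

theorem Act.toNode_ne_output {E : Type} (a : Act K E) : a.toNode ≠ .output := by
  cases a <;> simp [Act.toNode]

theorem Act.toNode_ne_input {E : Type} (a : Act K E) (n : E) : a.toNode ≠ .input n := by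
  cases a <;> simp [Act.toNode]

end Labels

section Machine

variable {K : Type u} [Semiring K] {ord : Option (SemiringOrder K)}

/-- The machine whose nodes between input and output are those of a flowchart. -/
noncomputable def Frag.machine (F : Frag K) : BSSMachine K :=
  have := F.finite
  { N := Nat.card F.L
    node := machineNode (Finite.equivFin F.L) F.start F.node
    input_iff := by
      intro m
      rcases label_cases (Finite.equivFin F.L) m with rfl | rfl | ⟨l, rfl⟩
      · simp [machineNode_zero]
      · simp [machineNode_last]
      · simp only [machineNode_place, Act.toNode_ne_input, exists_false, false_iff]
        simp [place]
    output_iff := by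
      intro m
      rcases label_cases (Finite.equivFin F.L) m with rfl | rfl | ⟨l, rfl⟩
      · simp [machineNode_zero, Fin.ext_iff]
      · simp [machineNode_last]
      · simp [machineNode_place, Act.toNode_ne_output, place_some_ne_last] }

theorem Frag.machine_step (F : Frag K) [Finite F.L] (l : F.L) (x : State K) :
    F.machine.step ord (place (Finite.equivFin F.L) (some l), x) =
      (place (Finite.equivFin F.L) ((F.node l).exec ord x).1, ((F.node l).exec ord x).2) := by
  have h : F.machine.node (place (Finite.equivFin F.L) (some l)) =
      ((F.node l).map (place (Finite.equivFin F.L))).toNode :=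
    machineNode_place (Finite.equivFin F.L) F.start F.node l
  rw [BSSMachine.step]
  simp only [h]
  rcases F.node l with _ | _ | _ | _ <;> simp only [Act.map, Act.toNode, Act.exec]
  · rfl
  · classical exact congrArg (·, x) (apply_ite (place (Finite.equivFin F.L)) _ _ _).symm
  · rfl
  · rfl

theorem Frag.machine_iterate (F : Frag K) [Finite F.L] {e : Option F.L} {x y : State K} {t : ℕ}
    (h : F.Run ord e x t y) :
    (F.machine.step ord)^[t] (place (Finite.equivFin F.L) e, x) =
      (Fin.last (F.machine.N + 1), y) := by
  induction h with
  | done x => rfl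
  | step h _ ih =>
    rw [Function.iterate_succ_apply, Frag.machine_step, h]
    exact ih

/-- A run of a flowchart from the initial state of an input word is a run of its machine. -/
theorem Frag.machine_run {F : Frag K} {w : List K} {t : ℕ} {y : State K}
    (h : F.Exec ord (inputMap w) t y) :
    F.machine.run ord w (t + 1) = (Fin.last (F.machine.N + 1), y) := by
  have := F.finite
  rw [BSSMachine.run, Function.iterate_succ_apply]
  exact F.machine_iterate h

end Machine

/-! ### Turing machines with an accumulator -/

section Head

variable {K : Type u} [Semiring K] {ord : Option (SemiringOrder K)}

theorem branchRel_refl (a : K) : branchRel ord a a := by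
  cases ord with
  | none => rfl
  | some o => exact o.le_refl a

theorem branchRel_antisymm {a b : K} (h : branchRel ord a b) (h' : branchRel ord b a) :
    a = b := by
  cases ord with
  | none => exact h
  | some o => exact o.le_antisymm a b h h'

theorem exists_not_branchRel [Nontrivial K] (ord : Option (SemiringOrder K)) :
    ∃ c : K × K, ¬ branchRel ord c.1 c.2 := by
  by_contra! h
  exact zero_ne_one (branchRel_antisymm (h (0, 1)) (h (1, 0)))

/-- A two-sided infinite tape `U` over `K`, a head between the cells `p - 1` and `p`, and an
accumulator `A`. -/
@[ext]
structure Conf (K : Type u) where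
  U : ℤ → K
  p : ℤ
  A : K

/-- The state `x` represents a configuration: the tape is cut at the head, and a gap of three
coordinates is inserted. Coordinates `1` and `2` are scratch, coordinate `3` is the accumulator. -/
def Rep (x : State K) (s : Conf K) : Prop :=
  (∀ i ≤ 0, x i = s.U (s.p + i - 1)) ∧ x 3 = s.A ∧ ∀ i, 4 ≤ i → x i = s.U (s.p + i - 4)

theorem Rep.congr {x y : State K} {s : Conf K} (h : Rep x s)
    (hy : ∀ i, i ≠ 1 → i ≠ 2 → y i = x i) : Rep y s := by
  refine ⟨fun i hi => ?_, ?_, fun i hi => ?_⟩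
  · rw [hy i (by omega) (by omega), h.1 i hi]
  · rw [hy 3 (by omega) (by omega), h.2.1]
  · rw [hy i (by omega) (by omega), h.2.2 i hi]

/-- The coordinate of the tape cell at distance `j` from the head. -/
def slot (j : ℤ) : ℤ := if j < 0 then j + 1 else j + 4

theorem slot_spec (j : ℤ) : j < 0 ∧ slot j = j + 1 ∨ 0 ≤ j ∧ slot j = j + 4 := by
  unfold slot
  split_ifs with h
  · exact .inl ⟨h, rfl⟩
  · exact .inr ⟨by omega, rfl⟩

theorem Rep.slot {x : State K} {s : Conf K} (h : Rep x s) (j : ℤ) :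
    x (slot j) = s.U (s.p + j) := by
  rcases slot_spec j with ⟨hj, e⟩ | ⟨hj, e⟩
  · rw [e, h.1 _ (by omega)]
    congr 1
    ring
  · rw [e, h.2.2 _ (by omega)]
    congr 1
    ring

/-- `F` takes the configuration `s` to `s'` within `T` steps. -/
def Sim (ord : Option (SemiringOrder K)) (F : Frag K) (s s' : Conf K) (T : ℕ) : Prop :=
  ∀ x, Rep x s → ∃ y, ∃ t ≤ T, F.Exec ord x t y ∧ Rep y s'

/-- Within `T` steps, `F` sets up a branch node that tells whether `b` holds. -/
def IsTest (ord : Option (SemiringOrder K)) (F : Frag K) (s : Conf K) (b : Prop) (T : ℕ) : Prop :=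
  ∀ x, Rep x s → ∃ y, ∃ t ≤ T, F.Exec ord x t y ∧ Rep y s ∧ (branchRel ord (y 1) (y 2) ↔ b)

theorem Sim.mono {F : Frag K} {s s' : Conf K} {T T' : ℕ} (h : Sim ord F s s' T) (hT : T ≤ T') :
    Sim ord F s s' T' := fun x hx =>
  let ⟨y, t, ht, hy⟩ := h x hx
  ⟨y, t, ht.trans hT, hy⟩

theorem Sim.cast {F : Frag K} {s s' s'' : Conf K} {T T' : ℕ} (h : Sim ord F s s' T)
    (hs : s' = s'') (hT : T ≤ T') : Sim ord F s s'' T' :=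
  hs ▸ h.mono hT

theorem IsTest.congr {F : Frag K} {s : Conf K} {b b' : Prop} {T : ℕ} (h : IsTest ord F s b T)
    (hb : b ↔ b') : IsTest ord F s b' T :=
  propext hb ▸ h

theorem Sim.skip (s : Conf K) : Sim ord (Frag.skip K) s s 0 :=
  fun x hx => ⟨x, 0, le_rfl, Frag.exec_skip x, hx⟩

theorem Sim.seq {F G : Frag K} {s s' s'' : Conf K} {T T' : ℕ} (h : Sim ord F s s' T)
    (h' : Sim ord G s' s'' T') : Sim ord (F.seq G) s s'' (T + T') := by
  intro x hx
  obtain ⟨y, t, ht, hr, hy⟩ := h x hx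
  obtain ⟨z, t', ht', hr', hz⟩ := h' y hy
  exact ⟨z, t + t', by omega, hr.seq hr', hz⟩

/-- Run `F` or `G`, depending on the test `T`. -/
def Frag.ite (T F G : Frag K) : Frag K := T.seq (F.cond G)

theorem Sim.ite_pos {D F : Frag K} (G : Frag K) {s s' : Conf K} {b : Prop} {T T' : ℕ}
    (hD : IsTest ord D s b T) (hb : b) (h : Sim ord F s s' T') :
    Sim ord (D.ite F G) s s' (T + T' + 1) := by
  intro x hx
  obtain ⟨y, t, ht, hr, hy, hc⟩ := hD x hx
  obtain ⟨z, t', ht', hr', hz⟩ := h y hy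
  exact ⟨z, t + (t' + 1), by omega, hr.seq (.cond_pos G (hc.2 hb) hr'), hz⟩

theorem Sim.ite_neg {D : Frag K} (F : Frag K) {G : Frag K} {s s' : Conf K} {b : Prop} {T T' : ℕ}
    (hD : IsTest ord D s b T) (hb : ¬ b) (h : Sim ord G s s' T') :
    Sim ord (D.ite F G) s s' (T + T' + 1) := by
  intro x hx
  obtain ⟨y, t, ht, hr, hy, hc⟩ := hD x hx
  obtain ⟨z, t', ht', hr', hz⟩ := h y hy
  exact ⟨z, t + (t' + 1), by omega, hr.seq (.cond_neg F (mt hc.1 hb) hr'), hz⟩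

theorem Sim.loop_neg {D : Frag K} (F : Frag K) {s : Conf K} {b : Prop} {T : ℕ}
    (hD : IsTest ord D s b T) (hb : ¬ b) : Sim ord (D.loop F) s s (T + 1) := by
  intro x hx
  obtain ⟨y, t, ht, hr, hy, hc⟩ := hD x hx
  exact ⟨y, t + 1, by omega, hr.loop_neg F (mt hc.1 hb), hy⟩

theorem Sim.loop_pos {D F : Frag K} {s s' s'' : Conf K} {b : Prop} {T T' T'' : ℕ}
    (hD : IsTest ord D s b T) (hb : b) (h : Sim ord F s s' T')
    (h' : Sim ord (D.loop F) s' s'' T'') : Sim ord (D.loop F) s s'' (T + T' + 1 + T'') := by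
  intro x hx
  obtain ⟨y, t, ht, hr, hy, hc⟩ := hD x hx
  obtain ⟨z, t', ht', hr', hz⟩ := h y hy
  obtain ⟨z', t'', ht'', hr'', hz'⟩ := h' z hz
  exact ⟨z', _, by omega, hr.loop_pos (hc.2 hb) hr' hr'', hz'⟩

/-- A source of a value: the accumulator, the cell at distance `j` from the head, or a constant. -/
inductive Opd (K : Type u)
  | acc
  | cell (j : ℤ)
  | const (c : K)

/-- The value of an operand. -/
def Opd.val (s : Conf K) : Opd K → K
  | .acc => s.A
  | .cell j => s.U (s.p + j)
  | .const c => c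

/-- Assignments that copy an operand to coordinate `2`. There is no instruction for copying, so `0`
is added. -/
def Opd.load₂ : Opd K → List (ℤ × BSSOp K)
  | .acc => [(2, .const 0), (2, .add 3 2)]
  | .cell j => [(2, .const 0), (2, .add (slot j) 2)]
  | .const c => [(2, .const c)]

/-- Assignments that copy an operand to coordinate `1`. -/
def Opd.load₁ : Opd K → List (ℤ × BSSOp K)
  | .acc => [(2, .const 0), (1, .add 3 2)]
  | .cell j => [(2, .const 0), (1, .add (slot j) 2)]
  | .const c => [(1, .const c)]

theorem assignAll_append (l l' : List (ℤ × BSSOp K)) (x : State K) :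
    assignAll (l ++ l') x = assignAll l' (assignAll l x) := by
  induction l generalizing x with
  | nil => rfl
  | cons a l ih => exact ih _

theorem Opd.load₁_spec {x : State K} {s : Conf K} (h : Rep x s) (o : Opd K) :
    assignAll o.load₁ x 1 = o.val s ∧
      ∀ i, i ≠ 1 → i ≠ 2 → assignAll o.load₁ x i = x i := by
  cases o with
  | acc =>
    simp +contextual [Opd.load₁, assignAll, BSSOp.value, Opd.val, h.2.1]
  | cell j =>
    have : slot j ≠ 2 := by rcases slot_spec j with h | h <;> omega
    simp +contextual [Opd.load₁, assignAll, BSSOp.value, Opd.val, h.slot,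
      this]
  | const c =>
    simp +contextual [Opd.load₁, assignAll, BSSOp.value, Opd.val]

theorem Opd.load₂_spec {x : State K} {s : Conf K} (h : Rep x s) (o : Opd K) :
    assignAll o.load₂ x 2 = o.val s ∧ ∀ i, i ≠ 2 → assignAll o.load₂ x i = x i := by
  cases o with
  | acc =>
    simp +contextual [Opd.load₂, assignAll, BSSOp.value, Opd.val, h.2.1]
  | cell j =>
    have : slot j ≠ 2 := by rcases slot_spec j with h | h <;> omega
    simp +contextual [Opd.load₂, assignAll, BSSOp.value, Opd.val, h.slot,
      this]
  | const c =>
    simp +contextual [Opd.load₂, assignAll, BSSOp.value, Opd.val]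

/-- The state after copying two operands to coordinates `1` and `2`. -/
theorem load_spec {x : State K} {s : Conf K} (h : Rep x s) (o o' : Opd K) :
    assignAll (o.load₁ ++ o'.load₂) x 1 = o.val s ∧
    assignAll (o.load₁ ++ o'.load₂) x 2 = o'.val s ∧
      ∀ i, i ≠ 1 → i ≠ 2 → assignAll (o.load₁ ++ o'.load₂) x i = x i := by
  obtain ⟨h1, h2⟩ := o.load₁_spec h
  obtain ⟨h3, h4⟩ := o'.load₂_spec (h.congr h2)
  rw [assignAll_append]
  exact ⟨(h4 1 (by omega)).trans h1, h3, fun i hi hi' => (h4 i hi').trans (h2 i hi hi')⟩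

theorem load_length (o o' : Opd K) : (o.load₁ ++ o'.load₂).length ≤ 4 := by
  cases o <;> cases o' <;> simp [Opd.load₁, Opd.load₂]

/-- The two binary operations of a semiring. -/
inductive Arith
  | add
  | mul

/-- The value of an operation. -/
def Arith.val : Arith → K → K → K
  | .add, a, b => a + b
  | .mul, a, b => a * b

/-- The operation applied to the coordinates `1` and `2`. -/
def Arith.op : Arith → BSSOp K
  | .add => .add 1 2
  | .mul => .mul 1 2

theorem Arith.value_op (f : Arith) (x : State K) : f.op.value x = f.val (x 1) (x 2) := by
  cases f <;> rfl

/-- Set the accumulator. -/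
def setAcc (f : Arith) (o o' : Opd K) : Frag K := Frag.line (o.load₁ ++ o'.load₂ ++ [(3, f.op)])

/-- Set the cell at distance `j` from the head. -/
def setCell (j : ℤ) (f : Arith) (o o' : Opd K) : Frag K :=
  Frag.line (o.load₁ ++ o'.load₂ ++ [(slot j, f.op)])

theorem sim_setAcc (f : Arith) (o o' : Opd K) (s : Conf K) :
    Sim ord (setAcc f o o') s { s with A := f.val (o.val s) (o'.val s) } 5 := by
  intro x hx
  refine ⟨_, _, ?_, Frag.exec_line _ _, ?_⟩
  · have := load_length o o'
    rw [List.length_append]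
    exact Nat.add_le_add_right this 1
  · obtain ⟨h1, h2, h3⟩ := load_spec hx o o'
    rw [assignAll_append]
    obtain ⟨ha, hb, hc⟩ := hx.congr h3
    refine ⟨fun i hi => ?_, ?_, fun i hi => ?_⟩
    · simpa [assignAll, Function.update_apply, show i ≠ 3 by omega] using ha i hi
    · simp only [assignAll, Arith.value_op, h1, h2, Finsupp.coe_update, Function.update_self]
    · simpa [assignAll, Function.update_apply, show i ≠ 3 by omega] using hc i hi

theorem sim_setCell (j : ℤ) (f : Arith) (o o' : Opd K) (s : Conf K) :
    Sim ord (setCell j f o o') s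
      { s with U := Function.update s.U (s.p + j) (f.val (o.val s) (o'.val s)) } 5 := by
  intro x hx
  refine ⟨_, _, ?_, Frag.exec_line _ _, ?_⟩
  · have := load_length o o'
    rw [List.length_append]
    exact Nat.add_le_add_right this 1
  · obtain ⟨h1, h2, h3⟩ := load_spec hx o o'
    rw [assignAll_append]
    obtain ⟨ha, hb, hc⟩ := hx.congr h3
    have hs := slot_spec j
    refine ⟨fun i hi => ?_, ?_, fun i hi => ?_⟩
    · simp only [assignAll, Arith.value_op, h1, h2, Finsupp.coe_update, Function.update_apply]
      have : i = slot j ↔ s.p + i - 1 = s.p + j := by omega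
      simp only [this, ha i hi]
    · simpa [assignAll, Function.update_apply, show 3 ≠ slot j by omega] using hb
    · simp only [assignAll, Arith.value_op, h1, h2, Finsupp.coe_update, Function.update_apply]
      have : i = slot j ↔ s.p + i - 4 = s.p + j := by omega
      simp only [this, hc i hi]

/-- Move the head to the right. The cell to the right of the head moves to the other side of the
gap. -/
def moveRight (K : Type u) [Semiring K] : Frag K :=
  (Frag.line [(2, .const 0), (1, .add 4 2), (4, .add 3 2)]).seq (Frag.single (.shiftLeft none))

/-- Move the head to the left. -/
def moveLeft (K : Type u) [Semiring K] : Frag K :=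
  (Frag.line [(1, .const 0), (2, .add 3 1), (3, .add 0 1)]).seq (Frag.single (.shiftRight none))

theorem sim_moveRight (s : Conf K) : Sim ord (moveRight K) s { s with p := s.p + 1 } 4 := by
  intro x hx
  refine ⟨_, _, le_rfl, (Frag.exec_line _ _).seq (Frag.exec_single rfl), ?_⟩
  obtain ⟨ha, hb, hc⟩ := hx
  -- The cell to the right of the head was in coordinate `4`, and is now in coordinate `0`.
  refine ⟨fun i hi => ?_, ?_, fun i hi => ?_⟩
  · rw [shiftL_apply]
    obtain rfl | hi := hi.eq_or_lt
    · simp [assignAll, BSSOp.value, hc]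
    · have := ha (i + 1) (by omega)
      simp only [assignAll, Finsupp.coe_update, Function.update_apply,
        show i + 1 ≠ 4 by omega, show i + 1 ≠ 1 by omega, show i + 1 ≠ 2 by omega, if_false, this]
      congr 1
      ring
  · rw [shiftL_apply]
    simp [assignAll, BSSOp.value, hb]
  · rw [shiftL_apply]
    have := hc (i + 1) (by omega)
    simp only [assignAll, Finsupp.coe_update, Function.update_apply,
      show i + 1 ≠ 4 by omega, show i + 1 ≠ 1 by omega, show i + 1 ≠ 2 by omega, if_false, this]
    congr 1
    ring

theorem sim_moveLeft (s : Conf K) : Sim ord (moveLeft K) s { s with p := s.p - 1 } 4 := by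
  intro x hx
  refine ⟨_, _, le_rfl, (Frag.exec_line _ _).seq (Frag.exec_single rfl), ?_⟩
  obtain ⟨ha, hb, hc⟩ := hx
  refine ⟨fun i hi => ?_, ?_, fun i hi => ?_⟩
  · rw [shiftR_apply]
    have := ha (i - 1) (by omega)
    simp only [assignAll, Finsupp.coe_update, Function.update_apply,
      show i - 1 ≠ 3 by omega, show i - 1 ≠ 1 by omega, show i - 1 ≠ 2 by omega, if_false, this]
    congr 1
    ring
  · rw [shiftR_apply]
    simp [assignAll, BSSOp.value, hb]
  · rw [shiftR_apply]
    obtain rfl | hi := hi.eq_or_lt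
    · simp [assignAll, BSSOp.value, ha]
    · have := hc (i - 1) (by omega)
      simp only [assignAll, Finsupp.coe_update, Function.update_apply,
        show i - 1 ≠ 3 by omega, show i - 1 ≠ 1 by omega, show i - 1 ≠ 2 by omega, if_false, this]
      congr 1
      ring

/-- The test whether the branch relation holds between two operands. -/
def testRel (o o' : Opd K) : Frag K := Frag.line (o.load₁ ++ o'.load₂)

theorem isTest_testRel (o o' : Opd K) (s : Conf K) :
    IsTest ord (testRel o o') s (branchRel ord (o.val s) (o'.val s)) 4 := by
  intro x hx
  obtain ⟨h1, h2, h3⟩ := load_spec hx o o'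
  exact ⟨_, _, load_length o o', Frag.exec_line _ _, hx.congr h3, by rw [h1, h2]⟩

/-- Assign two constants to the coordinates `1` and `2`. -/
def setPair (c : K × K) : Frag K := Frag.line [(1, .const c.1), (2, .const c.2)]

theorem exec_setPair (c : K × K) (x : State K) : ∃ y, (setPair c).Exec ord x 2 y ∧
    (∀ i, i ≠ 1 → i ≠ 2 → y i = x i) ∧ y 1 = c.1 ∧ y 2 = c.2 := by
  refine ⟨_, Frag.exec_line _ _, fun i h1 h2 => ?_, ?_, ?_⟩ <;>
    simp [assignAll, BSSOp.value, *]

theorem setPair_spec {x : State K} {s : Conf K} (h : Rep x s) (c : K × K) :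
    ∃ y, (setPair c).Exec ord x 2 y ∧ Rep y s ∧ y 1 = c.1 ∧ y 2 = c.2 :=
  let ⟨y, hy, h0, h1, h2⟩ := exec_setPair c x
  ⟨y, hy, h.congr h0, h1, h2⟩

/-- The test whether two operands are equal. Over an ordered semiring it takes two branch nodes,
one for each of the two inequalities; `c` is a pair for which the branch relation fails. -/
def testEq (c : K × K) (o o' : Opd K) : Frag K :=
  (testRel o o').ite ((testRel o' o).ite (setPair 0) (setPair c)) (setPair c)

theorem isTest_testEq {c : K × K} (hc : ¬ branchRel ord c.1 c.2) (o o' : Opd K) (s : Conf K) :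
    IsTest ord (testEq c o o') s (o.val s = o'.val s) 12 := by
  intro x hx
  obtain ⟨y, t, ht, hr, hy, hb⟩ := isTest_testRel (ord := ord) o o' s x hx
  obtain ⟨y', t', ht', hr', hy', hb'⟩ := isTest_testRel (ord := ord) o' o s y hy
  by_cases h : branchRel ord (o.val s) (o'.val s)
  · by_cases h' : branchRel ord (o'.val s) (o.val s)
    · obtain ⟨z, hz, hzs, h1, h2⟩ := setPair_spec (ord := ord) hy' (0 : K × K)
      refine ⟨z, _, ?_, hr.seq (.cond_pos _ (hb.2 h) (hr'.seq (.cond_pos _ (hb'.2 h') hz))), hzs, ?_⟩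
      · omega
      · simp [h1, h2, branchRel_refl, branchRel_antisymm h h']
    · obtain ⟨z, hz, hzs, h1, h2⟩ := setPair_spec (ord := ord) hy' c
      refine ⟨z, _, ?_, hr.seq (.cond_pos _ (hb.2 h) (hr'.seq (.cond_neg _ (mt hb'.1 h') hz))),
        hzs, ?_⟩
      · omega
      · rw [h1, h2]
        refine iff_of_false hc fun e => h' ?_
        rw [e]
        exact branchRel_refl _
  · obtain ⟨z, hz, hzs, h1, h2⟩ := setPair_spec (ord := ord) hy c
    refine ⟨z, _, ?_, hr.seq (.cond_neg _ (mt hb.1 h) hz), hzs, ?_⟩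
    · omega
    · rw [h1, h2]
      refine iff_of_false hc fun e => h ?_
      rw [e]
      exact branchRel_refl _

end Head

/-! ### Counters, registers and a read-only word on a tape -/

section Blocks

variable {K : Type u} [Semiring K] {ord : Option (SemiringOrder K)}

/-- `F` repeated `n` times. -/
def Frag.rep : ℕ → Frag K → Frag K
  | 0, _ => Frag.skip K
  | n + 1, F => F.seq (F.rep n)

theorem Sim.rep {F : Frag K} {δ : ℤ} {τ : ℕ}
    (hF : ∀ s, Sim ord F s { s with p := s.p + δ } τ) (n : ℕ) (s : Conf K) :
    Sim ord (F.rep n) s { s with p := s.p + n * δ } (n * τ) := by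
  induction n generalizing s with
  | zero => exact (Sim.skip s).cast (by ext <;> simp) (by simp)
  | succ n ih =>
    refine ((hF s).seq (ih _)).cast (Conf.ext rfl ?_ rfl) (by rw [Nat.succ_mul, add_comm])
    push_cast
    ring

/-- Move the head `n` cells to the left. -/
def goLeft (K : Type u) [Semiring K] (n : ℕ) : Frag K := (moveLeft K).rep n

/-- Move the head `n` cells to the right. -/
def goRight (K : Type u) [Semiring K] (n : ℕ) : Frag K := (moveRight K).rep n

theorem sim_goLeft (n : ℕ) (s : Conf K) :
    Sim ord (goLeft K n) s { s with p := s.p + -n } (4 * n) :=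
  (Sim.rep (δ := -1) (fun s => sim_moveLeft s) n s).cast (by ext <;> simp) (by omega)

theorem sim_goRight (n : ℕ) (s : Conf K) :
    Sim ord (goRight K n) s { s with p := s.p + n } (4 * n) :=
  (Sim.rep (δ := 1) (fun s => sim_moveRight s) n s).cast (by ext <;> simp) (by omega)

/-- Repeat `F` while the cell at distance `j` from the head contains `a`. -/
def walk (c : K × K) (j : ℤ) (a : K) (F : Frag K) : Frag K :=
  (testEq c (.cell j) (.const a)).loop F

theorem sim_walk {c : K × K} (hc : ¬ branchRel ord c.1 c.2) (j : ℤ) (a : K) {F : Frag K} {δ : ℤ}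
    {τ : ℕ} (hF : ∀ s, Sim ord F s { s with p := s.p + δ } τ) (n : ℕ) (s : Conf K)
    (h1 : ∀ k < n, s.U (s.p + k * δ + j) = a) (h2 : s.U (s.p + n * δ + j) ≠ a) :
    Sim ord (walk c j a F) s { s with p := s.p + n * δ } ((n + 1) * (τ + 13)) := by
  induction n generalizing s with
  | zero =>
    exact (Sim.loop_neg F (isTest_testEq hc (.cell j) (.const a) s)
      (by simpa [Opd.val] using h2)).cast (by ext <;> simp) (by omega)
  | succ n ih =>
    have h0 := h1 0 (by omega)
    refine (Sim.loop_pos (isTest_testEq hc (.cell j) (.const a) s) (by simpa [Opd.val] using h0)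
      (hF s) (ih { s with p := s.p + δ } (fun k hk => ?_) ?_)).cast (Conf.ext rfl ?_ rfl) ?_
    · rw [← h1 (k + 1) (by omega)]
      push_cast
      ring_nf
    · rwa [show s.p + δ + n * δ + j = s.p + (n + 1 : ℕ) * δ + j by push_cast; ring]
    · push_cast
      ring
    · ring_nf
      omega

/-- Counters and registers. -/
structure St (K : Type u) where
  c : ℕ → ℕ
  r : ℕ → K

/-- The number of cells of a block: a flag, a letter, `m` counters, `q` registers, and one cell that
is always `0`. -/
def width (m q : ℕ) : ℕ := m + q + 3

/-- The content of cell `t` of block `b`. Cell `0` marks the first block, cell `1` contains the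
`b`-th letter of `w`, counters are kept in unary, and registers are kept in the first block. -/
def content (m q : ℕ) (w : List K) (s : St K) (b t : ℕ) : K :=
  if t = 0 then (if b = 0 then 1 else 0)
  else if t = 1 then w.getD b 0
  else if t < 2 + m then (if b < s.c (t - 2) then 1 else 0)
  else if t < 2 + m + q then (if b = 0 then s.r (t - 2 - m) else 0)
  else 0

/-- The tape `U` contains the word `w`, the counters `s.c i` with `i < m` and the registers `s.r j`
with `j < q`. The first block starts at cell `0`, and the other blocks are to its left. -/
def Holds (m q : ℕ) (w : List K) (s : St K) (U : ℤ → K) : Prop :=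
  ∀ b t : ℕ, t < width m q → U (t - width m q * b) = content m q w s b t

theorem cell_inj {W b b' t t' : ℕ} (ht : t < W) (ht' : t' < W)
    (h : (t : ℤ) - W * b = t' - W * b') : b = b' ∧ t = t' := by
  have h1 : (t : ℤ) + W * b' = t' + W * b := by linarith
  have h2 : t + W * b' = t' + W * b := by exact_mod_cast h1
  have h3 := congrArg (· % W) h2
  simp only [Nat.add_mul_mod_self_left, Nat.mod_eq_of_lt ht, Nat.mod_eq_of_lt ht'] at h3
  subst h3
  exact ⟨(Nat.eq_of_mul_eq_mul_left (by omega) (Nat.add_left_cancel h2)).symm, rfl⟩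

theorem Holds.update {m q : ℕ} {w w' : List K} {s s' : St K} {U : ℤ → K} (h : Holds m q w s U)
    {b t : ℕ} (ht : t < width m q) {a : K}
    (hs : ∀ b' t', t' < width m q → content m q w' s' b' t' =
      if b' = b ∧ t' = t then a else content m q w s b' t') :
    Holds m q w' s' (Function.update U (t - width m q * b) a) := by
  intro b' t' ht'
  rw [hs b' t' ht', Function.update_apply, h b' t' ht']
  refine if_congr ⟨fun e => cell_inj ht' ht e, ?_⟩ rfl rfl
  rintro ⟨rfl, rfl⟩
  rfl

theorem Holds.flag {m q : ℕ} {w : List K} {s : St K} {U : ℤ → K} (h : Holds m q w s U) (b : ℕ) :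
    U (-(width m q * b)) = if b = 0 then 1 else 0 := by
  have := h b 0 (by unfold width; omega)
  simpa [content] using this

theorem Holds.letter {m q : ℕ} {w : List K} {s : St K} {U : ℤ → K} (h : Holds m q w s U) (b : ℕ) :
    U (1 - width m q * b) = w.getD b 0 := by
  have := h b 1 (by unfold width; omega)
  simpa [content] using this

theorem Holds.counter {m q : ℕ} {w : List K} {s : St K} {U : ℤ → K} (h : Holds m q w s U) (b : ℕ)
    {i : ℕ} (hi : i < m) :
    U ((2 + i : ℕ) - width m q * b) = if b < s.c i then 1 else 0 := by
  have := h b (2 + i) (by unfold width; omega)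
  rwa [content, if_neg (by omega), if_neg (by omega), if_pos (by omega),
    show 2 + i - 2 = i by omega] at this

theorem Holds.register {m q : ℕ} {w : List K} {s : St K} {U : ℤ → K} (h : Holds m q w s U)
    {j : ℕ} (hj : j < q) : U ((2 + m + j : ℕ)) = s.r j := by
  have := h 0 (2 + m + j) (by unfold width; omega)
  rwa [content, if_neg (by omega), if_neg (by omega), if_neg (by omega), if_pos (by omega),
    if_pos rfl, show 2 + m + j - 2 - m = j by omega, Nat.cast_zero, mul_zero, sub_zero] at this

theorem Holds.setCounter {m q : ℕ} {w : List K} {s : St K} {U : ℤ → K} (h : Holds m q w s U)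
    {i b n : ℕ} (hi : i < m) {a : K}
    (hn : ∀ b', (if b' < n then (1 : K) else 0) = if b' = b then a else if b' < s.c i then 1 else 0) :
    Holds m q w { s with c := Function.update s.c i n }
      (Function.update U ((2 + i : ℕ) - width m q * b) a) := by
  refine h.update (by unfold width; omega) fun b' t' ht' => ?_
  by_cases ht : t' = 2 + i
  · subst ht
    simp only [content, show 2 + i ≠ 0 by omega, show 2 + i ≠ 1 by omega,
      show 2 + i < 2 + m by omega, if_true, if_false, show 2 + i - 2 = i by omega,
      Function.update_self, and_true]
    exact hn b'
  · rw [if_neg (by tauto)]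
    unfold content
    split_ifs <;> first | rfl | skip
    all_goals
      have e := Function.update_of_ne (show t' - 2 ≠ i by omega) n s.c
      simp_all

theorem Holds.setRegister {m q : ℕ} {w : List K} {s : St K} {U : ℤ → K} (h : Holds m q w s U)
    {j : ℕ} (hj : j < q) (a : K) :
    Holds m q w { s with r := Function.update s.r j a }
      (Function.update U ((2 + m + j : ℕ)) a) := by
  have := h.update (w' := w) (s' := { s with r := Function.update s.r j a }) (b := 0)
    (t := 2 + m + j) (a := a) (by unfold width; omega) fun b' t' ht' => ?_
  · simpa using this
  by_cases ht : t' = 2 + m + j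
  · subst ht
    by_cases hb : b' = 0
    · simp [content, hb, show 2 + m + j ≠ 1 by omega, hj, show 2 + m + j - 2 - m = j by omega]
    · simp [content, hb, show 2 + m + j ≠ 1 by omega]
  · rw [if_neg (by tauto)]
    unfold content
    split_ifs <;> first | rfl | skip
    exact Function.update_of_ne (by omega) _ _

theorem holds_congr {m q : ℕ} {w : List K} {s s' : St K} {U : ℤ → K} (h : Holds m q w s U)
    (hc : ∀ i < m, s'.c i = s.c i) (hr : ∀ j < q, s'.r j = s.r j) : Holds m q w s' U := by
  intro b t ht
  rw [h b t ht]
  unfold content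
  split_ifs <;> first | rfl | skip
  all_goals first
    | exact (hr _ (by omega)).symm
    | exact absurd (hc (t - 2) (by omega)) (by omega)

/-- At the start of the first block, `F` takes the counters and registers from `s` to `s'` within `T`
steps. -/
def SimSt (ord : Option (SemiringOrder K)) (m q : ℕ) (w : List K) (F : Frag K) (s s' : St K)
    (T : ℕ) : Prop :=
  ∀ U A, Holds m q w s U →
    ∃ U' A', Sim ord F ⟨U, 0, A⟩ ⟨U', 0, A'⟩ T ∧ Holds m q w s' U'

/-- At the start of the first block, `F` tests `b` within `T` steps. -/
def IsTestSt (ord : Option (SemiringOrder K)) (m q : ℕ) (w : List K) (F : Frag K) (s : St K)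
    (b : Prop) (T : ℕ) : Prop :=
  ∀ U A, Holds m q w s U → IsTest ord F ⟨U, 0, A⟩ b T

section SimSt

variable {m q : ℕ} {w : List K}

theorem SimSt.mono {F : Frag K} {s s' : St K} {T T' : ℕ} (h : SimSt ord m q w F s s' T)
    (hT : T ≤ T') : SimSt ord m q w F s s' T' := fun U A hU =>
  let ⟨U', A', h1, h2⟩ := h U A hU
  ⟨U', A', h1.mono hT, h2⟩

theorem SimSt.skip (s : St K) : SimSt ord m q w (Frag.skip K) s s 0 :=
  fun U A hU => ⟨U, A, Sim.skip _, hU⟩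

theorem SimSt.seq {F G : Frag K} {s s' s'' : St K} {T T' : ℕ} (h : SimSt ord m q w F s s' T)
    (h' : SimSt ord m q w G s' s'' T') : SimSt ord m q w (F.seq G) s s'' (T + T') := by
  intro U A hU
  obtain ⟨U', A', h1, h2⟩ := h U A hU
  obtain ⟨U'', A'', h3, h4⟩ := h' U' A' h2
  exact ⟨U'', A'', h1.seq h3, h4⟩

theorem SimSt.ite_pos {D F : Frag K} (G : Frag K) {s s' : St K} {b : Prop} {T T' : ℕ}
    (hD : IsTestSt ord m q w D s b T) (hb : b) (h : SimSt ord m q w F s s' T') :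
    SimSt ord m q w (D.ite F G) s s' (T + T' + 1) := by
  intro U A hU
  obtain ⟨U', A', h1, h2⟩ := h U A hU
  exact ⟨U', A', Sim.ite_pos G (hD U A hU) hb h1, h2⟩

theorem SimSt.ite_neg {D : Frag K} (F : Frag K) {G : Frag K} {s s' : St K} {b : Prop} {T T' : ℕ}
    (hD : IsTestSt ord m q w D s b T) (hb : ¬ b) (h : SimSt ord m q w G s s' T') :
    SimSt ord m q w (D.ite F G) s s' (T + T' + 1) := by
  intro U A hU
  obtain ⟨U', A', h1, h2⟩ := h U A hU
  exact ⟨U', A', Sim.ite_neg F (hD U A hU) hb h1, h2⟩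

theorem SimSt.loop_neg {D : Frag K} (F : Frag K) {s : St K} {b : Prop} {T : ℕ}
    (hD : IsTestSt ord m q w D s b T) (hb : ¬ b) : SimSt ord m q w (D.loop F) s s (T + 1) :=
  fun U A hU => ⟨U, A, Sim.loop_neg F (hD U A hU) hb, hU⟩

theorem SimSt.loop_pos {D F : Frag K} {s s' s'' : St K} {b : Prop} {T T' T'' : ℕ}
    (hD : IsTestSt ord m q w D s b T) (hb : b) (h : SimSt ord m q w F s s' T')
    (h' : SimSt ord m q w (D.loop F) s' s'' T'') :
    SimSt ord m q w (D.loop F) s s'' (T + T' + 1 + T'') := by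
  intro U A hU
  obtain ⟨U', A', h1, h2⟩ := h U A hU
  obtain ⟨U'', A'', h3, h4⟩ := h' U' A' h2
  exact ⟨U'', A'', Sim.loop_pos (hD U A hU) hb h1 h3, h4⟩

/-! ### Operations on counters and registers -/

/-- The number of steps for a walk over one block. -/
def pace (m q : ℕ) : ℕ := 4 * width m q + 20

/-- A bound for the time of an operation when all counters are at most `X`: a few walks over at most
`X + 1` blocks. -/
def opTime (m q X : ℕ) : ℕ := 5 * (pace m q * (X + 1))

theorem walk_le {m q n X : ℕ} (h : n ≤ X) :
    (n + 1) * (4 * width m q + 13) ≤ pace m q * (X + 1) := by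
  rw [mul_comm]
  exact Nat.mul_le_mul (by unfold pace; omega) (by omega)

theorem pace_le (m q X : ℕ) : 4 * width m q + 20 ≤ pace m q * (X + 1) :=
  Nat.le_mul_of_pos_right _ (Nat.succ_pos X)

/-- From the start of the block `b` to the start of the first block. -/
def goHome (c : K × K) (m q : ℕ) : Frag K := walk c 0 0 (goRight K (width m q))

/-- From the start of the first block to the first block that counter `i` does not reach. -/
def goEnd (c : K × K) (m q i : ℕ) : Frag K := walk c (2 + i : ℕ) 1 (goLeft K (width m q))

/-- Assign to register `j` the result of an operation on the registers `k` and `l`. -/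
def arithFrag (m : ℕ) (f : Arith) (j k l : ℕ) : Frag K :=
  setCell (2 + m + j : ℕ) f (.cell (2 + m + k : ℕ)) (.cell (2 + m + l : ℕ))

theorem simSt_arith {s : St K} {j k l : ℕ} (f : Arith) (hj : j < q) (hk : k < q) (hl : l < q)
    (X : ℕ) : SimSt ord m q w (arithFrag m f j k l) s
      { s with r := Function.update s.r j (f.val (s.r k) (s.r l)) } (opTime m q X) := by
  intro U A hU
  refine ⟨_, A, ?_, hU.setRegister hj _⟩
  refine (sim_setCell _ f _ _ _).cast (Conf.ext ?_ rfl rfl) ?_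
  · simp only [Opd.val, zero_add, hU.register hk, hU.register hl]
  · have := pace_le m q X
    unfold opTime
    omega

/-- Assign a constant to register `j`. -/
def constFrag (m j : ℕ) (a : K) : Frag K := setCell (2 + m + j : ℕ) .add (.const a) (.const 0)

theorem simSt_const {s : St K} {j : ℕ} (hj : j < q) (a : K) (X : ℕ) :
    SimSt ord m q w (constFrag m j a) s { s with r := Function.update s.r j a }
      (opTime m q X) := by
  intro U A hU
  refine ⟨_, A, ?_, hU.setRegister hj _⟩
  refine (sim_setCell _ _ _ _ _).cast (Conf.ext ?_ rfl rfl) ?_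
  · simp only [Opd.val, Arith.val, zero_add, add_zero]
  · have := pace_le m q X
    unfold opTime
    omega

/-- The test whether the registers `j` and `k` are equal. -/
def eqTest (c : K × K) (m j k : ℕ) : Frag K :=
  testEq c (.cell (2 + m + j : ℕ)) (.cell (2 + m + k : ℕ))

theorem isTestSt_eq {c : K × K} (hc : ¬ branchRel ord c.1 c.2) {s : St K} {j k : ℕ}
    (hj : j < q) (hk : k < q) :
    IsTestSt ord m q w (eqTest c m j k) s (s.r j = s.r k) 12 := by
  intro U A hU
  refine (isTest_testEq hc (.cell (2 + m + j : ℕ)) (.cell (2 + m + k : ℕ)) ⟨U, 0, A⟩).congr ?_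
  change U (0 + (2 + m + j : ℕ)) = U (0 + (2 + m + k : ℕ)) ↔ _
  rw [zero_add, zero_add, hU.register hj, hU.register hk]

/-- The test whether the branch relation holds between the registers `j` and `k`. -/
def relTest (m j k : ℕ) : Frag K := testRel (.cell (2 + m + j : ℕ)) (.cell (2 + m + k : ℕ))

theorem isTestSt_rel {s : St K} {j k : ℕ} (hj : j < q) (hk : k < q) :
    IsTestSt ord m q w (relTest m j k) s (branchRel ord (s.r j) (s.r k)) 12 := by
  intro U A hU x hx
  obtain ⟨y, t, ht, h⟩ := isTest_testRel (.cell (2 + m + j : ℕ)) (.cell (2 + m + k : ℕ)) ⟨U, 0, A⟩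
    x hx
  refine ⟨y, t, by omega, h.1, ?_⟩
  simpa only [Opd.val, zero_add, hU.register hj, hU.register hk] using h.2

variable {c : K × K} (hc : ¬ branchRel ord c.1 c.2) [Nontrivial K]

include hc in
theorem sim_goHome {s : St K} {U : ℤ → K} (h : Holds m q w s U) (b : ℕ) (A : K) :
    Sim ord (goHome c m q) ⟨U, -(width m q * b), A⟩ ⟨U, 0, A⟩
      ((b + 1) * (4 * width m q + 13)) := by
  refine (sim_walk hc 0 0 (sim_goRight (width m q)) b _ (fun k hk => ?_) ?_).cast
    (Conf.ext rfl ?_ rfl) le_rfl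
  · have := h.flag (b - k)
    rw [if_neg (by omega), Nat.cast_sub hk.le] at this
    rw [← this]
    ring_nf
  · have := h.flag 0
    rw [if_pos rfl] at this
    convert one_ne_zero (α := K)
    rw [← this]
    push_cast
    ring_nf
  · simp only
    ring

include hc in
theorem sim_goEnd {s : St K} {U : ℤ → K} (h : Holds m q w s U) {i : ℕ} (hi : i < m) (A : K) :
    Sim ord (goEnd c m q i) ⟨U, 0, A⟩ ⟨U, -(width m q * s.c i), A⟩
      ((s.c i + 1) * (4 * width m q + 13)) := by
  refine (sim_walk hc _ 1 (sim_goLeft (width m q)) (s.c i) _ (fun k hk => ?_) ?_).cast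
    (Conf.ext rfl ?_ rfl) le_rfl
  · have := h.counter k hi
    rw [if_pos hk] at this
    rw [← this]
    ring_nf
  · have := h.counter (s.c i) hi
    rw [if_neg (lt_irrefl _)] at this
    convert zero_ne_one (α := K)
    rw [← this]
    ring_nf
  · simp only
    ring

/-- Increment counter `i`. -/
def incFrag (c : K × K) (m q i : ℕ) : Frag K :=
  (goEnd c m q i).seq ((setCell (2 + i : ℕ) .add (.const 1) (.const 0)).seq (goHome c m q))

include hc in
theorem simSt_inc {s : St K} {X i : ℕ} (hi : i < m) (hX : s.c i ≤ X) :
    SimSt ord m q w (incFrag c m q i) s { s with c := Function.update s.c i (s.c i + 1) }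
      (opTime m q X) := by
  intro U A hU
  have hU' : Holds m q w { s with c := Function.update s.c i (s.c i + 1) }
      (Function.update U ((2 + i : ℕ) - width m q * s.c i) 1) := by
    refine hU.setCounter hi fun b' => ?_
    split_ifs <;> first | rfl | omega
  refine ⟨_, A, ?_, hU'⟩
  have h2 := sim_setCell (ord := ord) (2 + i : ℕ) .add (.const 1) (.const 0)
    ⟨U, -(width m q * s.c i), A⟩
  refine ((sim_goEnd hc hU hi A).seq ((h2.cast (s'' := ⟨Function.update U
    ((2 + i : ℕ) - width m q * s.c i) 1, -(width m q * s.c i), A⟩) ?_ le_rfl).seq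
    (sim_goHome hc hU' (s.c i) A))).mono ?_
  · simp only [Opd.val, Arith.val, add_zero, neg_add_eq_sub]
  · have := walk_le (m := m) (q := q) hX
    have := pace_le m q X
    unfold opTime
    omega

/-- Decrement counter `i`, which is assumed to be positive. -/
def decFrag (c : K × K) (m q i : ℕ) : Frag K :=
  (goEnd c m q i).seq ((goRight K (width m q)).seq
    ((setCell (2 + i : ℕ) .add (.const 0) (.const 0)).seq (goHome c m q)))

include hc in
theorem simSt_dec {s : St K} {X i : ℕ} (hi : i < m) (h0 : s.c i ≠ 0) (hX : s.c i ≤ X) :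
    SimSt ord m q w (decFrag c m q i) s { s with c := Function.update s.c i (s.c i - 1) }
      (opTime m q X) := by
  intro U A hU
  have hU' : Holds m q w { s with c := Function.update s.c i (s.c i - 1) }
      (Function.update U ((2 + i : ℕ) - width m q * (s.c i - 1 : ℕ)) 0) := by
    refine hU.setCounter hi fun b' => ?_
    split_ifs <;> first | rfl | omega
  refine ⟨_, A, ?_, hU'⟩
  have h1 : Sim ord (goRight K (width m q)) ⟨U, -(width m q * s.c i), A⟩
      ⟨U, -(width m q * (s.c i - 1 : ℕ)), A⟩ _ :=
    (sim_goRight (width m q) _).cast (Conf.ext rfl (by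
      simp only [Nat.cast_sub (Nat.one_le_iff_ne_zero.2 h0)]
      push_cast
      ring) rfl) le_rfl
  have h2 := sim_setCell (ord := ord) (2 + i : ℕ) .add (.const 0) (.const 0)
    ⟨U, -(width m q * (s.c i - 1 : ℕ)), A⟩
  refine ((sim_goEnd hc hU hi A).seq (h1.seq
    ((h2.cast (s'' := ⟨Function.update U
    ((2 + i : ℕ) - width m q * (s.c i - 1 : ℕ)) 0, -(width m q * (s.c i - 1 : ℕ)), A⟩)
    ?_ le_rfl).seq (sim_goHome hc hU' (s.c i - 1) A)))).mono ?_
  · simp only [Opd.val, Arith.val, add_zero, neg_add_eq_sub]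
  · have := walk_le (m := m) (q := q) hX
    have := walk_le (m := m) (q := q) (show s.c i - 1 ≤ X by omega)
    have := pace_le m q X
    unfold opTime
    omega

/-- Read the letter at the position given by counter `i` into the register `j`. -/
def readFrag (c : K × K) (m q i j : ℕ) : Frag K :=
  (goEnd c m q i).seq ((setAcc .add (.cell 1) (.const 0)).seq
    ((goHome c m q).seq (setCell (2 + m + j : ℕ) .add .acc (.const 0))))

include hc in
theorem simSt_read {s : St K} {X i j : ℕ} (hi : i < m) (hj : j < q) (hX : s.c i ≤ X) :
    SimSt ord m q w (readFrag c m q i j) s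
      { s with r := Function.update s.r j (w.getD (s.c i) 0) } (opTime m q X) := by
  intro U A hU
  refine ⟨_, w.getD (s.c i) 0, ?_, hU.setRegister hj _⟩
  have h1 : Sim ord (setAcc .add (.cell 1) (.const 0)) ⟨U, -(width m q * s.c i), A⟩
      ⟨U, -(width m q * s.c i), w.getD (s.c i) 0⟩ 5 :=
    (sim_setAcc .add (.cell 1) (.const 0) _).cast (Conf.ext rfl rfl
      (by simp only [Opd.val, Arith.val, add_zero, neg_add_eq_sub, hU.letter])) le_rfl
  have h2 := sim_setCell (ord := ord) (2 + m + j : ℕ) .add .acc (.const 0)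
    ⟨U, 0, w.getD (s.c i) 0⟩
  refine ((sim_goEnd hc hU hi A).seq (h1.seq
    ((sim_goHome hc hU (s.c i) _).seq (h2.cast (s'' := ⟨Function.update U (2 + m + j : ℕ)
      (w.getD (s.c i) 0), 0, _⟩) ?_ le_rfl)))).mono ?_
  · simp only [Opd.val, Arith.val, add_zero, zero_add]
  · have := walk_le (m := m) (q := q) hX
    have := pace_le m q X
    unfold opTime
    omega

/-- Copy counter `i` to counter `k`, which is assumed to be `0`. -/
def copyFrag (c : K × K) (m q i k : ℕ) : Frag K :=
  (walk c (2 + i : ℕ) 1 ((setCell (2 + k : ℕ) .add (.const 1) (.const 0)).seq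
    (goLeft K (width m q)))).seq (goHome c m q)

include hc in
theorem simSt_copy {s : St K} {X i k : ℕ} (hi : i < m) (hk : k < m) (hik : i ≠ k)
    (h0 : s.c k = 0) (hX : s.c i ≤ X) :
    SimSt ord m q w (copyFrag c m q i k) s { s with c := Function.update s.c k (s.c i) }
      (opTime m q X) := by
  have key : ∀ n b : ℕ, b + n = s.c i → ∀ U A,
      Holds m q w { s with c := Function.update s.c k b } U →
      ∃ U', Sim ord (walk c (2 + i : ℕ) 1 ((setCell (2 + k : ℕ) .add (.const 1) (.const 0)).seq
        (goLeft K (width m q)))) ⟨U, -(width m q * b), A⟩ ⟨U', -(width m q * s.c i), A⟩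
        ((n + 1) * pace m q) ∧ Holds m q w { s with c := Function.update s.c k (s.c i) } U' := by
    intro n
    induction n with
    | zero =>
      rintro b hb U A hU
      obtain rfl : b = s.c i := hb
      have h1 := hU.counter (s.c i) hi
      simp only [Function.update_of_ne hik, lt_irrefl, if_false] at h1
      refine ⟨U, (Sim.loop_neg _ (isTest_testEq hc (.cell (2 + i : ℕ)) (.const 1) _) ?_).mono ?_, hU⟩
      · simp only [Opd.val, neg_add_eq_sub, h1]
        exact zero_ne_one
      · unfold pace
        omega
    | succ n ih =>
      intro b hb U A hU
      have h1 := hU.counter b hi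
      rw [if_pos (by simp only [Function.update_of_ne hik]; omega)] at h1
      have hU' := hU.setCounter (b := b) (n := b + 1) (a := 1) hk fun b' => by
        simp only [Function.update_self]
        split_ifs <;> first | rfl | omega
      simp only [Function.update_idem] at hU'
      obtain ⟨U', hs, hU''⟩ := ih (b + 1) (by omega) _ A hU'
      have h2 : Sim ord (setCell (2 + k : ℕ) .add (.const 1) (.const 0))
          ⟨U, -(width m q * b), A⟩
          ⟨Function.update U ((2 + k : ℕ) - width m q * b) 1, -(width m q * b), A⟩ 5 :=
        (sim_setCell _ _ _ _ _).cast
          (by simp only [Opd.val, Arith.val, add_zero, neg_add_eq_sub]) le_rfl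
      have h3 : Sim ord (goLeft K (width m q))
          ⟨Function.update U ((2 + k : ℕ) - width m q * b) 1, -(width m q * b), A⟩
          ⟨Function.update U ((2 + k : ℕ) - width m q * b) 1, -(width m q * (b + 1 : ℕ)), A⟩ _ :=
        (sim_goLeft _ _).cast (Conf.ext rfl (by push_cast; ring) rfl) le_rfl
      refine ⟨U', (Sim.loop_pos (isTest_testEq hc (.cell (2 + i : ℕ)) (.const 1) _) ?_
        (h2.seq h3) hs).mono ?_, hU''⟩
      · simp only [Opd.val, neg_add_eq_sub, h1]
      · rw [Nat.succ_mul (n + 1)]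
        unfold pace
        omega
  intro U A hU
  have hs : s = { s with c := Function.update s.c k 0 } := by rw [← h0, Function.update_eq_self]
  obtain ⟨U', h1, hU'⟩ := key (s.c i) 0 (by omega) U A (hs ▸ hU)
  rw [Nat.cast_zero, mul_zero, neg_zero] at h1
  refine ⟨U', A, ((h1.seq (sim_goHome hc hU' (s.c i) A)).mono ?_), hU'⟩
  have := walk_le (m := m) (q := q) hX
  have : (s.c i + 1) * pace m q ≤ pace m q * (X + 1) := by
    rw [mul_comm]
    exact Nat.mul_le_mul_left _ (by omega)
  unfold opTime
  omega

/-- The test whether counter `i` is positive. -/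
def posTest (c : K × K) (i : ℕ) : Frag K := testEq c (.cell (2 + i : ℕ)) (.const 1)

include hc in
theorem isTestSt_pos {s : St K} {i : ℕ} (hi : i < m) :
    IsTestSt ord m q w (posTest c i) s (s.c i ≠ 0) 12 := by
  intro U A hU
  refine (isTest_testEq hc (.cell (2 + i : ℕ)) (.const 1) ⟨U, 0, A⟩).congr ?_
  have h := hU.counter 0 hi
  rw [Nat.cast_zero, mul_zero, sub_zero] at h
  change U (0 + (2 + i : ℕ)) = 1 ↔ _
  rw [zero_add, h, ← Nat.pos_iff_ne_zero]
  split_ifs with h <;> simp [h]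

end SimSt

end Blocks

/-! ### Loop programs -/

/-- The conditions of loop programs: counter `i` is positive, two registers are equal, and the branch
relation holds between two registers. -/
inductive LCond
  | pos (i : ℕ)
  | eq (j k : ℕ)
  | rel (j k : ℕ)

/-- Loop programs with counters in `ℕ`, registers in `K`, and a read-only word over `K`. The program
`read i j` copies the letter at the position given by counter `i` to register `j`, and `loop i P`
runs `P` as often as counter `i` says before the first run. -/
inductive LProg (K : Type u)
  | nop
  | inc (i : ℕ)
  | dec (i : ℕ)
  | read (i j : ℕ)
  | arith (f : Arith) (j k l : ℕ)
  | const (j : ℕ) (a : K)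
  | seq (P Q : LProg K)
  | ite (d : LCond) (P Q : LProg K)
  | loop (i : ℕ) (P : LProg K)

section Uses

variable {K : Type u}

/-- The counters and registers of a condition are below `m` and `q`. -/
def LCond.Uses (m q : ℕ) : LCond → Prop
  | .pos i => i < m
  | .eq j k => j < q ∧ k < q
  | .rel j k => j < q ∧ k < q

/-- The counters and registers of a loop program are below `m` and `q`. -/
def LProg.Uses (m q : ℕ) : LProg K → Prop
  | .nop => True
  | .inc i => i < m
  | .dec i => i < m
  | .read i j => i < m ∧ j < q
  | .arith _ j k l => j < q ∧ k < q ∧ l < q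
  | .const j _ => j < q
  | .seq P Q => P.Uses m q ∧ Q.Uses m q
  | .ite d P Q => d.Uses m q ∧ P.Uses m q ∧ Q.Uses m q
  | .loop i P => i < m ∧ P.Uses m q

theorem LCond.Uses.mono {m q m' q' : ℕ} (hm : m ≤ m') (hq : q ≤ q') {d : LCond}
    (h : d.Uses m q) : d.Uses m' q' := by
  cases d <;> simp only [LCond.Uses] at * <;> omega

theorem LProg.Uses.mono {m q m' q' : ℕ} (hm : m ≤ m') (hq : q ≤ q') {P : LProg K}
    (h : P.Uses m q) : P.Uses m' q' := by
  induction P with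
  | seq P Q ihP ihQ => exact ⟨ihP h.1, ihQ h.2⟩
  | ite d P Q ihP ihQ => exact ⟨h.1.mono hm hq, ihP h.2.1, ihQ h.2.2⟩
  | loop i P ih => exact ⟨h.1.trans_le hm, ih h.2⟩
  | _ => simp only [LProg.Uses] at * <;> omega

theorem LCond.exists_uses (d : LCond) : ∃ n, d.Uses n n := by
  cases d with
  | pos i => exact ⟨i + 1, Nat.lt_succ_self i⟩
  | eq j k => exact ⟨j + k + 1, by simp only [LCond.Uses]; omega⟩
  | rel j k => exact ⟨j + k + 1, by simp only [LCond.Uses]; omega⟩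

theorem LProg.exists_uses (P : LProg K) : ∃ n, P.Uses n n := by
  induction P with
  | nop => exact ⟨0, trivial⟩
  | inc i => exact ⟨i + 1, Nat.lt_succ_self i⟩
  | dec i => exact ⟨i + 1, Nat.lt_succ_self i⟩
  | read i j => exact ⟨i + j + 1, by simp only [LProg.Uses]; omega⟩
  | arith f j k l => exact ⟨j + k + l + 1, by simp only [LProg.Uses]; omega⟩
  | const j a => exact ⟨j + 1, Nat.lt_succ_self j⟩
  | seq P Q ihP ihQ =>
    obtain ⟨n, hn⟩ := ihP
    obtain ⟨n', hn'⟩ := ihQ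
    exact ⟨n + n', hn.mono (by omega) (by omega), hn'.mono (by omega) (by omega)⟩
  | ite d P Q ihP ihQ =>
    obtain ⟨n, hn⟩ := ihP
    obtain ⟨n', hn'⟩ := ihQ
    obtain ⟨n'', hn''⟩ := d.exists_uses
    exact ⟨n + n' + n'', hn''.mono (by omega) (by omega), hn.mono (by omega) (by omega),
      hn'.mono (by omega) (by omega)⟩
  | loop i P ih =>
    obtain ⟨n, hn⟩ := ih
    exact ⟨n + i + 1, by omega, hn.mono (by omega) (by omega)⟩

/-- The nesting depth of the loops. -/
def LProg.depth : LProg K → ℕ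
  | .seq P Q => max P.depth Q.depth
  | .ite _ P Q => max P.depth Q.depth
  | .loop _ P => P.depth + 1
  | _ => 0

end Uses

section LoopPrograms

variable {K : Type u} [Semiring K] {ord : Option (SemiringOrder K)} {w : List K}

/-- The meaning of a condition. -/
def LCond.holds (ord : Option (SemiringOrder K)) (s : St K) : LCond → Prop
  | .pos i => s.c i ≠ 0
  | .eq j k => s.r j = s.r k
  | .rel j k => branchRel ord (s.r j) (s.r k)

open Classical in
/-- The meaning of a loop program. -/
noncomputable def LProg.sem (ord : Option (SemiringOrder K)) (w : List K) : LProg K → St K → St K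
  | .nop, s => s
  | .inc i, s => { s with c := Function.update s.c i (s.c i + 1) }
  | .dec i, s => { s with c := Function.update s.c i (s.c i - 1) }
  | .read i j, s => { s with r := Function.update s.r j (w.getD (s.c i) 0) }
  | .arith f j k l, s => { s with r := Function.update s.r j (f.val (s.r k) (s.r l)) }
  | .const j a, s => { s with r := Function.update s.r j a }
  | .seq P Q, s => Q.sem ord w (P.sem ord w s)
  | .ite d P Q, s => if d.holds ord s then P.sem ord w s else Q.sem ord w s
  | .loop i P, s => (P.sem ord w)^[s.c i] s

open Classical in
/-- The number of operations that a loop program makes. -/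
noncomputable def LProg.cost (ord : Option (SemiringOrder K)) (w : List K) : LProg K → St K → ℕ
  | .nop, _ => 1
  | .inc _, _ => 1
  | .dec _, _ => 1
  | .read _ _, _ => 1
  | .arith _ _ _ _, _ => 1
  | .const _ _, _ => 1
  | .seq P Q, s => P.cost ord w s + Q.cost ord w (P.sem ord w s)
  | .ite d P Q, s => 1 + if d.holds ord s then P.cost ord w s else Q.cost ord w s
  | .loop i P, s => 1 + ∑ j ∈ Finset.range (s.c i), (1 + P.cost ord w ((P.sem ord w)^[j] s))

/-- An operation increases a counter by at most one, so that the counters are bounded by the cost. -/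
theorem LProg.sem_le (P : LProg K) {B : ℕ} (s : St K) (hB : ∀ i, s.c i ≤ B) (i : ℕ) :
    (P.sem ord w s).c i ≤ B + P.cost ord w s := by
  induction P generalizing s B i with
  | inc k =>
    simp only [sem, cost, Function.update_apply]
    have := hB i
    have := hB k
    split_ifs <;> omega
  | dec k =>
    simp only [sem, cost, Function.update_apply]
    have := hB i
    have := hB k
    split_ifs <;> omega
  | seq P Q ihP ihQ =>
    have := ihQ _ (ihP s hB) i
    simp only [sem, cost]
    omega
  | ite d P Q ihP ihQ =>
    have := ihP s hB i
    have := ihQ s hB i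
    simp only [sem, cost]
    split_ifs <;> omega
  | loop k P ih =>
    have key : ∀ n, ∀ i, ((P.sem ord w)^[n] s).c i ≤
        B + ∑ j ∈ Finset.range n, (1 + P.cost ord w ((P.sem ord w)^[j] s)) := by
      intro n
      induction n with
      | zero => simpa using hB
      | succ n ihn =>
        intro i
        have := ih _ ihn i
        rw [Function.iterate_succ_apply', Finset.sum_range_succ]
        omega
    have := key (s.c k) i
    simp only [sem, cost]
    omega
  | _ => exact (hB i).trans (Nat.le_add_right _ _)

/-- The flowchart for a condition. -/
def LCond.frag (c : K × K) (M : ℕ) : LCond → Frag K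
  | .pos i => posTest c i
  | .eq j k => eqTest c M j k
  | .rel j k => relTest M j k

/-- The flowchart for a loop program. The counters from `h` on are used to count the runs of the
bodies of loops. -/
def LProg.frag (c : K × K) (M q : ℕ) : ℕ → LProg K → Frag K
  | _, .nop => Frag.skip K
  | _, .inc i => incFrag c M q i
  | _, .dec i => (posTest c i).ite (decFrag c M q i) (Frag.skip K)
  | _, .read i j => readFrag c M q i j
  | _, .arith f j k l => arithFrag M f j k l
  | _, .const j a => constFrag M j a
  | h, .seq P Q => (P.frag c M q h).seq (Q.frag c M q h)
  | h, .ite d P Q => (d.frag c M).ite (P.frag c M q h) (Q.frag c M q h)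
  | h, .loop i P => (copyFrag c M q i h).seq
      ((posTest c h).loop ((decFrag c M q h).seq (P.frag c M q (h + 1))))

/-- The counters of a program, followed from `m` on by the counters for its loops. -/
def mix (m : ℕ) (c g : ℕ → ℕ) (i : ℕ) : ℕ := if i < m then c i else g i

theorem mix_of_lt {m i : ℕ} (h : i < m) (c g : ℕ → ℕ) : mix m c g i = c i := if_pos h

theorem mix_of_le {m i : ℕ} (h : m ≤ i) (c g : ℕ → ℕ) : mix m c g i = g i := if_neg (by omega)

theorem mix_update_of_lt {m i : ℕ} (h : i < m) (c g : ℕ → ℕ) (a : ℕ) :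
    Function.update (mix m c g) i a = mix m (Function.update c i a) g := by
  ext k
  simp only [mix, Function.update_apply]
  split_ifs <;> first | rfl | omega

theorem mix_update_of_le {m i : ℕ} (h : m ≤ i) (c g : ℕ → ℕ) (a : ℕ) :
    Function.update (mix m c g) i a = mix m c (Function.update g i a) := by
  ext k
  simp only [mix, Function.update_apply]
  split_ifs <;> first | rfl | omega

theorem isTestSt_cond [Nontrivial K] {c : K × K} (hc : ¬ branchRel ord c.1 c.2) {m q M : ℕ}
    (hM : m ≤ M) {d : LCond} (hd : d.Uses m q) (s : St K) (g : ℕ → ℕ) :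
    IsTestSt ord M q w (d.frag c M) ⟨mix m s.c g, s.r⟩ (d.holds ord s) 12 := by
  cases d with
  | pos i =>
    have := isTestSt_pos (ord := ord) (w := w) (q := q) hc (s := ⟨mix m s.c g, s.r⟩)
      (lt_of_lt_of_le hd hM)
    simp only [mix_of_lt (show i < m from hd)] at this
    exact this
  | eq j k => exact isTestSt_eq hc hd.1 hd.2
  | rel j k => exact isTestSt_rel hd.1 hd.2

/-- A bound for the time of one operation of a loop program, including the tests and the branch
nodes that are passed to reach it. -/
def unit (M q X : ℕ) : ℕ := opTime M q X + 30

/-- The flowchart for a loop program does what the program means. -/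
theorem simSt_frag [Nontrivial K] {c : K × K} (hc : ¬ branchRel ord c.1 c.2) {m q M X : ℕ}
    (P : LProg K) (hP : P.Uses m q) (h : ℕ) (hm : m ≤ h) (hM : h + P.depth ≤ M) (s : St K)
    (g : ℕ → ℕ) (hg : ∀ i, h ≤ i → g i = 0) (hX : ∀ i, s.c i + P.cost ord w s ≤ X) :
    SimSt ord M q w (P.frag c M q h) ⟨mix m s.c g, s.r⟩
      ⟨mix m (P.sem ord w s).c g, (P.sem ord w s).r⟩ (P.cost ord w s * unit M q X) := by
  induction P generalizing h s g with
  | nop => exact (SimSt.skip _).mono (Nat.zero_le _)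
  | inc i =>
    have hi : i < m := hP
    have := simSt_inc (ord := ord) (w := w) (m := M) (q := q) hc (s := ⟨mix m s.c g, s.r⟩) (X := X)
      (show i < M by omega) (by simpa only [mix_of_lt hi] using (Nat.le_add_right _ _).trans (hX i))
    simp only [mix_update_of_lt hi, mix_of_lt hi] at this
    exact this.mono (by simp only [LProg.cost, unit]; omega)
  | dec i =>
    have hi : i < m := hP
    have ht := isTestSt_pos (ord := ord) (w := w) (q := q) hc (s := ⟨mix m s.c g, s.r⟩)
      (show i < M by omega)
    by_cases h0 : s.c i = 0
    · have := SimSt.ite_neg (decFrag c M q i) ht (by simpa only [mix_of_lt hi, not_not] using h0)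
        (SimSt.skip _)
      have e : Function.update s.c i (s.c i - 1) = s.c := by
        rw [Function.update_eq_self_iff, h0]
      rw [LProg.sem, e]
      exact this.mono (by simp only [LProg.cost, unit]; omega)
    · have := simSt_dec (ord := ord) (w := w) (m := M) (q := q) hc (s := ⟨mix m s.c g, s.r⟩)
        (X := X) (show i < M by omega) (by simpa only [mix_of_lt hi] using h0)
        (by simpa only [mix_of_lt hi] using (Nat.le_add_right _ _).trans (hX i))
      simp only [mix_update_of_lt hi, mix_of_lt hi] at this
      exact (SimSt.ite_pos (Frag.skip K) ht (by simpa only [mix_of_lt hi] using h0) this).mono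
        (by simp only [LProg.cost, unit]; omega)
  | read i j =>
    have hi : i < m := hP.1
    have := simSt_read (ord := ord) (w := w) (m := M) (q := q) hc (s := ⟨mix m s.c g, s.r⟩) (X := X)
      (show i < M by omega) hP.2
      (by simpa only [mix_of_lt hi] using (Nat.le_add_right _ _).trans (hX i))
    simp only [mix_of_lt hi] at this
    exact this.mono (by simp only [LProg.cost, unit]; omega)
  | arith f j k l =>
    exact (simSt_arith f hP.1 hP.2.1 hP.2.2 X).mono (by simp only [LProg.cost, unit]; omega)
  | const j a => exact (simSt_const hP a X).mono (by simp only [LProg.cost, unit]; omega)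
  | seq P Q ihP ihQ =>
    simp only [LProg.depth] at hM
    simp only [LProg.cost] at hX
    have hB : ∀ i, s.c i ≤ X - (P.cost ord w s + Q.cost ord w (P.sem ord w s)) := fun i => by
      have := hX i
      omega
    refine ((ihP hP.1 h hm (by omega) s g hg fun i => ?_).seq
      (ihQ hP.2 h hm (by omega) _ g hg fun i => ?_)).mono (by rw [LProg.cost, add_mul])
    · have := hX i
      omega
    · have := P.sem_le (ord := ord) (w := w) s hB i
      have := hX i
      omega
  | ite d P Q ihP ihQ =>
    simp only [LProg.depth] at hM
    have ht := isTestSt_cond (ord := ord) (w := w) hc (show m ≤ M by omega) hP.1 s g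
    by_cases hd : d.holds ord s
    · simp only [LProg.cost, LProg.sem, if_pos hd] at hX ⊢
      refine (SimSt.ite_pos _ ht hd (ihP hP.2.1 h hm (by omega) s g hg fun i => ?_)).mono ?_
      · have := hX i
        omega
      · rw [add_mul]
        unfold unit
        omega
    · simp only [LProg.cost, LProg.sem, if_neg hd] at hX ⊢
      refine (SimSt.ite_neg _ ht hd (ihQ hP.2.2 h hm (by omega) s g hg fun i => ?_)).mono ?_
      · have := hX i
        omega
      · rw [add_mul]
        unfold unit
        omega
  | loop i P ih =>
    obtain ⟨hi, hP⟩ := hP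
    simp only [LProg.depth] at hM
    simp only [LProg.cost, LProg.sem] at hX ⊢
    have key : ∀ n ≤ X, ∀ s : St K, (∀ i, s.c i + ∑ j ∈ Finset.range n,
        (1 + P.cost ord w ((P.sem ord w)^[j] s)) ≤ X) →
        SimSt ord M q w ((posTest c h).loop ((decFrag c M q h).seq (P.frag c M q (h + 1))))
          ⟨mix m s.c (Function.update g h n), s.r⟩
          ⟨mix m ((P.sem ord w)^[n] s).c g, ((P.sem ord w)^[n] s).r⟩
          ((∑ j ∈ Finset.range n, (1 + P.cost ord w ((P.sem ord w)^[j] s))) * unit M q X + 13) := by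
      intro n
      induction n with
      | zero =>
        intro _ s _
        have e : Function.update g h 0 = g := by rw [Function.update_eq_self_iff, hg h le_rfl]
        have ht := isTestSt_pos (ord := ord) (w := w) (q := q) hc (s := ⟨mix m s.c g, s.r⟩)
          (show h < M by omega)
        rw [e]
        exact (SimSt.loop_neg _ ht (by simp only [mix_of_le hm, hg h le_rfl, not_not])).mono
          (by omega)
      | succ n ihn =>
        intro hn s hs
        have ht := isTestSt_pos (ord := ord) (w := w) (q := q) hc
          (s := ⟨mix m s.c (Function.update g h (n + 1)), s.r⟩) (show h < M by omega)
        have hd := simSt_dec (ord := ord) (w := w) (m := M) (q := q) hc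
          (s := ⟨mix m s.c (Function.update g h (n + 1)), s.r⟩) (X := X) (show h < M by omega)
          (by simp only [mix_of_le hm, Function.update_self]; omega)
          (by simpa only [mix_of_le hm, Function.update_self] using hn)
        simp only [mix_update_of_le hm, mix_of_le hm, Function.update_self, Function.update_idem,
          Nat.add_sub_cancel] at hd
        simp only [Finset.sum_range_succ', Function.iterate_succ_apply, Function.iterate_zero_apply]
          at hs ⊢
        have hB : ∀ i, s.c i ≤ X - (∑ j ∈ Finset.range n,
            (1 + P.cost ord w ((P.sem ord w)^[j] (P.sem ord w s))) + (1 + P.cost ord w s)) :=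
          fun i => by
            have := hs i
            omega
        have hb := ih hP (h + 1) (by omega) (by omega) s (Function.update g h n) (fun i hi => by
          rw [Function.update_of_ne (by omega), hg i (by omega)]) fun i => by
            have := hs i
            omega
        refine (SimSt.loop_pos ht (by simp [mix_of_le hm]) (hd.seq hb)
          (ihn (by omega) _ fun i => ?_)).mono ?_
        · have := P.sem_le (ord := ord) (w := w) s hB i
          have := hs i
          omega
        · simp only [add_mul, one_mul]
          unfold unit
          omega
    have hcp := simSt_copy (ord := ord) (w := w) (m := M) (q := q) hc (s := ⟨mix m s.c g, s.r⟩)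
      (X := X) (show i < M by omega) (show h < M by omega) (by omega)
      (by simp only [mix_of_le hm, hg h le_rfl])
      (by simpa only [mix_of_lt hi] using (Nat.le_add_right _ _).trans (hX i))
    simp only [mix_update_of_le hm, mix_of_lt hi] at hcp
    refine (hcp.seq (key (s.c i) ?_ s fun k => ?_)).mono ?_
    · have := hX i
      omega
    · have := hX k
      omega
    · rw [add_mul, one_mul]
      unfold unit
      omega

end LoopPrograms

/-! ### From the input to the tape -/

section Init

variable {K : Type u} [CommSemiring K] {ord : Option (SemiringOrder K)} {w : List K}

theorem inputMap_zero : inputMap w 0 = 0 := by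
  change inputCoord w 0 = 0
  simp [inputCoord]

theorem inputMap_one {i : ℤ} (h : -(w.length : ℤ) ≤ i) (h' : i ≤ -1) : inputMap w i = 1 := by
  change inputCoord w i = 1
  rw [inputCoord, if_neg (by omega), if_pos ⟨h, h'⟩]

theorem inputMap_left {i : ℤ} (h : i < -(w.length : ℤ)) : inputMap w i = 0 := by
  change inputCoord w i = 0
  rw [inputCoord, if_neg (by omega), if_neg (by omega)]

theorem inputMap_right (j : ℕ) : inputMap w (1 + j) = w.getD j 0 := by
  change inputCoord w (1 + j) = _
  by_cases h : j < w.length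
  · rw [inputCoord, if_pos (by omega), show (1 + (j : ℤ) - 1).toNat = j by omega]
  · rw [inputCoord, if_neg (by omega), if_neg (by omega),
      List.getD_eq_default _ _ (by omega)]

/-- The test whether coordinate `1` is `1`, when coordinate `2` is known to be `1`. Afterwards the
coordinates `1` and `2` only tell the result. -/
def oneTest (c : K × K) : Frag K :=
  ((Frag.line [(2, .mul 1 2), (1, .const 1)]).seq ((setPair 0).cond (setPair c))).cond (setPair c)

theorem exec_oneTest {c : K × K} (hc : ¬ branchRel ord c.1 c.2) {x : State K} (hx : x 2 = 1) :
    ∃ y, ∃ t ≤ 8, (oneTest c).Exec ord x t y ∧ (∀ i, i ≠ 1 → i ≠ 2 → y i = x i) ∧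
      (branchRel ord (y 1) (y 2) ↔ x 1 = 1) := by
  by_cases h : branchRel ord (x 1) (x 2)
  · set z := assignAll [(2, .mul 1 2), (1, .const 1)] x with hz
    have hz1 : z 1 = 1 := by simp [hz, assignAll, BSSOp.value]
    have hz2 : z 2 = x 1 := by simp [hz, assignAll, BSSOp.value, hx]
    have hz3 : ∀ i, i ≠ 1 → i ≠ 2 → z i = x i := fun i h1 h2 => by
      simp [hz, assignAll, h1, h2]
    by_cases h' : branchRel ord (z 1) (z 2)
    · obtain ⟨y, hy, h3, h1, h2⟩ := exec_setPair (ord := ord) 0 z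
      refine ⟨y, _, ?_, .cond_pos _ h ((Frag.exec_line _ _).seq (.cond_pos _ h' hy)),
        fun i hi hi' => (h3 i hi hi').trans (hz3 i hi hi'), ?_⟩
      · simp
      · rw [hx] at h
        rw [hz1, hz2] at h'
        simp [h1, h2, branchRel_refl, branchRel_antisymm h h']
    · obtain ⟨y, hy, h3, h1, h2⟩ := exec_setPair (ord := ord) c z
      refine ⟨y, _, ?_, .cond_pos _ h ((Frag.exec_line _ _).seq (.cond_neg _ h' hy)),
        fun i hi hi' => (h3 i hi hi').trans (hz3 i hi hi'), ?_⟩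
      · simp
      · rw [h1, h2]
        refine iff_of_false hc fun e => h' ?_
        rw [hz1, hz2, e]
        exact branchRel_refl _
  · obtain ⟨y, hy, h3, h1, h2⟩ := exec_setPair (ord := ord) c x
    refine ⟨y, _, ?_, .cond_neg _ h hy, h3, ?_⟩
    · omega
    · rw [h1, h2]
      refine iff_of_false hc fun e => h ?_
      rw [e, hx]
      exact branchRel_refl _

/-- Shift right over the ones to the left, which stand for the length of the input. -/
def skipOnes (c : K × K) : Frag K :=
  (oneTest c).loop ((setPair 1).seq (Frag.single (.shiftRight none)))

theorem exec_skipOnes {c : K × K} [Nontrivial K] (hc : ¬ branchRel ord c.1 c.2) (r : ℕ) :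
    ∀ (j : ℕ) (x : State K), j + r = w.length → 1 ≤ j → (∀ i, x i = inputMap w (i - (2 + j))) →
    ∃ y, ∃ t ≤ 12 * (r + 1), (skipOnes c).Exec ord x t y ∧
      ∀ i, i ≠ 1 → i ≠ 2 → y i = inputMap w (i - (2 + w.length)) := by
  induction r with
  | zero =>
    intro j x hj h1 hx
    obtain ⟨y, t, ht, he, hy, hb⟩ := exec_oneTest (x := x) hc
      ((hx 2).trans (inputMap_one (by omega) (by omega)))
    refine ⟨y, _, ?_, he.loop_neg _ ?_, fun i h1 h2 => ?_⟩
    · omega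
    · rw [hb, hx 1, inputMap_left (by omega)]
      exact zero_ne_one
    · rw [hy i h1 h2, hx i]
      congr 2
      omega
  | succ r ih =>
    intro j x hj h1 hx
    have hx1 : x 1 = 1 := (hx 1).trans (inputMap_one (by omega) (by omega))
    have hx2 : x 2 = 1 := (hx 2).trans (inputMap_one (by omega) (by omega))
    obtain ⟨y, t, ht, he, hy, hb⟩ := exec_oneTest hc hx2
    obtain ⟨z, hz, hz0, hz1, hz2⟩ := exec_setPair (ord := ord) 1 y
    have hzx : ∀ i, z i = x i := fun i => by
      by_cases h1 : i = 1
      · rw [h1, hz1, hx1]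
        rfl
      by_cases h2 : i = 2
      · rw [h2, hz2, hx2]
        rfl
      rw [hz0 i h1 h2, hy i h1 h2]
    obtain ⟨u, t', ht', hu, hu'⟩ := ih (j + 1) (shiftR z) (by omega) (by omega) fun i => by
      rw [shiftR_apply, hzx, hx]
      congr 1
      push_cast
      ring
    exact ⟨u, _, by omega, he.loop_pos (hb.2 hx1) (hz.seq (Frag.exec_single rfl)) hu, hu'⟩

/-- Shift right until the ones that stand for the length of the input start at coordinate `4`.

Tests destroy the coordinates `1` and `2`, so it has to be known what was there. After two shifts to
the right, coordinate `2` contains the `0` from the origin, and coordinate `1` contains a `1` unless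
the input is empty; both are restored after the test. When `skipOnes` stops, the two coordinates
contain the `0` to the left of the ones and the leftmost of the ones. -/
def toOnes (c : K × K) : Frag K :=
  (Frag.single (.shiftRight none)).seq <| (Frag.single (.shiftRight none)).seq <|
  (Frag.line [(2, .const 1)]).seq <|
  ((oneTest c).ite
    ((setPair (1, 0)).seq <| (Frag.single (.shiftRight none)).seq <|
      (skipOnes c).seq (setPair (0, 1)))
    (setPair 0)).seq <|
  (Frag.single (.shiftRight none)).seq (Frag.single (.shiftRight none))

theorem exec_toOnes {c : K × K} [Nontrivial K] (hc : ¬ branchRel ord c.1 c.2) (w : List K) :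
    ∃ y, ∃ t ≤ 12 * w.length + 30, (toOnes c).Exec ord (inputMap w) t y ∧
      ∀ i, y i = inputMap w (i - (4 + w.length)) := by
  set x := shiftR (shiftR (inputMap w)) with hx
  have hxi : ∀ i, x i = inputMap w (i - 2) := fun i => by
    rw [hx, shiftR_apply, shiftR_apply]
    congr 1
    ring
  set x' := assignAll [(2, .const 1)] x with hx'
  have hxi' : ∀ i, i ≠ 2 → x' i = inputMap w (i - 2) := fun i hi => by
    simp [hx', assignAll, hi, hxi]
  have hx2 : x' 2 = 1 := by simp [hx', assignAll, BSSOp.value]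
  have hstart : ∀ {F : Frag K} {t : ℕ} {y : State K}, F.Exec ord x' t y →
      ((Frag.single (.shiftRight none)).seq ((Frag.single (.shiftRight none)).seq
        ((Frag.line [(2, .const 1)]).seq F))).Exec ord (inputMap w) (1 + (1 + (1 + t))) y :=
    fun h => (Frag.exec_single rfl).seq ((Frag.exec_single rfl).seq ((Frag.exec_line _ _).seq h))
  have hend : ∀ y : State K, ((Frag.single (.shiftRight none)).seq
      (Frag.single (.shiftRight none))).Exec ord y 2 (shiftR (shiftR y)) :=
    fun y => (Frag.exec_single rfl).seq (Frag.exec_single rfl)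
  obtain ⟨y, t, ht, he, hy, hb⟩ := exec_oneTest hc hx2
  by_cases h0 : w.length = 0
  · have h1 : x' 1 = 0 := (hxi' 1 (by omega)).trans (inputMap_left (by omega))
    obtain ⟨z, hz, hz0, hz1, hz2⟩ := exec_setPair (ord := ord) 0 y
    refine ⟨_, _, ?_, hstart ((he.seq (.cond_neg _ (mt hb.1 (by simp [h1])) hz)).seq (hend _)), ?_⟩
    · omega
    · intro i
      rw [shiftR_apply, shiftR_apply, h0]
      by_cases h3 : i = 3
      · subst h3
        exact hz1.trans (inputMap_left (by omega)).symm
      by_cases h4 : i = 4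
      · subst h4
        exact hz2.trans inputMap_zero.symm
      rw [hz0 _ (by omega) (by omega), hy _ (by omega) (by omega), hxi' _ (by omega)]
      congr 1
      push_cast
      ring
  · have h1 : x' 1 = 1 := (hxi' 1 (by omega)).trans (inputMap_one (by omega) (by omega))
    obtain ⟨z, hz, hz0, hz1, hz2⟩ := exec_setPair (ord := ord) (1, 0) y
    obtain ⟨u, t', ht', hu, hu'⟩ := exec_skipOnes (ord := ord) (w := w) hc (w.length - 1) 1 (shiftR z)
      (by omega) le_rfl fun i => by
        rw [shiftR_apply]
        by_cases h1 : i = 2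
        · subst h1
          exact hz1.trans (inputMap_one (by omega) (by omega)).symm
        by_cases h2 : i = 3
        · subst h2
          exact hz2.trans inputMap_zero.symm
        rw [hz0 _ (by omega) (by omega), hy _ (by omega) (by omega), hxi' _ (by omega)]
        congr 1
        push_cast
        ring
    obtain ⟨v, hv, hv0, hv1, hv2⟩ := exec_setPair (ord := ord) (0, 1) u
    refine ⟨_, _, ?_, hstart ((he.seq (.cond_pos _ (hb.2 h1) (hz.seq ((Frag.exec_single rfl).seq
      (hu.seq hv))))).seq (hend _)), ?_⟩
    · omega
    · intro i
      rw [shiftR_apply, shiftR_apply]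
      by_cases h3 : i = 3
      · subst h3
        exact hv1.trans (inputMap_left (by omega)).symm
      by_cases h4 : i = 4
      · subst h4
        exact hv2.trans (inputMap_one (by omega) (by omega)).symm
      rw [hv0 _ (by omega) (by omega), hu' _ (by omega) (by omega)]
      congr 1
      ring

end Init

/-! ### Distributing the input over the blocks -/

section Spread

variable {K : Type u} [CommSemiring K] {ord : Option (SemiringOrder K)} {w : List K}

/-- Write a constant into the cell at distance `j` from the head. -/
def write (j : ℤ) (a : K) : Frag K := setCell j .add (.const a) (.const 0)

theorem sim_write (j : ℤ) (a : K) {U : ℤ → K} {p : ℤ} {A : K} :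
    Sim ord (write j a) ⟨U, p, A⟩ ⟨Function.update U (p + j) a, p, A⟩ 5 :=
  (sim_setCell j .add (.const a) (.const 0) _).cast (by simp only [Opd.val, Arith.val, add_zero])
    le_rfl

/-- Write the accumulator into the cell at distance `j` from the head. -/
def put (K : Type u) [Semiring K] (j : ℤ) : Frag K := setCell j .add .acc (.const 0)

theorem sim_put (j : ℤ) {U : ℤ → K} {p : ℤ} {A : K} :
    Sim ord (put K j) ⟨U, p, A⟩ ⟨Function.update U (p + j) A, p, A⟩ 5 :=
  (sim_setCell j .add .acc (.const 0) _).cast (by simp only [Opd.val, Arith.val, add_zero]) le_rfl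

/-- Read the cell at distance `j` from the head into the accumulator. -/
def fetch (K : Type u) [Semiring K] (j : ℤ) : Frag K := setAcc .add (.cell j) (.const 0)

theorem sim_fetch (j : ℤ) {U : ℤ → K} {p : ℤ} {A : K} :
    Sim ord (fetch K j) ⟨U, p, A⟩ ⟨U, p, U (p + j)⟩ 5 :=
  (sim_setAcc .add (.cell j) (.const 0) _).cast (by simp only [Opd.val, Arith.val, add_zero]) le_rfl

theorem sim_walkRight {c : K × K} (hc : ¬ branchRel ord c.1 c.2) {U : ℤ → K} {p : ℤ} {A : K}
    (p' : ℤ) (hp : p ≤ p') (h1 : ∀ z, p ≤ z → z < p' → U z = 1) (h2 : U p' ≠ 1) :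
    Sim ord (walk c 0 1 (moveRight K)) ⟨U, p, A⟩ ⟨U, p', A⟩ (((p' - p).toNat + 1) * 17) := by
  refine (sim_walk hc 0 1 (fun s => sim_moveRight s) (p' - p).toNat ⟨U, p, A⟩ (fun k hk => ?_)
    ?_).cast (Conf.ext rfl ?_ rfl) le_rfl
  · exact h1 _ (by simp only; omega) (by simp only; omega)
  · convert h2 using 2
    simp only
    omega
  · simp only
    omega

theorem sim_walkLeft {c : K × K} (hc : ¬ branchRel ord c.1 c.2) {U : ℤ → K} {p : ℤ} {A : K}
    (p' : ℤ) (hp : p' ≤ p) (h1 : ∀ z, p' < z → z ≤ p → U z = 1) (h2 : U p' ≠ 1) :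
    Sim ord (walk c 0 1 (moveLeft K)) ⟨U, p, A⟩ ⟨U, p', A⟩ (((p - p').toNat + 1) * 17) := by
  refine (sim_walk (δ := -1) hc 0 1 (fun s => sim_moveLeft s) (p - p').toNat ⟨U, p, A⟩
    (fun k hk => ?_) ?_).cast (Conf.ext rfl ?_ rfl) le_rfl
  · exact h1 _ (by simp only; omega) (by simp only; omega)
  · convert h2 using 2
    simp only
    omega
  · simp only
    omega

/-- Only the first counter is not zero, and all registers are zero. -/
def startSt (K : Type u) [Zero K] (n : ℕ) : St K := ⟨Function.update 0 0 n, 0⟩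

/-- The tape after the first `i` letters of the input have been moved to the blocks. To the right of
the first block there are `2 * i` ones, a zero, as many ones as there are letters left, a zero, and
then these letters: each of them leaves two cells, its own one and one of the ones. -/
structure Spread (m q : ℕ) (w : List K) (i : ℕ) (U : ℤ → K) : Prop where
  holds : Holds m q (w.take i) (startSt K i) U
  ones : ∀ z : ℤ, width m q ≤ z → z < width m q + 2 * i → U z = 1
  zero : U (width m q + 2 * i) = 0
  ones' : ∀ z : ℤ, width m q + 2 * i < z → z < width m q + w.length + i + 1 → U z = 1
  zero' : U (width m q + w.length + i + 1) = 0
  letters : ∀ j : ℕ, U (width m q + w.length + i + 2 + j) = w.getD (i + j) 0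

/-- Moves one letter of the input to the blocks. The head starts and stops at the first zero to the
right of the first block. -/
def spreadOne (c : K × K) (m q : ℕ) : Frag K :=
  (moveRight K).seq <| (walk c 0 1 (moveRight K)).seq <| (write 0 1).seq <| (fetch K 1).seq <|
  (write 1 0).seq <| (moveLeft K).seq <| (walk c 0 1 (moveLeft K)).seq <| (write 0 1).seq <|
  (write 2 0).seq <| (walk c 0 1 (moveLeft K)).seq <| (goLeft K (width m q - 1)).seq <|
  (goEnd c m q 0).seq <| (put K 1).seq <| (write 2 1).seq <| (goHome c m q).seq <|
  (goRight K (width m q)).seq <| walk c 0 1 (moveRight K)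

theorem Holds.update_right {m q : ℕ} {s : St K} {U : ℤ → K} (h : Holds m q w s U) {z : ℤ}
    (hz : width m q ≤ z) (a : K) : Holds m q w s (Function.update U z a) := by
  intro b t ht
  rw [Function.update_of_ne, h b t ht]
  have : 0 ≤ (width m q : ℤ) * b := by positivity
  omega

theorem Holds.pad {m q : ℕ} {s : St K} {U : ℤ → K} (h : Holds m q w s U) :
    U (width m q - 1) = 0 := by
  have := h 0 (width m q - 1) (by unfold width; omega)
  rw [content, if_neg (by unfold width; omega), if_neg (by unfold width; omega),
    if_neg (by unfold width; omega), if_neg (by unfold width; omega)] at this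
  rw [← this]
  congr 1
  unfold width
  omega

theorem Holds.append {m q i : ℕ} (hm : 0 < m) {U : ℤ → K} (hi : i < w.length)
    (h : Holds m q (w.take i) (startSt K i) U) :
    Holds m q (w.take (i + 1)) (startSt K (i + 1))
      (Function.update (Function.update U (-(width m q * i) + 1) (w.getD i 0))
        (-(width m q * i) + 2) 1) := by
  have h1 : Holds m q (w.take (i + 1)) (startSt K i)
      (Function.update U ((1 : ℕ) - width m q * i) (w.getD i 0)) := by
    refine h.update (by unfold width; omega) fun b t ht => ?_
    by_cases h1 : t = 1
    · subst h1
      simp only [content, one_ne_zero, if_false, if_true, and_true, List.getD_eq_getElem?_getD,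
        List.getElem?_take]
      split_ifs <;> first | rfl | omega | simp_all
    · rw [if_neg (by tauto)]
      simp only [content, h1, if_false]
  have h2 := h1.setCounter (b := i) (n := i + 1) (a := 1) hm fun b' => by
    simp only [startSt, Function.update_self]
    split_ifs <;> first | rfl | omega
  simp only [startSt, Function.update_idem] at h2 ⊢
  convert h2 using 2
  · congr 1
    push_cast
    ring
  · push_cast
    ring

theorem walkTime_le {m q n : ℕ} {z : ℤ} (hz : z ≤ 2 * n + 2) :
    (z.toNat + 1) * 17 ≤ 3 * (pace m q * (n + 1)) := by
  have h : 17 * (2 * n + 3) ≤ 3 * (20 * (n + 1)) := by omega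
  have h' : 20 * (n + 1) ≤ pace m q * (n + 1) := Nat.mul_le_mul_right _ (by unfold pace; omega)
  omega

theorem sim_spreadOne [Nontrivial K] {c : K × K} (hc : ¬ branchRel ord c.1 c.2) {m q i : ℕ}
    (hm : 0 < m) {U : ℤ → K} (A : K) (hi : i < w.length) (h : Spread m q w i U) :
    ∃ U' A', Sim ord (spreadOne c m q) ⟨U, width m q + 2 * i, A⟩
      ⟨U', width m q + 2 * (i + 1 : ℕ), A'⟩ (20 * (pace m q * (w.length + 1))) ∧
      Spread m q w (i + 1) U' := by
  have hW : 3 ≤ width m q := by unfold width; omega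
  have hWi : 0 ≤ (width m q : ℤ) * i := by positivity
  have ha : U (width m q + w.length + i + 2) = w.getD i 0 := by
    have := h.letters 0
    simpa using this
  generalize hP : (width m q : ℤ) + 2 * i = P at *
  generalize hQ : (width m q : ℤ) + w.length + i + 1 = Q at *
  set U₁ := Function.update U Q 1 with hU₁
  set U₂ := Function.update U₁ (Q + 1) 0 with hU₂
  set U₃ := Function.update U₂ P 1 with hU₃
  set U₄ := Function.update U₃ (P + 2) 0 with hU₄
  set U₅ := Function.update U₄ (-(width m q * i) + 1) (w.getD i 0) with hU₅
  set U₆ := Function.update U₅ (-(width m q * i) + 2) 1 with hU₆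
  have hzero := h.zero
  have hzero' := h.zero'
  rw [hP] at hzero
  rw [hQ] at hzero'
  have h4 : Holds m q (w.take i) (startSt K i) U₄ :=
    (((h.holds.update_right (by omega) _).update_right (by omega) _).update_right
      (by omega) _).update_right (by omega) _
  have h6 : Holds m q (w.take (i + 1)) (startSt K (i + 1)) U₆ := h4.append hm hi
  have e1 : Sim ord (moveRight K) ⟨U, P, A⟩ ⟨U, P + 1, A⟩ 4 := sim_moveRight _
  have e2 := sim_walkRight (A := A) hc (U := U) (p := P + 1) Q (by omega)
    (fun z h1 h2 => h.ones' z (by omega) (by omega)) (by rw [hzero']; exact zero_ne_one)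
  have e3 : Sim ord (write 0 1) ⟨U, Q, A⟩ ⟨U₁, Q, A⟩ 5 :=
    (sim_write 0 1).cast (by rw [add_zero]) le_rfl
  have e4 : Sim ord (fetch K 1) ⟨U₁, Q, A⟩ ⟨U₁, Q, w.getD i 0⟩ 5 :=
    (sim_fetch 1).cast (by
      rw [hU₁, Function.update_of_ne (by omega), ← ha]
      congr 2
      omega) le_rfl
  have e5 : Sim ord (write 1 0) ⟨U₁, Q, w.getD i 0⟩ ⟨U₂, Q, w.getD i 0⟩ 5 := sim_write 1 0
  have e6 : Sim ord (moveLeft K) ⟨U₂, Q, w.getD i 0⟩ ⟨U₂, Q - 1, w.getD i 0⟩ 4 := sim_moveLeft _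
  have e7 := sim_walkLeft (A := w.getD i 0) hc (U := U₂) (p := Q - 1) P (by omega)
    (fun z h1 h2 => by
      rw [hU₂, Function.update_of_ne (by omega), hU₁, Function.update_of_ne (by omega)]
      exact h.ones' z (by omega) (by omega))
    (by
      rw [hU₂, Function.update_of_ne (by omega), hU₁, Function.update_of_ne (by omega), hzero]
      exact zero_ne_one)
  have e8 : Sim ord (write 0 1) ⟨U₂, P, w.getD i 0⟩ ⟨U₃, P, w.getD i 0⟩ 5 :=
    (sim_write 0 1).cast (by rw [add_zero]) le_rfl
  have e9 : Sim ord (write 2 0) ⟨U₃, P, w.getD i 0⟩ ⟨U₄, P, w.getD i 0⟩ 5 := sim_write 2 0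
  have e10 := sim_walkLeft (A := w.getD i 0) hc (U := U₄) (p := P) (width m q - 1) (by omega)
    (fun z h1 h2 => by
      rw [hU₄, Function.update_of_ne (by omega), hU₃]
      by_cases hz : z = P
      · rw [hz, Function.update_self]
      · rw [Function.update_of_ne hz, hU₂, Function.update_of_ne (by omega), hU₁,
          Function.update_of_ne (by omega)]
        exact h.ones z (by omega) (by omega))
    (by rw [h4.pad]; exact zero_ne_one)
  have e11 : Sim ord (goLeft K (width m q - 1)) ⟨U₄, width m q - 1, w.getD i 0⟩
      ⟨U₄, 0, w.getD i 0⟩ _ :=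
    (sim_goLeft _ _).cast (Conf.ext rfl (by simp only; omega) rfl) le_rfl
  have e12 := sim_goEnd hc h4 hm (w.getD i 0)
  simp only [startSt, Function.update_self] at e12
  have e13 : Sim ord (put K 1) ⟨U₄, -(width m q * i), w.getD i 0⟩
    ⟨U₅, -(width m q * i), w.getD i 0⟩ 5 := sim_put 1
  have e14 : Sim ord (write 2 1) ⟨U₅, -(width m q * i), w.getD i 0⟩
    ⟨U₆, -(width m q * i), w.getD i 0⟩ 5 := sim_write 2 1
  have e15 := sim_goHome hc h6 i (w.getD i 0)
  have e16 : Sim ord (goRight K (width m q)) ⟨U₆, 0, w.getD i 0⟩ ⟨U₆, width m q, w.getD i 0⟩ _ :=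
    (sim_goRight _ _).cast (Conf.ext rfl (zero_add _) rfl) le_rfl
  have hright : ∀ z : ℤ, width m q ≤ z → U₆ z = U₄ z := fun z hz => by
    rw [hU₆, Function.update_of_ne (by omega), hU₅, Function.update_of_ne (by omega)]
  have hones : ∀ z : ℤ, width m q ≤ z → z < P + 2 → U₆ z = 1 := fun z h1 h2 => by
    rw [hright z h1, hU₄, Function.update_of_ne (by omega), hU₃]
    by_cases hz : z = P
    · rw [hz, Function.update_self]
    · rw [Function.update_of_ne hz, hU₂, Function.update_of_ne (by omega), hU₁,
        Function.update_of_ne (by omega)]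
      by_cases hz' : z < P
      · exact h.ones z (by omega) (by omega)
      · exact h.ones' z (by omega) (by omega)
  have hz : U₆ (P + 2) = 0 := by rw [hright _ (by omega), hU₄, Function.update_self]
  have e17 := sim_walkRight (A := w.getD i 0) hc (U := U₆) (p := width m q) (P + 2) (by omega)
    hones (by rw [hz]; exact zero_ne_one)
  clear_value U₆ U₅ U₄ U₃ U₂ U₁
  have hP2 : (width m q : ℤ) + 2 * (i + 1 : ℕ) = P + 2 := by push_cast; omega
  refine ⟨U₆, w.getD i 0, ?_, h6, ?_, ?_, ?_, ?_, ?_⟩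
  · rw [hP2]
    have e := e1.seq <| e2.seq <| e3.seq <| e4.seq <| e5.seq <| e6.seq <| e7.seq <| e8.seq <|
      e9.seq <| e10.seq <| e11.seq <| e12.seq <| e13.seq <| e14.seq <| e15.seq <| e16.seq e17
    refine Sim.mono e ?_
    clear e e1 e2 e3 e4 e5 e6 e7 e8 e9 e10 e11 e12 e13 e14 e15 e16 e17
    have h1 := walk_le (m := m) (q := q) hi.le
    have h2 := pace_le m q w.length
    have h3 : ((Q - (P + 1)).toNat + 1) * 17 ≤ _ := walkTime_le (m := m) (q := q) (n := w.length)
      (by omega)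
    have h4 : ((Q - 1 - P).toNat + 1) * 17 ≤ _ := walkTime_le (m := m) (q := q) (n := w.length)
      (by omega)
    have h5 : ((P - (width m q - 1)).toNat + 1) * 17 ≤ _ :=
      walkTime_le (m := m) (q := q) (n := w.length) (by omega)
    have h6 : ((P + 2 - width m q).toNat + 1) * 17 ≤ _ :=
      walkTime_le (m := m) (q := q) (n := w.length) (by omega)
    have h7 : 4 * (width m q - 1) ≤ 4 * width m q := by omega
    linarith
  · rwa [hP2]
  · rwa [hP2]
  · intro z h1 h2
    rw [hP2] at h1
    rw [hright z (by omega), hU₄, Function.update_of_ne (by omega), hU₃,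
      Function.update_of_ne (by omega), hU₂, Function.update_of_ne (by push_cast at h2; omega), hU₁]
    by_cases hz : z = Q
    · rw [hz, Function.update_self]
    · rw [Function.update_of_ne hz]
      exact h.ones' z (by omega) (by push_cast at h2; omega)
  · rw [show (width m q : ℤ) + w.length + (i + 1 : ℕ) + 1 = Q + 1 by push_cast; omega,
      hright _ (by omega), hU₄, Function.update_of_ne (by omega), hU₃,
      Function.update_of_ne (by omega), hU₂, Function.update_self]
  · intro j
    rw [show (width m q : ℤ) + w.length + (i + 1 : ℕ) + 2 + j = Q + 2 + j by push_cast; omega,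
      hright _ (by omega), hU₄, Function.update_of_ne (by omega), hU₃,
      Function.update_of_ne (by omega), hU₂, Function.update_of_ne (by omega), hU₁,
      Function.update_of_ne (by omega)]
    have := h.letters (j + 1)
    rw [show i + 1 + j = i + (j + 1) by ring, ← this]
    congr 1
    push_cast
    omega

theorem sim_spreadLoop [Nontrivial K] {c : K × K} (hc : ¬ branchRel ord c.1 c.2) {m q : ℕ}
    (hm : 0 < m) (r : ℕ) : ∀ (i : ℕ) (U : ℤ → K) (A : K), i + r = w.length → Spread m q w i U →
    ∃ U' A', Sim ord (walk c 1 1 (spreadOne c m q)) ⟨U, width m q + 2 * i, A⟩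
      ⟨U', width m q + 2 * w.length, A'⟩ (r * (20 * (pace m q * (w.length + 1)) + 13) + 13) ∧
      Spread m q w w.length U' := by
  induction r with
  | zero =>
    rintro i U A hi h
    obtain rfl : i = w.length := hi
    refine ⟨U, A, (Sim.loop_neg _ (isTest_testEq hc (.cell 1) (.const 1) _) ?_).mono (by omega), h⟩
    have := h.zero'
    simp only [Opd.val]
    rw [show (width m q : ℤ) + 2 * w.length + 1 = width m q + w.length + w.length + 1 by ring, this]
    exact zero_ne_one
  | succ r ih =>
    intro i U A hi h
    obtain ⟨U', A', h1, h'⟩ := sim_spreadOne hc hm A (by omega) h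
    obtain ⟨U'', A'', h2, h''⟩ := ih (i + 1) U' A' (by omega) h'
    refine ⟨U'', A'', (Sim.loop_pos (isTest_testEq hc (.cell 1) (.const 1) _) ?_ h1 h2).mono ?_,
      h''⟩
    · exact h.ones' _ (by simp only; omega) (by simp only; omega)
    · rw [Nat.succ_mul r]
      omega

/-- Brings the input into the block form: the ones and the input become the initial situation of
`Spread`, then the letters are moved one by one. -/
def initFrag (c : K × K) (m q : ℕ) : Frag K :=
  (toOnes c).seq <| (goLeft K (width m q + 1)).seq <| (write 0 1).seq <|
  (goRight K (width m q)).seq <| (walk c 1 1 (spreadOne c m q)).seq <| (moveLeft K).seq <|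
  (walk c 0 1 (moveLeft K)).seq (goLeft K (width m q - 1))

theorem spread_zero (m q : ℕ) (w : List K) : Spread m q w 0
    (Function.update (fun z => inputMap w (z - (width m q + 1) - w.length)) 0 1) := by
  have hW : 3 ≤ width m q := by unfold width; omega
  refine ⟨?_, ?_, ?_, ?_, ?_, ?_⟩
  · intro b t ht
    have hb : 0 ≤ (width m q : ℤ) * b := by positivity
    by_cases h : b = 0 ∧ t = 0
    · rw [h.1, h.2]
      simp [content]
    · rw [Function.update_of_ne fun e => h (cell_inj (b' := 0) (t' := 0) ht (by omega)
        (by simpa using e)), inputMap_left (by omega)]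
      unfold content
      split_ifs <;> first | rfl | tauto | simp_all [startSt]
  · intro z h1 h2
    omega
  · rw [Function.update_of_ne (by omega), inputMap_left (by omega)]
  · intro z h1 h2
    rw [Function.update_of_ne (by omega), inputMap_one (by omega) (by omega)]
  · rw [Function.update_of_ne (by omega)]
    convert inputMap_zero (w := w) using 2
    push_cast
    ring
  · intro j
    rw [Function.update_of_ne (by omega), zero_add, ← inputMap_right]
    congr 1
    push_cast
    ring

theorem exec_initFrag [Nontrivial K] {c : K × K} (hc : ¬ branchRel ord c.1 c.2) {m q : ℕ}
    (hm : 0 < m) (w : List K) :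
    ∃ y, ∃ t ≤ (w.length + 2) * (20 * (pace m q * (w.length + 1)) + 30),
      (initFrag c m q).Exec ord (inputMap w) t y ∧
      ∃ U A, Rep y ⟨U, 0, A⟩ ∧ Holds m q w (startSt K w.length) U := by
  have hW : 3 ≤ width m q := by unfold width; omega
  obtain ⟨x, t, ht, hx, hxi⟩ := exec_toOnes (ord := ord) hc w
  set U₀ : ℤ → K := fun z => inputMap w (z - (width m q + 1) - w.length) with hU₀
  have hrep : Rep x ⟨U₀, width m q + 1, 0⟩ := by
    refine ⟨fun i hi => ?_, ?_, fun i hi => ?_⟩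
    · rw [hxi, hU₀]
      exact (inputMap_left (by omega)).trans (inputMap_left (by simp only; omega)).symm
    · rw [hxi, inputMap_left (by omega)]
    · rw [hxi, hU₀]
      simp only
      congr 1
      ring
  obtain ⟨U, A, h5, hU⟩ := sim_spreadLoop hc hm w.length 0 _ 0 (zero_add _) (spread_zero m q w)
  have e2 : Sim ord (goLeft K (width m q + 1)) ⟨U₀, width m q + 1, 0⟩ ⟨U₀, 0, 0⟩ _ :=
    (sim_goLeft _ _).cast (Conf.ext rfl (by simp) rfl) le_rfl
  have e3 : Sim ord (write 0 1) ⟨U₀, 0, 0⟩ ⟨Function.update U₀ 0 1, 0, 0⟩ 5 := sim_write 0 1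
  have e4 : Sim ord (goRight K (width m q)) ⟨Function.update U₀ 0 1, 0, 0⟩
      ⟨Function.update U₀ 0 1, width m q + 2 * (0 : ℕ), 0⟩ _ :=
    (sim_goRight _ _).cast (Conf.ext rfl (by simp) rfl) le_rfl
  have e6 : Sim ord (moveLeft K) ⟨U, width m q + 2 * w.length, A⟩
    ⟨U, width m q + 2 * w.length - 1, A⟩ 4 := sim_moveLeft _
  have e7 := sim_walkLeft (A := A) hc (U := U) (p := width m q + 2 * w.length - 1)
    (width m q - 1) (by omega) (fun z h1 h2 => hU.ones z (by omega) (by omega))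
    (by rw [hU.holds.pad]; exact zero_ne_one)
  have e8 : Sim ord (goLeft K (width m q - 1)) ⟨U, width m q - 1, A⟩ ⟨U, 0, A⟩ _ :=
    (sim_goLeft _ _).cast (Conf.ext rfl (by simp only; omega) rfl) le_rfl
  obtain ⟨y, t', ht', hy, hyr⟩ := (e2.seq <| e3.seq <| e4.seq <| h5.seq <| e6.seq <| e7.seq e8) x
    hrep
  refine ⟨y, _, ?_, hx.seq hy, U, A, hyr, ?_⟩
  · clear e2 e3 e4 e6 e7 e8 h5
    have h2 := pace_le m q w.length
    have h3 : (((width m q : ℤ) + 2 * w.length - 1 - (width m q - 1)).toNat + 1) * 17 ≤ _ :=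
      walkTime_le (m := m) (q := q) (n := w.length) (by omega)
    have h4 : 4 * (width m q - 1) ≤ 4 * width m q := by omega
    linarith
  · have := hU.holds
    rwa [List.take_length] at this

/-! ### From loop programs to machines -/

theorem outputMap_eq [Nontrivial K] {y : State K} (h1 : y (-1) = 1) (h2 : y (-2) = 0) :
    outputMap y = [y 1] := by
  have h : outputLength y = 1 := by
    refine le_antisymm (Nat.sInf_le ?_) (le_csInf ⟨1, ?_⟩ fun l hl => ?_)
    · simp [h2]
    · simp [h2]
    · by_contra! h0
      obtain rfl : l = 0 := by omega
      exact hl (by simpa using h1)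
  unfold outputMap
  generalize outputLength y = l at h
  subst h
  simp

/-- Sets the output to the value of the first register. -/
def outFrag (K : Type u) [Semiring K] (m : ℕ) : Frag K :=
  Frag.line [(2, .const 0), (1, .add (slot (2 + m : ℕ)) 2), (-1, .const 1), (-2, .const 0)]

theorem exec_outFrag [Nontrivial K] {m q : ℕ} (hq : 0 < q) {s : St K} {U : ℤ → K}
    (h : Holds m q w s U) {x : State K} {A : K} (hx : Rep x ⟨U, 0, A⟩) :
    ∃ y, (outFrag K m).Exec ord x 4 y ∧ outputMap y = [s.r 0] := by
  refine ⟨_, Frag.exec_line _ _, ?_⟩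
  have h1 : x (slot (2 + m : ℕ)) = s.r 0 := by
    rw [hx.slot, ← h.register hq]
    simp
  have h2 : slot (2 + m : ℕ) ≠ 2 := by rcases slot_spec (2 + m : ℕ) with h | h <;> omega
  rw [outputMap_eq] <;>
    simp [assignAll, BSSOp.value, Function.update_apply, ← h1]
  intro e
  exact absurd e (by simpa using h2)

/-- A language is in `P_K` if its characteristic function is computed by a loop program with
polynomially many operations. -/
theorem mem_PClass_of_loopProgram [Nontrivial K] {L : Set (List K)} (P : LProg K) (e : ℕ)
    (hP : ∀ w, [(P.sem ord w (startSt K w.length)).r 0] = charFun L w)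
    (he : ∀ w, P.cost ord w (startSt K w.length) ≤ (w.length + 2) ^ e) : L ∈ PClass ord := by
  obtain ⟨c, hc⟩ := exists_not_branchRel ord
  obtain ⟨m', hm'⟩ := P.exists_uses
  set m := m' + 1 with hm
  set M := m + P.depth with hM
  set T : ℕ → ℕ := fun n => (n + 2) * (20 * (pace M m * (n + 1)) + 30) +
    (n + 2) ^ e * (5 * (pace M m * (n + (n + 2) ^ e + 1)) + 30) + 5 with hT
  have key : ∀ w : List K, ∃ t ≤ T w.length, ∃ y,
      (((initFrag c M m).seq ((P.frag c M m m).seq (outFrag K M))).machine.run ord w t) =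
        (Fin.last _, y) ∧ outputMap y = charFun L w := by
    intro w
    obtain ⟨x, t, ht, hx, U, A, hxU, hU⟩ := exec_initFrag hc (q := m) (show 0 < M by omega) w
    have hU' : Holds M m w ⟨mix m (startSt K w.length).c 0, (startSt K w.length).r⟩ U := by
      refine holds_congr hU (fun i _ => ?_) fun _ _ => rfl
      simp only [mix, startSt, Function.update_apply, Pi.zero_apply]
      split_ifs <;> first | rfl | omega
    obtain ⟨U', A', h1, h2⟩ := simSt_frag hc (M := M) P
      (hm'.mono (show m' ≤ m by omega) (show m' ≤ m by omega)) m le_rfl le_rfl (startSt K w.length) 0 (fun _ _ => rfl)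
      (X := w.length + P.cost ord w (startSt K w.length)) (fun i => by
        simp only [startSt, Function.update_apply, Pi.zero_apply]
        split_ifs <;> omega) U A hU'
    obtain ⟨y, t', ht', hy, hyr⟩ := h1 x hxU
    obtain ⟨z, hz, hz'⟩ := exec_outFrag (ord := ord) (show 0 < m by omega) h2 hyr
    refine ⟨_, ?_, z, Frag.machine_run (hx.seq (hy.seq hz)), hz'.trans (hP w)⟩
    have h3 : P.cost ord w (startSt K w.length) * unit M m
        (w.length + P.cost ord w (startSt K w.length)) ≤ (w.length + 2) ^ e *
        (5 * (pace M m * (w.length + (w.length + 2) ^ e + 1)) + 30) := by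
      unfold unit opTime
      have := he w
      gcongr
    rw [hT]
    simp only
    omega
  refine ⟨((initFrag c M m).seq ((P.frag c M m m).seq (outFrag K M))).machine, fun w => ?_,
    (Polynomial.X + 2) * (20 * (Polynomial.C (pace M m) * (Polynomial.X + 1)) + 30) +
    (Polynomial.X + 2) ^ e * (5 * (Polynomial.C (pace M m) *
    (Polynomial.X + (Polynomial.X + 2) ^ e + 1)) + 30) + 5, fun w => ?_⟩
  · obtain ⟨t, -, y, hy, ho⟩ := key w
    exact ⟨t, by rw [hy], by rw [hy, ho]⟩
  · obtain ⟨t, ht, y, hy, -⟩ := key w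
    refine ⟨t, ?_, by rw [hy]⟩
    simpa [hT] using ht

end Spread

/-! ### Polynomially bounded functions -/

section PolyBdd

variable {K : Type u} {m : ℕ}

/-- The size of a word together with numbers, which are thought of in unary. -/
def size (w : List K) (v : Fin m → ℕ) : ℕ := w.length + ∑ i, v i + 2

/-- Bounded by a power of the size of the arguments. -/
def PolyBdd (T : List K → (Fin m → ℕ) → ℕ) : Prop := ∃ e, ∀ w v, T w v ≤ size w v ^ e

variable {T T' : List K → (Fin m → ℕ) → ℕ}

theorem two_le_size (w : List K) (v : Fin m → ℕ) : 2 ≤ size w v := Nat.le_add_left _ _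

theorem PolyBdd.mono (h : PolyBdd T') (hT : ∀ w v, T w v ≤ T' w v) : PolyBdd T :=
  let ⟨e, he⟩ := h
  ⟨e, fun w v => (hT w v).trans (he w v)⟩

theorem PolyBdd.size : PolyBdd (fun (w : List K) (v : Fin m → ℕ) => size w v) :=
  ⟨1, fun _ _ => (pow_one _).ge⟩

theorem PolyBdd.const (n : ℕ) : PolyBdd (fun (_ : List K) (_ : Fin m → ℕ) => n) :=
  ⟨n, fun w v => n.lt_two_pow_self.le.trans (Nat.pow_le_pow_left (two_le_size w v) n)⟩

theorem PolyBdd.mul (h : PolyBdd T) (h' : PolyBdd T') : PolyBdd fun w v => T w v * T' w v := by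
  obtain ⟨e, he⟩ := h
  obtain ⟨e', he'⟩ := h'
  exact ⟨e + e', fun w v => by rw [pow_add]; exact Nat.mul_le_mul (he w v) (he' w v)⟩

theorem PolyBdd.add (h : PolyBdd T) (h' : PolyBdd T') : PolyBdd fun w v => T w v + T' w v := by
  obtain ⟨e, he⟩ := h
  obtain ⟨e', he'⟩ := h'
  refine ⟨e + e' + 1, fun w v => ?_⟩
  have h2 := two_le_size w v
  have h3 := (he w v).trans (Nat.pow_le_pow_right (by omega) (Nat.le_add_right e e'))
  have h4 := (he' w v).trans (Nat.pow_le_pow_right (by omega) (Nat.le_add_left e' e))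
  rw [pow_succ]
  have := Nat.mul_le_mul_left (SemiringMC.size w v ^ (e + e')) h2
  show T w v + T' w v ≤ _
  omega

theorem PolyBdd.pow (h : PolyBdd T) (n : ℕ) : PolyBdd fun w v => T w v ^ n := by
  obtain ⟨e, he⟩ := h
  exact ⟨e * n, fun w v => by rw [pow_mul]; exact Nat.pow_le_pow_left (he w v) n⟩

theorem size_snoc (w : List K) (v : Fin m → ℕ) (a : ℕ) :
    size w (Fin.snoc v a : Fin (m + 1) → ℕ) = size w v + a := by
  simp only [size, Fin.sum_univ_castSucc, Fin.snoc_castSucc, Fin.snoc_last]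
  omega

theorem size_init_le (w : List K) (v : Fin (m + 1) → ℕ) :
    size w (Fin.init v : Fin m → ℕ) ≤ size w v := by
  simp only [size, Fin.sum_univ_castSucc, Fin.init]
  omega

theorem PolyBdd.weaken (h : PolyBdd T) :
    PolyBdd fun w (v : Fin (m + 1) → ℕ) => T w (Fin.init v) := by
  obtain ⟨e, he⟩ := h
  exact ⟨e, fun w v => (he w _).trans (Nat.pow_le_pow_left (size_init_le w v) e)⟩

end PolyBdd

/-! ### Functions computed by loop programs -/

section Ready

variable {K : Type u}

/-- Counter `0` contains the length of the word, and all counters from `b` on are zero. -/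
structure Ready (w : List K) (b : ℕ) (s : St K) : Prop where
  pos : 0 < b
  len : s.c 0 = w.length
  zero : ∀ i, b ≤ i → s.c i = 0

theorem Ready.succ {w : List K} {b : ℕ} {s s' : St K} (h : Ready w b s) {x : ℕ}
    (hs : s'.c = Function.update s.c b x) : Ready w (b + 1) s' := by
  refine ⟨by omega, ?_, fun i hi => ?_⟩
  · rw [hs, Function.update_of_ne h.pos.ne, h.len]
  · rw [hs, Function.update_of_ne (by omega), h.zero i (by omega)]

theorem Ready.mono {w : List K} {b b' : ℕ} {s : St K} (h : Ready w b s) (hb : b ≤ b') :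
    Ready w b' s :=
  ⟨h.pos.trans_le hb, h.len, fun i hi => h.zero i (hb.trans hi)⟩

end Ready

section Calculus

variable {K : Type u} [CommSemiring K] {ord : Option (SemiringOrder K)} {m : ℕ}

theorem comp_update {ι : Fin m → ℕ} {b : ℕ} (h : ∀ i, ι i < b) (c : ℕ → ℕ) (x : ℕ) :
    Function.update c b x ∘ ι = c ∘ ι := by
  ext i
  exact Function.update_of_ne (h i).ne _ _

theorem snoc_lt {ι : Fin m → ℕ} {b b' k : ℕ} (h : ∀ i, ι i < b) (hb : b ≤ b') (hk : k < b') :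
    ∀ i, (Fin.snoc ι k : Fin (m + 1) → ℕ) i < b' := by
  intro i
  cases i using Fin.lastCases with
  | last => simpa using hk
  | cast i => simpa using (h i).trans_le hb

/-- Started in `s`, the program `P` writes `x` into counter `b`, changes no other counter, and no
register below `d`; it makes at most `T` operations. -/
def NSpec (ord : Option (SemiringOrder K)) (P : LProg K) (b d : ℕ) (w : List K) (s : St K)
    (x T : ℕ) : Prop :=
  (P.sem ord w s).c = Function.update s.c b x ∧ (∀ j < d, (P.sem ord w s).r j = s.r j) ∧
    P.cost ord w s ≤ T

/-- Started in `s`, the program `P` writes `x` into register `d`, and changes no counter and no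
register below `d`; it makes at most `T` operations. -/
def KSpec (ord : Option (SemiringOrder K)) (P : LProg K) (d : ℕ) (w : List K) (s : St K)
    (x : K) (T : ℕ) : Prop :=
  (P.sem ord w s).c = s.c ∧ (∀ j < d, (P.sem ord w s).r j = s.r j) ∧
    (P.sem ord w s).r d = x ∧ P.cost ord w s ≤ T

/-- The number-valued function `f` of words and numbers is computed by loop programs with
polynomially many operations. There is one program for each list `ι` of the counters with the
arguments, and for all `b` and `d` such that the counters from `b` and the registers from `d` on are
free. -/
def NComp (ord : Option (SemiringOrder K)) (f : List K → (Fin m → ℕ) → ℕ) : Prop :=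
  ∃ (P : (Fin m → ℕ) → ℕ → ℕ → LProg K) (T : List K → (Fin m → ℕ) → ℕ), PolyBdd T ∧
    ∀ ι b d w s, (∀ i, ι i < b) → Ready w b s →
      NSpec ord (P ι b d) b d w s (f w (s.c ∘ ι)) (T w (s.c ∘ ι))

/-- The analogue of `NComp` for functions with values in `K`. -/
def KComp (ord : Option (SemiringOrder K)) (f : List K → (Fin m → ℕ) → K) : Prop :=
  ∃ (P : (Fin m → ℕ) → ℕ → ℕ → LProg K) (T : List K → (Fin m → ℕ) → ℕ), PolyBdd T ∧
    ∀ ι b d w s, (∀ i, ι i < b) → Ready w b s →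
      KSpec ord (P ι b d) d w s (f w (s.c ∘ ι)) (T w (s.c ∘ ι))

open Classical in
/-- The analogue of `NComp` for predicates. -/
def PComp (ord : Option (SemiringOrder K)) (p : List K → (Fin m → ℕ) → Prop) : Prop :=
  NComp ord fun w v => if p w v then 1 else 0

section Macros

variable (w : List K) (s : St K) (i j : ℕ)

/-- Set counter `i` to zero. -/
def clearProg (K : Type u) (i : ℕ) : LProg K := .loop i (.dec i)

/-- Add counter `i` to counter `j`. -/
def addProg (K : Type u) (i j : ℕ) : LProg K := .loop i (.inc j)

/-- Subtract counter `i` from counter `j`. -/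
def subProg (K : Type u) (i j : ℕ) : LProg K := .loop i (.dec j)

/-- Move the value of counter `i` to counter `j`. -/
def moveProg (K : Type u) (i j : ℕ) : LProg K :=
  (clearProg K j).seq ((addProg K i j).seq (clearProg K i))

theorem iterate_dec (n : ℕ) : ((LProg.dec j).sem ord w)^[n] s =
    { s with c := Function.update s.c j (s.c j - n) } := by
  induction n with
  | zero => simp
  | succ n ih =>
    rw [Function.iterate_succ_apply', ih]
    simp only [LProg.sem, Function.update_self, Function.update_idem]
    rfl

theorem iterate_inc (n : ℕ) : ((LProg.inc j).sem ord w)^[n] s =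
    { s with c := Function.update s.c j (s.c j + n) } := by
  induction n with
  | zero => simp
  | succ n ih =>
    rw [Function.iterate_succ_apply', ih]
    simp only [LProg.sem, Function.update_self, Function.update_idem]
    rfl

theorem sem_subProg : (subProg K i j).sem ord w s =
    { s with c := Function.update s.c j (s.c j - s.c i) } := iterate_dec w s j _

theorem cost_subProg : (subProg K i j).cost ord w s = 1 + s.c i * 2 := by
  simp [subProg, LProg.cost]

theorem sem_clearProg : (clearProg K i).sem ord w s =
    { s with c := Function.update s.c i 0 } := by
  rw [← Nat.sub_self (s.c i)]
  exact iterate_dec w s i _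

theorem cost_clearProg : (clearProg K i).cost ord w s = 1 + s.c i * 2 := by
  simp [clearProg, LProg.cost]

theorem sem_addProg : (addProg K i j).sem ord w s =
    { s with c := Function.update s.c j (s.c j + s.c i) } := iterate_inc w s j _

theorem cost_addProg : (addProg K i j).cost ord w s = 1 + s.c i * 2 := by
  simp [addProg, LProg.cost]

theorem sem_moveProg (h : i ≠ j) : (moveProg K i j).sem ord w s =
    { s with c := Function.update (Function.update s.c j (s.c i)) i 0 } := by
  simp [moveProg, LProg.sem, sem_clearProg, sem_addProg, h]

theorem cost_moveProg (h : i ≠ j) : (moveProg K i j).cost ord w s =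
    3 + s.c j * 2 + s.c i * 4 := by
  simp only [moveProg, LProg.cost, sem_clearProg, sem_addProg, cost_clearProg, cost_addProg, ne_eq,
    h, not_false_eq_true, Function.update_of_ne]
  omega

end Macros

/-- The values of a function that is computed in polynomial time are polynomially bounded, since
they are kept in unary. -/
theorem NComp.polyBdd {f : List K → (Fin m → ℕ) → ℕ} (h : NComp ord f) : PolyBdd f := by
  obtain ⟨P, T, hT, h⟩ := h
  refine (PolyBdd.size.add hT).mono fun w v => ?_
  -- A state in which the counters `1`, …, `m` contain the arguments.
  let s : St K := ⟨fun i => if i = 0 then w.length else if h : i - 1 < m then v ⟨i - 1, h⟩ else 0, 0⟩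
  have hv : s.c ∘ (fun i : Fin m => (i : ℕ) + 1) = v := by
    ext i
    simp [s]
  obtain ⟨h1, -, h2⟩ := h (fun i => i + 1) (m + 1) 0 w s (fun i => by omega)
    ⟨by omega, by simp [s], fun i hi => by
      simp only [s]
      rw [if_neg (by omega), dif_neg (by omega)]⟩
  rw [hv] at h1 h2
  have h3 := (P (fun i => i + 1) (m + 1) 0).sem_le (ord := ord) (w := w) (B := size w v) s
    (fun i => by
      simp only [s]
      split_ifs with h0 h'
      · unfold size
        omega
      · have := Finset.single_le_sum (f := v) (fun _ _ => Nat.zero_le _)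
          (Finset.mem_univ ⟨i - 1, h'⟩)
        unfold size
        omega
      · omega) (m + 1)
  rw [h1, Function.update_self] at h3
  omega

theorem NComp.congr {f f' : List K → (Fin m → ℕ) → ℕ} (h : NComp ord f)
    (hf : ∀ w v, f' w v = f w v) : NComp ord f' := by
  obtain rfl : f' = f := funext fun w => funext fun v => hf w v
  exact h

theorem KComp.congr {f f' : List K → (Fin m → ℕ) → K} (h : KComp ord f)
    (hf : ∀ w v, f' w v = f w v) : KComp ord f' := by
  obtain rfl : f' = f := funext fun w => funext fun v => hf w v
  exact h

theorem NComp.weaken {f : List K → (Fin m → ℕ) → ℕ} (h : NComp ord f) :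
    NComp ord fun w (v : Fin (m + 1) → ℕ) => f w (Fin.init v) := by
  obtain ⟨P, T, hT, h⟩ := h
  exact ⟨fun ι b d => P (Fin.init ι) b d, _, hT.weaken,
    fun ι b d w s hι hs => h (Fin.init ι) b d w s (fun i => hι _) hs⟩

theorem NComp.var (i : Fin m) : NComp ord fun (_ : List K) v => v i := by
  refine ⟨fun ι b _ => addProg K (ι i) b, fun w v => 1 + v i * 2, ?_, ?_⟩
  · refine ((PolyBdd.const 1).add (PolyBdd.size.mul (.const 2))).mono fun w v => ?_
    have := Finset.single_le_sum (f := v) (fun _ _ => Nat.zero_le _) (Finset.mem_univ i)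
    unfold size
    omega
  · intro ι b d w s hι hs
    refine ⟨?_, ?_, ?_⟩
    · simp [sem_addProg, hs.zero b le_rfl]
    · simp [sem_addProg]
    · simp [cost_addProg]

theorem NComp.last : NComp ord fun (_ : List K) (v : Fin (m + 1) → ℕ) => v (Fin.last m) := .var _

theorem NComp.len : NComp ord fun (w : List K) (_ : Fin m → ℕ) => w.length := by
  refine ⟨fun ι b _ => addProg K 0 b, fun w v => 1 + w.length * 2, ?_, ?_⟩
  · refine ((PolyBdd.const 1).add (PolyBdd.size.mul (.const 2))).mono fun w v => ?_
    unfold size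
    omega
  · intro ι b d w s hι hs
    refine ⟨?_, ?_, ?_⟩
    · simp [sem_addProg, hs.zero b le_rfl, hs.len]
    · simp [sem_addProg]
    · simp [cost_addProg, hs.len]

theorem NComp.succ {f : List K → (Fin m → ℕ) → ℕ} (h : NComp ord f) :
    NComp ord fun w v => f w v + 1 := by
  obtain ⟨P, T, hT, h⟩ := h
  refine ⟨fun ι b d => (P ι b d).seq (.inc b), _, hT.add (.const 1), fun ι b d w s hι hs => ?_⟩
  obtain ⟨h1, h2, h3⟩ := h ι b d w s hι hs
  refine ⟨?_, fun j hj => ?_, ?_⟩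
  · simp [LProg.sem, h1]
  · simp only [LProg.sem, h2 j hj]
  · simpa [LProg.cost] using h3

theorem NComp.const (n : ℕ) : NComp ord fun (_ : List K) (_ : Fin m → ℕ) => n := by
  induction n with
  | zero =>
    refine ⟨fun _ _ _ => .nop, _, .const 1, fun ι b d w s hι hs => ⟨?_, fun _ _ => rfl, le_rfl⟩⟩
    exact (Function.update_eq_self_iff.2 (hs.zero b le_rfl).symm).symm
  | succ n ih => exact ih.succ

/-- Both arguments are computed in free counters, and the second one is cleared in the end. This is
the pattern of `NComp.add` and `NComp.sub`. -/
theorem NComp.binary (Q : ℕ → ℕ → LProg K) (o : ℕ → ℕ → ℕ)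
    (hQ : ∀ i j w s, (Q i j).sem ord w s = { s with c := Function.update s.c j (o (s.c j) (s.c i)) })
    (hQ' : ∀ i j w s, (Q i j).cost ord w s = 1 + s.c i * 2)
    {f g : List K → (Fin m → ℕ) → ℕ} (hf : NComp ord f) (hg : NComp ord g) :
    NComp ord fun w v => o (f w v) (g w v) := by
  have hgb := hg.polyBdd
  obtain ⟨P, T, hT, hf⟩ := hf
  obtain ⟨P', T', hT', hg⟩ := hg
  refine ⟨fun ι b d => (P ι b d).seq <| (P' ι (b + 1) d).seq <| (Q (b + 1) b).seq
    (clearProg K (b + 1)), fun w v => T w v + (T' w v + (1 + g w v * 2 + (1 + g w v * 2))),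
    hT.add (hT'.add (((PolyBdd.const 1).add (hgb.mul (.const 2))).add
      ((PolyBdd.const 1).add (hgb.mul (.const 2))))), fun ι b d w s hι hs => ?_⟩
  obtain ⟨h1, h2, h3⟩ := hf ι b d w s hι hs
  obtain ⟨h1', h2', h3'⟩ := hg ι (b + 1) d w _ (fun i => (hι i).trans (Nat.lt_succ_self b))
    (hs.succ h1)
  rw [h1, comp_update hι] at h1' h3'
  refine ⟨?_, fun j hj => ?_, ?_⟩
  · simp only [LProg.sem, hQ, sem_clearProg, h1']
    ext k
    have := hs.zero (b + 1) (by omega)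
    simp only [Function.update_apply]
    split_ifs <;> first | omega | simp_all
  · simp only [LProg.sem, hQ, sem_clearProg, h2' j hj, h2 j hj]
  · simp only [LProg.cost, hQ, hQ', cost_clearProg, h1', Function.update_self,
      Function.update_of_ne (show b + 1 ≠ b by omega)]
    omega

theorem NComp.add {f g : List K → (Fin m → ℕ) → ℕ} (hf : NComp ord f) (hg : NComp ord g) :
    NComp ord fun w v => f w v + g w v :=
  NComp.binary (addProg K) (· + ·) (fun i j w s => sem_addProg w s i j)
    (fun i j w s => cost_addProg w s i j) hf hg

theorem NComp.sub {f g : List K → (Fin m → ℕ) → ℕ} (hf : NComp ord f) (hg : NComp ord g) :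
    NComp ord fun w v => f w v - g w v :=
  NComp.binary (subProg K) (· - ·) (fun i j w s => sem_subProg w s i j)
    (fun i j w s => cost_subProg w s i j) hf hg

open Classical in
/-- Branching on whether a number is zero. -/
theorem NComp.ite' {f g h : List K → (Fin m → ℕ) → ℕ} (hf : NComp ord f) (hg : NComp ord g)
    (hh : NComp ord h) : NComp ord fun w v => if f w v ≠ 0 then g w v else h w v := by
  have hfb := hf.polyBdd
  obtain ⟨P, T, hT, hf⟩ := hf
  obtain ⟨P', T', hT', hg⟩ := hg
  obtain ⟨P'', T'', hT'', hh⟩ := hh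
  refine ⟨fun ι b d => (P ι b d).seq <| .ite (.pos b) ((clearProg K b).seq (P' ι b d)) (P'' ι b d),
    fun w v => T w v + (1 + (1 + f w v * 2 + T' w v + T'' w v)),
    hT.add ((PolyBdd.const 1).add ((((PolyBdd.const 1).add (hfb.mul (.const 2))).add hT').add hT'')),
    fun ι b d w s hι hs => ?_⟩
  obtain ⟨h1, h2, h3⟩ := hf ι b d w s hι hs
  have e : ∀ x, Function.update (Function.update s.c b x) b 0 = s.c := fun x => by
    rw [Function.update_idem, Function.update_eq_self_iff, hs.zero b le_rfl]
  by_cases h0 : f w (s.c ∘ ι) = 0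
  · rw [h0] at h1
    have hc : ((P ι b d).sem ord w s).c = s.c := by
      rw [h1, Function.update_eq_self_iff, hs.zero b le_rfl]
    obtain ⟨h1', h2', h3'⟩ := hh ι b d w ((P ι b d).sem ord w s) hι
      ⟨hs.pos, by rw [hc, hs.len], fun i hi => by rw [hc, hs.zero i hi]⟩
    rw [hc] at h1' h3'
    have hd : ¬ (LCond.pos b).holds ord ((P ι b d).sem ord w s) := by
      simp [LCond.holds, hc, hs.zero b le_rfl]
    refine ⟨?_, fun j hj => ?_, ?_⟩
    · simp only [LProg.sem, if_neg hd, h1', h0, ne_eq, not_true, if_false]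
    · simp only [LProg.sem, if_neg hd, h2' j hj, h2 j hj]
    · simp only [LProg.cost, if_neg hd]
      omega
  · have hd : (LCond.pos b).holds ord ((P ι b d).sem ord w s) := by
      simpa [LCond.holds, h1] using h0
    obtain ⟨h1', h2', h3'⟩ := hg ι b d w ((clearProg K b).sem ord w ((P ι b d).sem ord w s)) hι
      ⟨hs.pos, by rw [sem_clearProg, h1, e, hs.len], fun i hi => by
        rw [sem_clearProg, h1, e, hs.zero i hi]⟩
    simp only [sem_clearProg, h1, e] at h1' h3' h2'
    refine ⟨?_, fun j hj => ?_, ?_⟩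
    · simp only [LProg.sem, if_pos hd, sem_clearProg, h1, e, h1', ne_eq, h0, not_false_eq_true,
        if_true]
    · simp only [LProg.sem, if_pos hd, sem_clearProg, h1, e, h2' j hj, h2 j hj]
    · simp only [LProg.cost, if_pos hd, sem_clearProg, cost_clearProg, h1, e, Function.update_self]
      omega

open Classical in
theorem KComp.ite' {f : List K → (Fin m → ℕ) → ℕ} {g h : List K → (Fin m → ℕ) → K}
    (hf : NComp ord f) (hg : KComp ord g)
    (hh : KComp ord h) : KComp ord fun w v => if f w v ≠ 0 then g w v else h w v := by
  have hfb := hf.polyBdd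
  obtain ⟨P, T, hT, hf⟩ := hf
  obtain ⟨P', T', hT', hg⟩ := hg
  obtain ⟨P'', T'', hT'', hh⟩ := hh
  refine ⟨fun ι b d => (P ι b d).seq <| .ite (.pos b) ((clearProg K b).seq (P' ι b d)) (P'' ι b d),
    fun w v => T w v + (1 + (1 + f w v * 2 + T' w v + T'' w v)),
    hT.add ((PolyBdd.const 1).add ((((PolyBdd.const 1).add (hfb.mul (.const 2))).add hT').add hT'')),
    fun ι b d w s hι hs => ?_⟩
  obtain ⟨h1, h2, h3⟩ := hf ι b d w s hι hs
  have e : ∀ x, Function.update (Function.update s.c b x) b 0 = s.c := fun x => by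
    rw [Function.update_idem, Function.update_eq_self_iff, hs.zero b le_rfl]
  by_cases h0 : f w (s.c ∘ ι) = 0
  · rw [h0] at h1
    have hc : ((P ι b d).sem ord w s).c = s.c := by
      rw [h1, Function.update_eq_self_iff, hs.zero b le_rfl]
    obtain ⟨h1', h2', h4', h3'⟩ := hh ι b d w ((P ι b d).sem ord w s) hι
      ⟨hs.pos, by rw [hc, hs.len], fun i hi => by rw [hc, hs.zero i hi]⟩
    rw [hc] at h1' h3' h4'
    have hd : ¬ (LCond.pos b).holds ord ((P ι b d).sem ord w s) := by
      simp [LCond.holds, hc, hs.zero b le_rfl]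
    refine ⟨?_, fun j hj => ?_, ?_, ?_⟩
    · simp only [LProg.sem, if_neg hd, h1']
    · simp only [LProg.sem, if_neg hd, h2' j hj, h2 j hj]
    · simp only [LProg.sem, if_neg hd, h4', h0, ne_eq, not_true, if_false]
    · simp only [LProg.cost, if_neg hd]
      omega
  · have hd : (LCond.pos b).holds ord ((P ι b d).sem ord w s) := by
      simpa [LCond.holds, h1] using h0
    obtain ⟨h1', h2', h4', h3'⟩ := hg ι b d w ((clearProg K b).sem ord w ((P ι b d).sem ord w s)) hι
      ⟨hs.pos, by rw [sem_clearProg, h1, e, hs.len], fun i hi => by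
        rw [sem_clearProg, h1, e, hs.zero i hi]⟩
    simp only [sem_clearProg, h1, e] at h1' h3' h2' h4'
    refine ⟨?_, fun j hj => ?_, ?_, ?_⟩
    · simp only [LProg.sem, if_pos hd, sem_clearProg, h1, e, h1']
    · simp only [LProg.sem, if_pos hd, sem_clearProg, h1, e, h2' j hj, h2 j hj]
    · simp only [LProg.sem, if_pos hd, sem_clearProg, h1, e, h4', ne_eq, h0, not_false_eq_true,
        if_true]
    · simp only [LProg.cost, if_pos hd, sem_clearProg, cost_clearProg, h1, e, Function.update_self]
      omega

end Calculus

/-! ### Recursion, search and folding -/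

section Recursion

variable {K : Type u} [CommSemiring K] {ord : Option (SemiringOrder K)} {m : ℕ}

theorem comp_snoc (c : ℕ → ℕ) (ι : Fin m → ℕ) (k : ℕ) :
    c ∘ (Fin.snoc ι k : Fin (m + 1) → ℕ) = Fin.snoc (c ∘ ι) (c k) := by
  ext i
  cases i using Fin.lastCases <;> simp

theorem cost_loop_le {P : LProg K} {i : ℕ} {w : List K} {s : St K} {M : ℕ}
    (h : ∀ j < s.c i, P.cost ord w ((P.sem ord w)^[j] s) ≤ M) :
    (LProg.loop i P).cost ord w s ≤ 1 + s.c i * (1 + M) := by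
  rw [LProg.cost]
  refine Nat.add_le_add_left ((Finset.sum_le_card_nsmul _ _ (1 + M) fun j hj => ?_).trans ?_) _
  · exact Nat.add_le_add_left (h j (Finset.mem_range.1 hj)) _
  · simp

/-- Primitive recursion, for polynomially bounded intermediate values. -/
theorem NComp.recursion {F : List K → (Fin m → ℕ) → ℕ → ℕ} {n f : List K → (Fin m → ℕ) → ℕ}
    {h : List K → (Fin m → ℕ) → ℕ → ℕ → ℕ} {R : List K → (Fin m → ℕ) → ℕ}
    (F0 : ∀ w v, F w v 0 = f w v) (Fs : ∀ w v i, F w v (i + 1) = h w v i (F w v i))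
    (hn : NComp ord n) (hf : NComp ord f)
    (hh : NComp ord fun w (v : Fin (m + 1 + 1) → ℕ) =>
      h w (Fin.init (Fin.init v)) (v (Fin.last m).castSucc) (v (Fin.last (m + 1))))
    (hR : PolyBdd R) (hFR : ∀ w v, ∀ i ≤ n w v, F w v i ≤ R w v) :
    NComp ord fun w v => F w v (n w v) := by
  have hnb := hn.polyBdd
  obtain ⟨P, T, hT, hn⟩ := hn
  obtain ⟨P', T', hT', hf⟩ := hf
  obtain ⟨P'', T'', ⟨e, he⟩, hh⟩ := hh
  -- Counter `b` contains the number of rounds, `b + 1` the number of the current round, `b + 2` the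
  -- current value, and `b + 3` receives the next one.
  let body : (Fin m → ℕ) → ℕ → ℕ → LProg K := fun ι b d =>
    (P'' (Fin.snoc (Fin.snoc ι (b + 1) : Fin (m + 1) → ℕ) (b + 2)) (b + 3) d).seq
      ((moveProg K (b + 3) (b + 2)).seq (.inc (b + 1)))
  have bnd : PolyBdd fun w v => (size w v + n w v + R w v) ^ e :=
    ((PolyBdd.size.add hnb).add hR).pow e
  refine ⟨fun ι b d => (P ι b d).seq <| (P' ι (b + 2) d).seq <| (LProg.loop b (body ι b d)).seq <|
    (moveProg K (b + 2) b).seq (clearProg K (b + 1)),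
    fun w v => T w v + (T' w v + ((1 + n w v * (1 + ((size w v + n w v + R w v) ^ e + (4 + R w v * 6))))
      + ((3 + n w v * 2 + R w v * 4) + (1 + n w v * 2)))),
    hT.add (hT'.add (((PolyBdd.const 1).add (hnb.mul ((PolyBdd.const 1).add (bnd.add
      ((PolyBdd.const 4).add (hR.mul (.const 6))))))).add ((((PolyBdd.const 3).add
      (hnb.mul (.const 2))).add (hR.mul (.const 4))).add ((PolyBdd.const 1).add
      (hnb.mul (.const 2)))))), fun ι b d w s hι hs => ?_⟩
  obtain ⟨h1, h2, h3⟩ := hn ι b d w s hι hs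
  obtain ⟨h1', h2', h3'⟩ := hf ι (b + 2) d w _ (fun i => (hι i).trans_le (by omega))
    ((hs.succ h1).mono (show b + 1 ≤ b + 2 by omega))
  rw [h1, comp_update hι] at h1' h3'
  set s1 := (P ι b d).sem ord w s with hs1
  set s2 := (P' ι (b + 2) d).sem ord w s1 with hs2
  set v := s.c ∘ ι with hv
  let C : ℕ → ℕ → ℕ := fun j => Function.update (Function.update (Function.update s.c b (n w v))
    (b + 1) j) (b + 2) (F w v j)
  have hCv : ∀ j, C j ∘ (Fin.snoc (Fin.snoc ι (b + 1) : Fin (m + 1) → ℕ) (b + 2) :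
      Fin (m + 1 + 1) → ℕ) = Fin.snoc (Fin.snoc v j : Fin (m + 1) → ℕ) (F w v j) := fun j => by
    rw [comp_snoc, comp_snoc]
    have : C j ∘ ι = v := by
      ext i
      have := hι i
      simp only [C, Function.comp, Function.update_apply, hv]
      rw [if_neg (by omega), if_neg (by omega), if_neg (by omega)]
    rw [this]
    simp [C]
  have hready : ∀ j (s' : St K), s'.c = C j → Ready w (b + 3) s' := fun j s' hs' => by
    refine ⟨by omega, ?_, fun i hi => ?_⟩
    · rw [hs', ← hs.len]
      have := hs.pos
      simp only [C, Function.update_apply]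
      rw [if_neg (by omega), if_neg (by omega), if_neg (by omega)]
    · rw [hs', ← hs.zero i (by omega)]
      simp only [C, Function.update_apply]
      rw [if_neg (by omega), if_neg (by omega), if_neg (by omega)]
  have hlt : ∀ i, (Fin.snoc (Fin.snoc ι (b + 1) : Fin (m + 1) → ℕ) (b + 2) :
      Fin (m + 1 + 1) → ℕ) i < b + 3 :=
    snoc_lt (snoc_lt hι (show b ≤ b + 2 by omega) (by omega)) (by omega) (by omega)
  have step : ∀ j (s' : St K), s'.c = C j → ((body ι b d).sem ord w s').c = C (j + 1) ∧
      (∀ i < d, ((body ι b d).sem ord w s').r i = s'.r i) ∧ (j < n w v →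
      (body ι b d).cost ord w s' ≤ (size w v + n w v + R w v) ^ e + (4 + R w v * 6)) := by
    intro j s' hs'
    obtain ⟨g1, g2, g3⟩ := hh _ (b + 3) d w s' hlt (hready j s' hs')
    rw [hs', hCv] at g1 g3
    simp only [Fin.snoc_last, Fin.init_snoc, Fin.snoc_castSucc, ← Fs] at g1
    have hz : C (j + 1) (b + 3) = 0 := (hready (j + 1) ⟨C (j + 1), 0⟩ rfl).zero _ le_rfl
    refine ⟨?_, fun i hi => ?_, fun hj => ?_⟩
    · simp only [body, LProg.sem, sem_moveProg w _ _ _ (show b + 3 ≠ b + 2 by omega), g1]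
      ext k
      simp only [C, Function.update_apply] at hz ⊢
      split_ifs at hz ⊢ <;> first | omega | simp_all
    · simp only [body, LProg.sem, sem_moveProg w _ _ _ (show b + 3 ≠ b + 2 by omega), g2 i hi]
    · have r1 := hFR w v j hj.le
      have r2 := hFR w v (j + 1) hj
      have := g3.trans (he _ _)
      rw [size_snoc, size_snoc] at this
      have := this.trans (Nat.pow_le_pow_left
        (show size w v + j + F w v j ≤ size w v + n w v + R w v by omega) e)
      simp only [body, LProg.cost, cost_moveProg w _ _ _ (show b + 3 ≠ b + 2 by omega), g1,
        Function.update_self, Function.update_of_ne (show b + 2 ≠ b + 3 by omega)]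
      have : C j (b + 2) = F w v j := by simp [C]
      omega
  have hs2c : s2.c = C 0 := by
    rw [h1']
    have := hs.zero (b + 1) (by omega)
    ext k
    simp only [C, F0, Function.update_apply]
    split_ifs <;> first | rfl | simp_all
  have inv : ∀ j, (((body ι b d).sem ord w)^[j] s2).c = C j ∧
      ∀ i < d, (((body ι b d).sem ord w)^[j] s2).r i = s2.r i := by
    intro j
    induction j with
    | zero => exact ⟨hs2c, fun _ _ => rfl⟩
    | succ j ih =>
      rw [Function.iterate_succ_apply']
      obtain ⟨g1, g2, -⟩ := step j _ ih.1
      exact ⟨g1, fun i hi => (g2 i hi).trans (ih.2 i hi)⟩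
  have hs2b : s2.c b = n w v := by
    rw [hs2c]
    simp [C]
  obtain ⟨i1, i2⟩ := inv (n w v)
  have hle := hFR w v _ le_rfl
  refine ⟨?_, fun j hj => ?_, ?_⟩
  · simp only [LProg.sem, ← hs1, ← hs2, hs2b, i1, sem_clearProg,
      sem_moveProg w _ _ _ (show b + 2 ≠ b by omega)]
    have h0 := hs.zero (b + 1) (by omega)
    have h00 := hs.zero (b + 2) (by omega)
    ext k
    simp only [C, Function.update_apply]
    split_ifs <;> first | omega | simp_all
  · simp only [LProg.sem, ← hs1, ← hs2, hs2b, sem_clearProg,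
      sem_moveProg w _ _ _ (show b + 2 ≠ b by omega)]
    rw [i2 j hj, h2' j hj, h2 j hj]
  · have hl := cost_loop_le (ord := ord) (w := w) (s := s2) (i := b) (P := body ι b d)
      fun j hj => (step j _ (inv j).1).2.2 (hs2b ▸ hj)
    rw [hs2b] at hl
    simp only [LProg.cost.eq_7, ← hs1, ← hs2, cost_clearProg,
      sem_moveProg w _ _ _ (show b + 2 ≠ b by omega),
      cost_moveProg w _ _ _ (show b + 2 ≠ b by omega)]
    have e1 : ((LProg.loop b (body ι b d)).sem ord w s2).c = C (n w v) := by
      rw [LProg.sem, hs2b, i1]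
    rw [e1]
    have e2 : C (n w v) b = n w v := by simp [C]
    have e3 : C (n w v) (b + 2) = F w v (n w v) := by simp [C]
    have e4 : C (n w v) (b + 1) = n w v := by simp [C]
    simp only [Function.update_of_ne (show b + 1 ≠ b + 2 by omega),
      Function.update_of_ne (show b + 1 ≠ b by omega), e2, e3, e4]
    omega

/-- Sums, products and other folds over a range. -/
theorem KComp.fold (o : Arith) (a : K) {F g : List K → (Fin m → ℕ) → ℕ → K}
    {n : List K → (Fin m → ℕ) → ℕ}
    (F0 : ∀ w v, F w v 0 = a) (Fs : ∀ w v i, F w v (i + 1) = o.val (F w v i) (g w v i))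
    (hn : NComp ord n) (hg : KComp ord fun w (v : Fin (m + 1) → ℕ) =>
      g w (Fin.init v) (v (Fin.last m))) :
    KComp ord fun w v => F w v (n w v) := by
  have hnb := hn.polyBdd
  obtain ⟨P, T, hT, hn⟩ := hn
  obtain ⟨P', T', ⟨e, he⟩, hg⟩ := hg
  -- Counter `b` contains the number of rounds, `b + 1` the number of the current round, and register
  -- `d` the current value.
  let body : (Fin m → ℕ) → ℕ → ℕ → LProg K := fun ι b d =>
    (P' (Fin.snoc ι (b + 1) : Fin (m + 1) → ℕ) (b + 2) (d + 1)).seq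
      ((LProg.arith o d d (d + 1)).seq (.inc (b + 1)))
  refine ⟨fun ι b d => (P ι b d).seq <| (LProg.const d a).seq <| (LProg.loop b (body ι b d)).seq <|
    (clearProg K b).seq (clearProg K (b + 1)),
    fun w v => T w v + (1 + ((1 + n w v * (1 + ((size w v + n w v) ^ e + 2)))
      + ((1 + n w v * 2) + (1 + n w v * 2)))),
    hT.add ((PolyBdd.const 1).add (((PolyBdd.const 1).add (hnb.mul ((PolyBdd.const 1).add
      (((PolyBdd.size.add hnb).pow e).add (.const 2))))).add (((PolyBdd.const 1).add
      (hnb.mul (.const 2))).add ((PolyBdd.const 1).add (hnb.mul (.const 2)))))),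
    fun ι b d w s hι hs => ?_⟩
  obtain ⟨h1, h2, h3⟩ := hn ι b d w s hι hs
  set s1 := (P ι b d).sem ord w s with hs1
  set s2 := (LProg.const d a).sem ord w s1 with hs2
  set v := s.c ∘ ι with hv
  let C : ℕ → ℕ → ℕ := fun j => Function.update (Function.update s.c b (n w v)) (b + 1) j
  have hCv : ∀ j, C j ∘ (Fin.snoc ι (b + 1) : Fin (m + 1) → ℕ) = Fin.snoc v j := fun j => by
    rw [comp_snoc]
    have : C j ∘ ι = v := by
      ext i
      have := hι i
      simp only [C, Function.comp, Function.update_apply, hv]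
      rw [if_neg (by omega), if_neg (by omega)]
    rw [this]
    simp [C]
  have hready : ∀ j (s' : St K), s'.c = C j → Ready w (b + 2) s' := fun j s' hs' => by
    refine ⟨by omega, ?_, fun i hi => ?_⟩
    · rw [hs', ← hs.len]
      have := hs.pos
      simp only [C, Function.update_apply]
      rw [if_neg (by omega), if_neg (by omega)]
    · rw [hs', ← hs.zero i (by omega)]
      simp only [C, Function.update_apply]
      rw [if_neg (by omega), if_neg (by omega)]
  have hlt : ∀ i, (Fin.snoc ι (b + 1) : Fin (m + 1) → ℕ) i < b + 2 :=
    snoc_lt hι (show b ≤ b + 2 by omega) (by omega)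
  have step : ∀ j (s' : St K), s'.c = C j → ((body ι b d).sem ord w s').c = C (j + 1) ∧
      (∀ i < d, ((body ι b d).sem ord w s').r i = s'.r i) ∧
      ((body ι b d).sem ord w s').r d = o.val (s'.r d) (g w v j) ∧ (j < n w v →
      (body ι b d).cost ord w s' ≤ (size w v + n w v) ^ e + 2) := by
    intro j s' hs'
    obtain ⟨g1, g2, g4, g3⟩ := hg _ (b + 2) (d + 1) w s' hlt (hready j s' hs')
    rw [hs', hCv] at g3
    rw [hs', hCv] at g4
    rw [hs'] at g1
    simp only [Fin.snoc_last, Fin.init_snoc] at g4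
    refine ⟨?_, fun i hi => ?_, ?_, fun hj => ?_⟩
    · simp only [body, LProg.sem, g1]
      ext k
      simp only [C, Function.update_apply]
      split_ifs <;> omega
    · simp only [body, LProg.sem, Function.update_of_ne hi.ne, g2 i (by omega)]
    · simp only [body, LProg.sem, Function.update_self, g4, g2 d (by omega)]
    · have := g3.trans (he _ _)
      rw [size_snoc] at this
      have := this.trans (Nat.pow_le_pow_left
        (show size w v + j ≤ size w v + n w v by omega) e)
      simp only [body, LProg.cost]
      omega
  have hs2c : s2.c = C 0 := by
    have : s2.c = s1.c := rfl
    rw [this, h1]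
    have := hs.zero (b + 1) (by omega)
    ext k
    simp only [C, Function.update_apply]
    split_ifs <;> simp_all
  have inv : ∀ j, (((body ι b d).sem ord w)^[j] s2).c = C j ∧
      (∀ i < d, (((body ι b d).sem ord w)^[j] s2).r i = s.r i) ∧
      (((body ι b d).sem ord w)^[j] s2).r d = F w v j := by
    intro j
    induction j with
    | zero =>
      refine ⟨hs2c, fun i hi => ?_, ?_⟩
      · rw [← h2 i hi]
        exact Function.update_of_ne hi.ne _ _
      · rw [F0]
        exact Function.update_self _ _ _
    | succ j ih =>
      rw [Function.iterate_succ_apply']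
      obtain ⟨g1, g2, g3, -⟩ := step j _ ih.1
      exact ⟨g1, fun i hi => (g2 i hi).trans (ih.2.1 i hi), by rw [g3, ih.2.2, Fs]⟩
  have hs2b : s2.c b = n w v := by
    rw [hs2c]
    simp [C]
  obtain ⟨i1, i2, i3⟩ := inv (n w v)
  refine ⟨?_, fun j hj => ?_, ?_, ?_⟩
  · simp only [LProg.sem.eq_7, ← hs1, ← hs2, sem_clearProg]
    rw [LProg.sem, hs2b, i1]
    have h0 := hs.zero (b + 1) (by omega)
    have h00 := hs.zero b (by omega)
    ext k
    simp only [C, Function.update_apply]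
    split_ifs <;> first | omega | simp_all
  · simp only [LProg.sem.eq_7, ← hs1, ← hs2, sem_clearProg]
    rw [LProg.sem, hs2b, i2 j hj]
  · simp only [LProg.sem.eq_7, ← hs1, ← hs2, sem_clearProg]
    rw [LProg.sem, hs2b, i3]
  · have hl := cost_loop_le (ord := ord) (w := w) (s := s2) (i := b) (P := body ι b d)
      fun j hj => (step j _ (inv j).1).2.2.2 (hs2b ▸ hj)
    rw [hs2b] at hl
    simp only [LProg.cost.eq_7, ← hs1, ← hs2, cost_clearProg, sem_clearProg]
    have e1 : ((LProg.loop b (body ι b d)).sem ord w s2).c = C (n w v) := by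
      rw [LProg.sem, hs2b, i1]
    rw [e1]
    have e2 : C (n w v) b = n w v := by simp [C]
    have e4 : C (n w v) (b + 1) = n w v := by simp [C]
    simp only [Function.update_of_ne (show b + 1 ≠ b by omega), e2, e4]
    have : (LProg.const d a).cost ord w s1 = 1 := rfl
    omega

theorem KComp.const (a : K) : KComp ord fun (_ : List K) (_ : Fin m → ℕ) => a :=
  ⟨fun _ _ d => .const d a, _, .const 1, fun _ _ _ _ _ _ _ => ⟨rfl,
    fun _ hj => Function.update_of_ne hj.ne _ _, Function.update_self _ _ _, le_rfl⟩⟩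

theorem KComp.read {f : List K → (Fin m → ℕ) → ℕ} (hf : NComp ord f) :
    KComp ord fun w v => w.getD (f w v) 0 := by
  have hfb := hf.polyBdd
  obtain ⟨P, T, hT, hf⟩ := hf
  refine ⟨fun ι b d => (P ι b d).seq ((LProg.read b d).seq (clearProg K b)),
    fun w v => T w v + (1 + (1 + f w v * 2)),
    hT.add ((PolyBdd.const 1).add ((PolyBdd.const 1).add (hfb.mul (.const 2)))),
    fun ι b d w s hι hs => ?_⟩
  obtain ⟨h1, h2, h3⟩ := hf ι b d w s hι hs
  refine ⟨?_, fun j hj => ?_, ?_, ?_⟩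
  · simp only [LProg.sem, sem_clearProg, h1, Function.update_idem]
    exact Function.update_eq_self_iff.2 (hs.zero b le_rfl).symm
  · simp only [LProg.sem, sem_clearProg, Function.update_of_ne hj.ne, h2 j hj]
  · simp only [LProg.sem, sem_clearProg, Function.update_self, h1]
  · simp only [LProg.cost, LProg.sem, cost_clearProg, h1, Function.update_self]
    omega

theorem KComp.arith (o : Arith) {f g : List K → (Fin m → ℕ) → K} (hf : KComp ord f)
    (hg : KComp ord g) : KComp ord fun w v => o.val (f w v) (g w v) := by
  obtain ⟨P, T, hT, hf⟩ := hf
  obtain ⟨P', T', hT', hg⟩ := hg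
  refine ⟨fun ι b d => (P ι b d).seq ((P' ι b (d + 1)).seq (LProg.arith o d d (d + 1))),
    fun w v => T w v + (T' w v + 1), hT.add (hT'.add (PolyBdd.const 1)),
    fun ι b d w s hι hs => ?_⟩
  obtain ⟨h1, h2, h4, h3⟩ := hf ι b d w s hι hs
  obtain ⟨h1', h2', h4', h3'⟩ := hg ι b (d + 1) w ((P ι b d).sem ord w s) hι
    ⟨hs.pos, h1 ▸ hs.len, h1 ▸ hs.zero⟩
  rw [h1] at h1' h3' h4'
  refine ⟨?_, fun j hj => ?_, ?_, ?_⟩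
  · simp only [LProg.sem, h1']
  · simp only [LProg.sem, Function.update_of_ne hj.ne, h2' j (by omega), h2 j hj]
  · simp only [LProg.sem, Function.update_self, h2' d (by omega), h4, h4']
  · simp only [LProg.cost]
    omega

theorem KComp.add {f g : List K → (Fin m → ℕ) → K} (hf : KComp ord f) (hg : KComp ord g) :
    KComp ord fun w v => f w v + g w v := hf.arith .add hg

theorem KComp.mul {f g : List K → (Fin m → ℕ) → K} (hf : KComp ord f) (hg : KComp ord g) :
    KComp ord fun w v => f w v * g w v := hf.arith .mul hg

theorem KComp.sum {n : List K → (Fin m → ℕ) → ℕ} {g : List K → (Fin m → ℕ) → ℕ → K}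
    (hn : NComp ord n) (hg : KComp ord fun w (v : Fin (m + 1) → ℕ) =>
      g w (Fin.init v) (v (Fin.last m))) :
    KComp ord fun w v => ∑ i ∈ Finset.range (n w v), g w v i :=
  KComp.fold .add 0 (F := fun w v n => ∑ i ∈ Finset.range n, g w v i) (fun _ _ => rfl) (fun _ _ _ => Finset.sum_range_succ _ _) hn hg

theorem KComp.prod {n : List K → (Fin m → ℕ) → ℕ} {g : List K → (Fin m → ℕ) → ℕ → K}
    (hn : NComp ord n) (hg : KComp ord fun w (v : Fin (m + 1) → ℕ) =>
      g w (Fin.init v) (v (Fin.last m))) :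
    KComp ord fun w v => ∏ i ∈ Finset.range (n w v), g w v i :=
  KComp.fold .mul 1 (F := fun w v n => ∏ i ∈ Finset.range n, g w v i) (fun _ _ => rfl) (fun _ _ _ => Finset.prod_range_succ _ _) hn hg

/-- The pattern of `PComp.keq` and `PComp.krel`: a condition `C` of loop programs that means the
relation `o`. -/
theorem PComp.cond (C : ℕ → ℕ → LCond) (o : K → K → Prop)
    (hC : ∀ j k s, (C j k).holds ord s ↔ o (s.r j) (s.r k))
    {f g : List K → (Fin m → ℕ) → K} (hf : KComp ord f) (hg : KComp ord g) :
    PComp ord fun w v => o (f w v) (g w v) := by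
  obtain ⟨P, T, hT, hf⟩ := hf
  obtain ⟨P', T', hT', hg⟩ := hg
  refine ⟨fun ι b d => (P ι b d).seq ((P' ι b (d + 1)).seq (LProg.ite (C d (d + 1)) (.inc b) .nop)),
    fun w v => T w v + (T' w v + 2), hT.add (hT'.add (PolyBdd.const 2)),
    fun ι b d w s hι hs => ?_⟩
  obtain ⟨h1, h2, h4, h3⟩ := hf ι b d w s hι hs
  obtain ⟨h1', h2', h4', h3'⟩ := hg ι b (d + 1) w ((P ι b d).sem ord w s) hι
    ⟨hs.pos, h1 ▸ hs.len, h1 ▸ hs.zero⟩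
  rw [h1] at h1' h3' h4'
  have h0 := hs.zero b le_rfl
  have hd : ((C d (d + 1)).holds ord ((P' ι b (d + 1)).sem ord w ((P ι b d).sem ord w s))) ↔
      o (f w (s.c ∘ ι)) (g w (s.c ∘ ι)) := by
    rw [hC, h2' d (by omega), h4, h4']
  by_cases hp : o (f w (s.c ∘ ι)) (g w (s.c ∘ ι))
  · refine ⟨?_, fun j hj => ?_, ?_⟩
    · simp only [LProg.sem, if_pos (hd.2 hp), if_pos hp, h1', h0]
    · simp only [LProg.sem, if_pos (hd.2 hp), h2' j (by omega), h2 j hj]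
    · simp only [LProg.cost, if_pos (hd.2 hp)]
      omega
  · have hd' := fun h => hp (hd.1 h)
    refine ⟨?_, fun j hj => ?_, ?_⟩
    · simp only [LProg.sem, if_neg hd', if_neg hp, h1']
      exact (Function.update_eq_self_iff.2 h0.symm).symm
    · simp only [LProg.sem, if_neg hd', h2' j (by omega), h2 j hj]
    · simp only [LProg.cost, if_neg hd']
      omega

theorem PComp.keq {f g : List K → (Fin m → ℕ) → K} (hf : KComp ord f) (hg : KComp ord g) :
    PComp ord fun w v => f w v = g w v := PComp.cond .eq _ (fun _ _ _ => Iff.rfl) hf hg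

theorem PComp.krel {f g : List K → (Fin m → ℕ) → K} (hf : KComp ord f) (hg : KComp ord g) :
    PComp ord fun w v => branchRel ord (f w v) (g w v) :=
  PComp.cond .rel _ (fun _ _ _ => Iff.rfl) hf hg

end Recursion

/-! ### Predicates decided by loop programs -/

section Predicates

variable {K : Type u} [CommSemiring K] {ord : Option (SemiringOrder K)} {m : ℕ}
  {p q : List K → (Fin m → ℕ) → Prop} {f g : List K → (Fin m → ℕ) → ℕ}

theorem PComp.congr (hp : PComp ord p) (h : ∀ w v, q w v ↔ p w v) : PComp ord q := by
  obtain rfl : q = p := funext fun w => funext fun v => propext (h w v)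
  exact hp

theorem PComp.weaken (hp : PComp ord p) :
    PComp ord fun w (v : Fin (m + 1) → ℕ) => p w (Fin.init v) :=
  NComp.weaken hp

theorem NComp.ite [∀ w v, Decidable (p w v)] (hp : PComp ord p) (hf : NComp ord f) (hg : NComp ord g) :
    NComp ord fun w v => if p w v then f w v else g w v :=
  (NComp.ite' hp hf hg).congr fun w v => by by_cases h : p w v <;> simp [h]

theorem KComp.ite [∀ w v, Decidable (p w v)] {f g : List K → (Fin m → ℕ) → K} (hp : PComp ord p) (hf : KComp ord f)
    (hg : KComp ord g) : KComp ord fun w v => if p w v then f w v else g w v :=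
  (KComp.ite' hp hf hg).congr fun w v => by by_cases h : p w v <;> simp [h]

theorem PComp.not (hp : PComp ord p) : PComp ord fun w v => ¬ p w v :=
  open Classical in
  (NComp.ite hp (.const 0) (.const 1)).congr fun w v => by by_cases h : p w v <;> simp [h]

theorem PComp.and (hp : PComp ord p) (hq : PComp ord q) : PComp ord fun w v => p w v ∧ q w v :=
  open Classical in
  (NComp.ite hp hq (.const 0)).congr fun w v => by
    by_cases h : p w v <;> by_cases h' : q w v <;> simp [h, h']

theorem PComp.or (hp : PComp ord p) (hq : PComp ord q) : PComp ord fun w v => p w v ∨ q w v :=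
  open Classical in
  (NComp.ite hp (.const 1) hq).congr fun w v => by
    by_cases h : p w v <;> by_cases h' : q w v <;> simp [h, h']

theorem PComp.imp (hp : PComp ord p) (hq : PComp ord q) : PComp ord fun w v => p w v → q w v :=
  open Classical in
  (NComp.ite hp hq (.const 1)).congr fun w v => by
    by_cases h : p w v <;> by_cases h' : q w v <;> simp [h, h']

theorem PComp.iff (hp : PComp ord p) (hq : PComp ord q) : PComp ord fun w v => p w v ↔ q w v :=
  ((hp.imp hq).and (hq.imp hp)).congr fun _ _ => iff_iff_implies_and_implies

theorem PComp.lt (hf : NComp ord f) (hg : NComp ord g) : PComp ord fun w v => f w v < g w v :=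
  (NComp.ite' (hg.sub hf) (.const 1) (.const 0)).congr fun w v => by
    by_cases h : f w v < g w v <;> simp [Nat.sub_eq_zero_iff_le, h]

theorem PComp.le (hf : NComp ord f) (hg : NComp ord g) : PComp ord fun w v => f w v ≤ g w v :=
  (PComp.lt hg hf).not.congr fun _ _ => not_lt.symm

theorem PComp.eq (hf : NComp ord f) (hg : NComp ord g) : PComp ord fun w v => f w v = g w v :=
  ((PComp.le hf hg).and (PComp.le hg hf)).congr fun _ _ => le_antisymm_iff

theorem NComp.mul (hf : NComp ord f) (hg : NComp ord g) : NComp ord fun w v => f w v * g w v := by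
  refine NComp.recursion (F := fun w v i => i * g w v) (f := fun _ _ => 0)
    (h := fun w v _ a => a + g w v) (R := fun w v => f w v * g w v) (fun _ _ => Nat.zero_mul _)
    (fun _ _ _ => Nat.succ_mul _ _) hf (.const 0) (NComp.last.add hg.weaken.weaken)
    (hf.polyBdd.mul hg.polyBdd) fun w v i hi => Nat.mul_le_mul_right _ hi

/-- The least number below `n` that satisfies `p`; it is `n` if there is none. -/
noncomputable def least (n : ℕ) (p : ℕ → Prop) : ℕ := sInf {i | p i ∨ n ≤ i}

theorem least_le (n : ℕ) (p : ℕ → Prop) : least n p ≤ n := Nat.sInf_le (Or.inr le_rfl)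

theorem not_of_lt_least {n : ℕ} {p : ℕ → Prop} {i : ℕ} (h : i < least n p) : ¬ p i :=
  fun hp => Nat.notMem_of_lt_sInf h (Or.inl hp)

theorem least_spec {n : ℕ} {p : ℕ → Prop} (h : least n p < n) : p (least n p) :=
  (Nat.sInf_mem (s := {i | p i ∨ n ≤ i}) ⟨n, Or.inr le_rfl⟩).resolve_right h.not_ge

theorem least_eq {n : ℕ} {p : ℕ → Prop} {i : ℕ} (hn : i ≤ n) (h : ∀ j < i, ¬ p j)
    (hp : i < n → p i) : least n p = i := by
  rcases lt_trichotomy (least n p) i with h' | h' | h'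
  · exact absurd (least_spec (h'.trans_le hn)) (h _ h')
  · exact h'
  · exact absurd (hp (h'.trans_le (least_le n p))) (not_of_lt_least h')

theorem least_lt_iff {n : ℕ} {p : ℕ → Prop} : least n p < n ↔ ∃ i < n, p i := by
  refine ⟨fun h => ⟨_, h, least_spec h⟩, fun ⟨i, hi, hp⟩ => ?_⟩
  by_contra h
  exact not_of_lt_least (hi.trans_le (not_lt.1 h)) hp

open Classical in
theorem least_succ (n : ℕ) (p : ℕ → Prop) :
    least (n + 1) p = if least n p < n ∨ p n then least n p else n + 1 := by
  have hn := least_le n p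
  split_ifs with h
  · refine least_eq (by omega) (fun j => not_of_lt_least) fun _ => ?_
    by_cases h' : least n p < n
    · exact least_spec h'
    · rw [show least n p = n by omega]
      exact h.resolve_left h'
  · push Not at h
    refine least_eq le_rfl (fun j hj => ?_) fun h => absurd h (lt_irrefl _)
    rcases Nat.lt_succ_iff_lt_or_eq.1 hj with hj | rfl
    · exact not_of_lt_least (hj.trans_le h.1)
    · exact h.2

theorem NComp.least {p : List K → (Fin m → ℕ) → ℕ → Prop} (hf : NComp ord f)
    (hp : PComp ord fun w (v : Fin (m + 1) → ℕ) => p w (Fin.init v) (v (Fin.last m))) :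
    NComp ord fun w v => least (f w v) (p w v) := by
  classical
  have i1 : NComp ord fun (_ : List K) (v : Fin (m + 1 + 1) → ℕ) => v (Fin.last m).castSucc :=
    .var _
  have i2 : NComp ord fun (_ : List K) (v : Fin (m + 1 + 1) → ℕ) => v (Fin.last (m + 1)) :=
    .var _
  refine NComp.recursion (F := fun w v i => SemiringMC.least i (p w v)) (f := fun _ _ => 0)
    (h := fun w v i a => if a < i ∨ p w v i then a else i + 1) (R := f)
    (fun _ _ => Nat.le_zero.1 (least_le _ _)) (fun _ _ _ => least_succ _ _) hf (.const 0) ?_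
    hf.polyBdd fun w v i hi => (least_le _ _).trans hi
  exact NComp.ite ((PComp.lt i2 i1).or hp.weaken) i2 i1.succ

theorem PComp.exists {p : List K → (Fin m → ℕ) → ℕ → Prop} (hf : NComp ord f)
    (hp : PComp ord fun w (v : Fin (m + 1) → ℕ) => p w (Fin.init v) (v (Fin.last m))) :
    PComp ord fun w v => ∃ i < f w v, p w v i :=
  (PComp.lt (hf.least hp) hf).congr fun _ _ => least_lt_iff.symm

theorem PComp.forall {p : List K → (Fin m → ℕ) → ℕ → Prop} (hf : NComp ord f)
    (hp : PComp ord fun w (v : Fin (m + 1) → ℕ) => p w (Fin.init v) (v (Fin.last m))) :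
    PComp ord fun w v => ∀ i < f w v, p w v i :=
  (PComp.exists (p := fun w v i => ¬ p w v i) hf hp.not).not.congr fun _ _ => by push Not; rfl

/-- A language is in `P_K` if its membership predicate is decided by loop programs. -/
theorem PComp.mem_PClass [Nontrivial K] {L : Set (List K)}
    (h : PComp ord fun w (_ : Fin 0 → ℕ) => w ∈ L) : L ∈ PClass ord := by
  classical
  obtain ⟨P, T, ⟨e, he⟩, h⟩ := KComp.ite h (KComp.const 1) (KComp.const 0)
  have key := fun w : List K => h Fin.elim0 1 0 w (startSt K w.length) (fun i => i.elim0)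
    ⟨one_pos, by simp [startSt], fun i hi => by
      simp only [startSt, Function.update_of_ne (show i ≠ 0 by omega), Pi.zero_apply]⟩
  refine mem_PClass_of_loopProgram (P Fin.elim0 1 0) e (fun w => ?_) fun w => ?_
  · rw [(key w).2.2.1, charFun]
    by_cases h : w ∈ L <;> simp only [h, if_true, if_false]
  · refine ((key w).2.2.2.trans (he _ _)).trans (Nat.pow_le_pow_left ?_ e)
    simp [size]

end Predicates

/-! ### Reading the codes of numbers -/

section Parsing

variable {K : Type u} [CommSemiring K]

/-- The letter of `w` at position `i`, counted from `0`, and `0` beyond the end of `w`. -/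
def letter (w : List K) (i : ℕ) : K := w.getD i 0

theorem letter_add {w l : List K} {q : ℕ} (h : w.drop q = l) (i : ℕ) :
    letter w (q + i) = l.getD i 0 := by
  simp [letter, ← h]

theorem drop_eq_cons {w : List K} {q : ℕ} (h : q < w.length) :
    w.drop q = letter w q :: w.drop (q + 1) := by
  rw [List.drop_eq_getElem_cons h, letter, List.getD_eq_getElem _ _ h]

theorem lt_length_of_letter_ne {w : List K} {q : ℕ} (h : letter w q ≠ 0) : q < w.length := by
  by_contra hq
  exact h (List.getD_eq_default _ _ (not_lt.1 hq))

/-- The code of a list of binary digits, without the end mark. -/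
def bitCode (K : Type u) [CommSemiring K] (bs : List Bool) : List K :=
  bs.flatMap fun b => [1, if b then 1 else 0]

theorem encNat_eq (a : ℕ) : encNat K a = bitCode K a.bits ++ [0] := rfl

theorem encNatList_cons (a : ℕ) (l : List ℕ) :
    encNatList K (a :: l) = 1 :: encNat K a ++ encNatList K l := by
  simp [encNatList]

theorem length_bitCode (bs : List Bool) : (bitCode K bs).length = 2 * bs.length := by
  induction bs with
  | nil => rfl
  | cons b bs ih =>
    simp only [bitCode, List.flatMap_cons, List.length_append, List.length_cons, List.length_nil]
      at ih ⊢
    omega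

theorem bitCode_mark (rest : List K) {bs : List Bool} {i : ℕ} (hi : i < bs.length) :
    (bitCode K bs ++ rest).getD (2 * i) 0 = 1 := by
  induction bs generalizing i with
  | nil => exact absurd hi (Nat.not_lt_zero _)
  | cons b bs ih =>
    cases i with
    | zero => rfl
    | succ i => exact ih (Nat.lt_of_succ_lt_succ hi)

theorem bitCode_bit (rest : List K) {bs : List Bool} {i : ℕ} (hi : i < bs.length) :
    (bitCode K bs ++ rest).getD (2 * i + 1) 0 = if bs.getI i then 1 else 0 := by
  induction bs generalizing i with
  | nil => exact absurd hi (Nat.not_lt_zero _)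
  | cons b bs ih =>
    cases i with
    | zero => rfl
    | succ i => exact ih (Nat.lt_of_succ_lt_succ hi)

theorem bitCode_end (rest : List K) (bs : List Bool) :
    (bitCode K bs ++ 0 :: rest).getD (2 * bs.length) 0 = 0 := by
  induction bs with
  | nil => rfl
  | cons b bs ih => exact ih

/-- The number of binary digits of the number with code at position `q`. -/
noncomputable def numLen (w : List K) (q : ℕ) : ℕ :=
  least w.length fun i => letter w (q + 2 * i) ≠ 1

/-- The binary digit `i` of the number with code at position `q` is one. -/
def bitAt (w : List K) (q i : ℕ) : Prop := i < numLen w q ∧ letter w (q + 2 * i + 1) = 1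

/-- The code of `a` is found at position `q`. -/
def NatAt (w : List K) (q a : ℕ) : Prop := ∃ rest, w.drop q = encNat K a ++ rest

/-- There is a code of a number at position `q`: an end mark is found, the digits are zeros and ones,
and the last one is not zero. -/
def okNat (w : List K) (q : ℕ) : Prop :=
  q + 2 * numLen w q < w.length ∧ letter w (q + 2 * numLen w q) = 0 ∧
    (∀ i < numLen w q, letter w (q + 2 * i + 1) = 0 ∨ letter w (q + 2 * i + 1) = 1) ∧
    (0 < numLen w q → letter w (q + 2 * numLen w q - 1) = 1)

/-- The lists that do not end with a zero are lists of binary digits of numbers. -/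
theorem exists_bits_eq (bs : List Bool) (h : ∀ hb : bs ≠ [], bs.getLast hb = true) :
    ∃ a : ℕ, a.bits = bs := by
  induction bs with
  | nil => exact ⟨0, Nat.zero_bits⟩
  | cons b bs ih =>
    obtain ⟨a, rfl⟩ := ih fun hb => by simpa [List.getLast_cons hb] using h (List.cons_ne_nil _ _)
    refine ⟨Nat.bit b a, Nat.bits_append_bit a b ?_⟩
    rintro rfl
    simpa using h (List.cons_ne_nil _ _)

theorem testBit_length_bits_sub_one {a : ℕ} (h : 0 < a.bits.length) :
    a.testBit (a.bits.length - 1) = true := by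
  rw [Nat.size_eq_bits_len] at h ⊢
  by_contra h'
  have h1 : a < 2 ^ (a.size - 1) := by
    refine Nat.lt_pow_two_of_testBit a fun i hi => ?_
    rcases hi.eq_or_lt with rfl | hi
    · simpa using h'
    · exact Nat.testBit_lt_two_pow ((Nat.lt_size_self a).trans_le
        (Nat.pow_le_pow_right two_pos (by omega)))
  have := Nat.size_le.2 h1
  omega

/-- The position of entry `j` of the list with code at position `p`, more precisely of the mark
before it. -/
noncomputable def ent (w : List K) (p j : ℕ) : ℕ := (fun p => p + 2 * numLen w (p + 1) + 2)^[j] p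

theorem ent_succ (w : List K) (p j : ℕ) :
    ent w p (j + 1) = ent w p j + 2 * numLen w (ent w p j + 1) + 2 := by
  rw [ent, Function.iterate_succ_apply']
  rfl

variable {w : List K} {p q a : ℕ}

theorem NatAt.length_lt (h : NatAt w q a) : q + 2 * a.bits.length < w.length := by
  obtain ⟨rest, h⟩ := h
  have h := congrArg List.length h
  simp only [List.length_drop, encNat_eq, List.length_append, length_bitCode, List.length_cons,
    List.length_nil] at h
  omega

theorem NatAt.testBit_lt (h : NatAt w q a) {i : ℕ} (hi : w.length ≤ i) : a.testBit i = false := by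
  have := h.length_lt
  rw [Nat.size_eq_bits_len] at this
  exact Nat.testBit_lt_two_pow ((Nat.lt_size_self a).trans_le
    (Nat.pow_le_pow_right two_pos (by omega)))

theorem exists_bitCode {L : ℕ} (h1 : ∀ i < L, letter w (q + 2 * i) = 1)
    (h2 : ∀ i < L, letter w (q + 2 * i + 1) = 0 ∨ letter w (q + 2 * i + 1) = 1)
    (hL : q + 2 * L < w.length) :
    ∃ bs : List Bool, bs.length = L ∧ w.drop q = bitCode K bs ++ w.drop (q + 2 * L) := by
  induction L generalizing q with
  | zero => exact ⟨[], rfl, by simp [bitCode]⟩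
  | succ L ih =>
    obtain ⟨bs, hbs, e⟩ := ih (q := q + 2)
      (fun i hi => by rw [← h1 (i + 1) (by omega)]; congr 1; omega)
      (fun i hi => by
        have := h2 (i + 1) (by omega)
        rwa [show q + 2 * (i + 1) + 1 = q + 2 + 2 * i + 1 by omega] at this) (by omega)
    rw [show q + 2 + 2 * L = q + 2 * (L + 1) by omega] at e
    have e1 := h1 0 (Nat.succ_pos L)
    have e2 := h2 0 (Nat.succ_pos L)
    simp only [mul_zero, add_zero] at e1 e2
    rw [drop_eq_cons (show q < w.length by omega), drop_eq_cons (show q + 1 < w.length by omega), e,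
      e1]
    rcases e2 with e2 | e2
    · exact ⟨false :: bs, by simp [hbs], by rw [e2]; rfl⟩
    · exact ⟨true :: bs, by simp [hbs], by rw [e2]; rfl⟩

variable [Nontrivial K]

theorem NatAt.numLen_eq (h : NatAt w q a) : numLen w q = a.bits.length := by
  have hl := h.length_lt
  obtain ⟨rest, h⟩ := h
  rw [encNat_eq, List.append_assoc] at h
  refine least_eq (by omega) (fun i hi => not_not.2 ?_) fun _ => ?_
  · rw [letter_add h, bitCode_mark _ hi]
  · rw [letter_add h, List.singleton_append, bitCode_end]
    exact zero_ne_one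

theorem NatAt.letter_eq (h : NatAt w q a) {i : ℕ} (hi : i < numLen w q) :
    letter w (q + 2 * i + 1) = if a.testBit i then 1 else 0 := by
  rw [h.numLen_eq] at hi
  obtain ⟨rest, h⟩ := h
  rw [encNat_eq, List.append_assoc] at h
  rw [add_assoc, letter_add h, bitCode_bit _ hi, Nat.testBit_eq_inth]

theorem NatAt.bitAt_iff (h : NatAt w q a) (i : ℕ) : bitAt w q i ↔ a.testBit i = true := by
  constructor
  · rintro ⟨hi, hi'⟩
    rw [h.letter_eq hi] at hi'
    by_contra hc
    rw [if_neg hc] at hi'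
    exact zero_ne_one hi'
  · intro hi
    have : i < numLen w q := by
      by_contra hc
      rw [h.numLen_eq, Nat.size_eq_bits_len] at hc
      rw [Nat.testBit_lt_two_pow ((Nat.lt_size_self a).trans_le
        (Nat.pow_le_pow_right two_pos (by omega)))] at hi
      exact Bool.false_ne_true hi
    exact ⟨this, by rw [h.letter_eq this, if_pos hi]⟩

theorem NatAt.okNat (h : NatAt w q a) : okNat w q := by
  have hL := h.numLen_eq
  refine ⟨hL ▸ h.length_lt, ?_, fun i hi => ?_, fun hpos => ?_⟩
  · rw [hL]
    obtain ⟨rest, h⟩ := h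
    rw [encNat_eq, List.append_assoc] at h
    rw [letter_add h, List.singleton_append, bitCode_end]
  · rw [h.letter_eq hi]
    split_ifs <;> simp
  · have := h.letter_eq (i := numLen w q - 1) (by omega)
    rw [show q + 2 * (numLen w q - 1) + 1 = q + 2 * numLen w q - 1 by omega, hL,
      if_pos (testBit_length_bits_sub_one (hL ▸ hpos))] at this
    rw [hL, this]

/-- If the check is passed, there is indeed a code of a number. -/
theorem okNat.exists_eq (h : okNat w q) :
    ∃ a, w.drop q = encNat K a ++ w.drop (q + 2 * numLen w q + 1) := by
  obtain ⟨h1, h2, h3, h4⟩ := h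
  obtain ⟨bs, hbs, e⟩ := exists_bitCode (L := numLen w q)
    (fun i hi => not_not.1 (not_of_lt_least (p := fun i => letter w (q + 2 * i) ≠ 1) hi)) h3 h1
  obtain ⟨a, rfl⟩ := exists_bits_eq bs fun hb => by
    have hpos := List.length_pos_iff.2 hb
    have h4 := h4 (by omega)
    have := bitCode_bit (K := K) (w.drop (q + 2 * numLen w q))
      (show bs.length - 1 < bs.length by omega)
    rw [← letter_add e, show q + (2 * (bs.length - 1) + 1) = q + 2 * numLen w q - 1 by omega, h4,
      List.getI_eq_getElem _ (show bs.length - 1 < bs.length by omega)] at this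
    rw [List.getLast_eq_getElem]
    by_contra hc
    rw [if_neg hc] at this
    exact one_ne_zero this
  refine ⟨a, ?_⟩
  rw [e, drop_eq_cons h1, h2, encNat_eq, List.append_assoc]
  rfl

/-- The numbers with codes at `q` and `q'` are equal. -/
def eqAt (w : List K) (q q' : ℕ) : Prop := ∀ i < w.length, (bitAt w q i ↔ bitAt w q' i)

/-- The number with code at `q` is less than the one with code at `q'`: they differ at some digit,
and agree at all higher ones. -/
def ltAt (w : List K) (q q' : ℕ) : Prop :=
  ∃ i < w.length, (¬ bitAt w q i ∧ bitAt w q' i) ∧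
    ∀ j < w.length, i < j → (bitAt w q j ↔ bitAt w q' j)

theorem NatAt.eqAt_iff {a' q' : ℕ} (h : NatAt w q a) (h' : NatAt w q' a') :
    eqAt w q q' ↔ a = a' := by
  constructor
  · intro H
    refine Nat.eq_of_testBit_eq fun i => ?_
    by_cases hi : i < w.length
    · have := H i hi
      rw [h.bitAt_iff, h'.bitAt_iff] at this
      exact Bool.eq_iff_iff.2 this
    · rw [h.testBit_lt (not_lt.1 hi), h'.testBit_lt (not_lt.1 hi)]
  · rintro rfl i -
    rw [h.bitAt_iff, h'.bitAt_iff]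

theorem NatAt.ltAt_iff {a' q' : ℕ} (h : NatAt w q a) (h' : NatAt w q' a') :
    ltAt w q q' ↔ a < a' := by
  have key : ltAt w q q' → a < a' := by
    rintro ⟨i, -, ⟨h1, h2⟩, h3⟩
    rw [h.bitAt_iff] at h1
    rw [h'.bitAt_iff] at h2
    refine Nat.lt_of_testBit i (by simpa using h1) h2 fun j hij => ?_
    by_cases hj : j < w.length
    · have := h3 j hj hij
      rw [h.bitAt_iff, h'.bitAt_iff] at this
      exact Bool.eq_iff_iff.2 this
    · rw [h.testBit_lt (not_lt.1 hj), h'.testBit_lt (not_lt.1 hj)]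
  refine ⟨key, fun hlt => ?_⟩
  obtain ⟨i, hi, hi'⟩ := Nat.exists_most_significant_bit (n := a ^^^ a')
    (by simpa [Nat.xor_eq_zero_iff] using hlt.ne)
  rw [Nat.testBit_xor] at hi
  have hj : ∀ j, i < j → a.testBit j = a'.testBit j := fun j hj => by
    have := hi' j hj
    rw [Nat.testBit_xor] at this
    simpa using this
  have h2 : a'.testBit i = true := by
    by_contra hc
    have hc : a'.testBit i = false := by simpa using hc
    rw [hc, Bool.xor_false] at hi
    exact absurd (Nat.lt_of_testBit i hc hi fun j hij => (hj j hij).symm) hlt.not_gt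
  have h1 : a.testBit i = false := by simpa [h2] using hi
  refine ⟨i, ?_, ⟨?_, (h'.bitAt_iff i).2 h2⟩, fun j _ hij => ?_⟩
  · by_contra hc
    rw [h'.testBit_lt (not_lt.1 hc)] at h2
    exact Bool.false_ne_true h2
  · rw [h.bitAt_iff, h1]
    exact Bool.false_ne_true
  · rw [h.bitAt_iff, h'.bitAt_iff, hj j hij]

/-! ### Reading the codes of lists of numbers -/

/-- The number of entries of the list with code at position `p`. -/
noncomputable def cnt (w : List K) (p : ℕ) : ℕ := least w.length fun j => letter w (ent w p j) ≠ 1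

/-- The first position behind the code of a list at position `p`. -/
noncomputable def fin (w : List K) (p : ℕ) : ℕ := ent w p (cnt w p) + 1

/-- There is a code of a list of numbers at position `p`: an end mark is found, and the entries are
codes of numbers. -/
def okList (w : List K) (p : ℕ) : Prop :=
  ent w p (cnt w p) < w.length ∧ letter w (ent w p (cnt w p)) = 0 ∧
    ∀ j < cnt w p, okNat w (ent w p j + 1)

variable {l : List ℕ} {rest : List K}

theorem drop_ent (h : w.drop p = encNatList K l ++ rest) {j : ℕ} (hj : j ≤ l.length) :
    w.drop (ent w p j) = encNatList K (l.drop j) ++ rest := by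
  induction j with
  | zero => exact h
  | succ j ih =>
    have ih := ih (by omega)
    rw [List.drop_eq_getElem_cons (show j < l.length by omega), encNatList_cons] at ih
    have ih' : w.drop (ent w p j + 1) =
        encNat K l[j] ++ (encNatList K (l.drop (j + 1)) ++ rest) := by
      have := congrArg (List.drop 1) ih
      rw [List.drop_drop] at this
      simpa using this
    have hn : numLen w (ent w p j + 1) = l[j].bits.length := NatAt.numLen_eq ⟨_, ih'⟩
    have := congrArg (List.drop (encNat K l[j]).length) ih'
    rw [List.drop_drop, List.drop_left] at this
    rw [← this, ent_succ, hn]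
    congr 1
    simp only [encNat_eq, List.length_append, length_bitCode, List.length_cons, List.length_nil]
    omega

theorem natAt_ent (h : w.drop p = encNatList K l ++ rest) {j : ℕ} (hj : j < l.length) :
    NatAt w (ent w p j + 1) l[j] := by
  have ih := drop_ent h hj.le
  rw [List.drop_eq_getElem_cons hj, encNatList_cons] at ih
  refine ⟨encNatList K (l.drop (j + 1)) ++ rest, ?_⟩
  have := congrArg (List.drop 1) ih
  rw [List.drop_drop] at this
  simpa using this

theorem cnt_eq (h : w.drop p = encNatList K l ++ rest) : cnt w p = l.length := by
  have hm : ∀ j < l.length, letter w (ent w p j) = 1 := fun j hj => by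
    have ih := drop_ent h hj.le
    rw [List.drop_eq_getElem_cons hj, encNatList_cons] at ih
    simpa using letter_add ih 0
  have hlen : l.length ≤ w.length := by
    have h1 : l.length ≤ (encNatList K l).length := by
      clear h hm
      induction l with
      | nil => exact Nat.zero_le _
      | cons a l ih =>
        rw [encNatList_cons]
        simp only [List.length_append, List.length_cons]
        omega
    have := congrArg List.length h
    simp only [List.length_drop, List.length_append] at this
    omega
  refine least_eq hlen (fun j hj => not_not.2 (hm j hj)) fun _ => ?_
  have ih := drop_ent h le_rfl
  rw [List.drop_length] at ih
  have := letter_add ih 0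
  rw [add_zero] at this
  rw [this]
  exact zero_ne_one

theorem drop_ent_cnt (h : w.drop p = encNatList K l ++ rest) :
    w.drop (ent w p (cnt w p)) = 0 :: rest := by
  have ih := drop_ent h le_rfl
  rw [List.drop_length] at ih
  rw [cnt_eq h, ih]
  rfl

theorem drop_fin (h : w.drop p = encNatList K l ++ rest) : w.drop (fin w p) = rest := by
  have := congrArg (List.drop 1) (drop_ent_cnt h)
  rwa [List.drop_drop] at this

theorem okList_of_drop (h : w.drop p = encNatList K l ++ rest) : okList w p := by
  have h0 := drop_ent_cnt h
  refine ⟨?_, ?_, fun j hj => ?_⟩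
  · have := congrArg List.length h0
    simp only [List.length_drop, List.length_cons] at this
    omega
  · simpa using letter_add h0 0
  · rw [cnt_eq h] at hj
    exact (natAt_ent h hj).okNat

/-- If the check is passed, there is indeed a code of a list. -/
theorem okList.exists_eq (h : okList w p) : ∃ l, w.drop p = encNatList K l ++ w.drop (fin w p) := by
  obtain ⟨h1, h2, h3⟩ := h
  have hm : ∀ j < cnt w p, letter w (ent w p j) = 1 := fun j hj =>
    not_not.1 (not_of_lt_least (p := fun j => letter w (ent w p j) ≠ 1) hj)
  have : ∀ j ≤ cnt w p, ∃ l, w.drop (ent w p (cnt w p - j)) = encNatList K l ++ w.drop (fin w p) := by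
    intro j hj
    induction j with
    | zero => exact ⟨[], by rw [Nat.sub_zero, drop_eq_cons h1, h2]; rfl⟩
    | succ j ih =>
      obtain ⟨l, hl⟩ := ih (by omega)
      have hlt : cnt w p - (j + 1) < cnt w p := by omega
      obtain ⟨a, ha⟩ := (h3 _ hlt).exists_eq
      have e := ent_succ w p (cnt w p - (j + 1))
      rw [show cnt w p - (j + 1) + 1 = cnt w p - j by omega] at e
      rw [show ent w p (cnt w p - (j + 1)) + 1 + 2 * numLen w (ent w p (cnt w p - (j + 1)) + 1) + 1 =
        ent w p (cnt w p - j) by omega, hl] at ha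
      refine ⟨a :: l, ?_⟩
      have := hm _ hlt
      rw [drop_eq_cons (lt_length_of_letter_ne (by rw [this]; exact one_ne_zero)), this, ha,
        encNatList_cons]
      simp
  simpa [ent] using this _ le_rfl

end Parsing

/-! ### Reading codes by loop programs -/

section ParsingPrograms

variable {K : Type u} [CommSemiring K] {ord : Option (SemiringOrder K)} {m : ℕ}
  {f g : List K → (Fin m → ℕ) → ℕ}

theorem NComp.prevLast : NComp ord fun (_ : List K) (v : Fin (m + 1 + 1) → ℕ) =>
    Fin.init v (Fin.last m) := .var _

theorem KComp.letter (hf : NComp ord f) : KComp ord fun w v => letter w (f w v) := .read hf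

theorem PComp.letter_eq (hf : NComp ord f) (a : K) : PComp ord fun w v => letter w (f w v) = a :=
  .keq (.letter hf) (.const a)

theorem NComp.numLen (hf : NComp ord f) : NComp ord fun w v => numLen w (f w v) :=
  NComp.least (p := fun w v i => letter w (f w v + 2 * i) ≠ 1) .len
    (PComp.letter_eq (hf.weaken.add ((NComp.const 2).mul .last)) 1).not

theorem PComp.bitAt (hf : NComp ord f) (hg : NComp ord g) :
    PComp ord fun w v => bitAt w (f w v) (g w v) :=
  (PComp.lt hg hf.numLen).and (.letter_eq ((hf.add ((NComp.const 2).mul hg)).add (.const 1)) 1)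

theorem PComp.okNat (hf : NComp ord f) : PComp ord fun w v => okNat w (f w v) := by
  have h1 := hf.add ((NComp.const 2).mul hf.numLen)
  refine (PComp.lt h1 .len).and ((PComp.letter_eq h1 0).and (PComp.and ?_ ?_))
  · refine PComp.forall (p := fun w v i => SemiringMC.letter w (f w v + 2 * i + 1) = 0 ∨
      SemiringMC.letter w (f w v + 2 * i + 1) = 1) hf.numLen ?_
    have := (hf.weaken.add ((NComp.const 2).mul .last)).add (.const 1)
    exact (PComp.letter_eq this 0).or (.letter_eq this 1)
  · exact (PComp.lt (.const 0) hf.numLen).imp (.letter_eq (h1.sub (.const 1)) 1)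

theorem PComp.eqAt (hf : NComp ord f) (hg : NComp ord g) :
    PComp ord fun w v => eqAt w (f w v) (g w v) :=
  PComp.forall (p := fun w v i => SemiringMC.bitAt w (f w v) i ↔ SemiringMC.bitAt w (g w v) i) .len
    ((PComp.bitAt hf.weaken .last).iff (.bitAt hg.weaken .last))

theorem PComp.ltAt (hf : NComp ord f) (hg : NComp ord g) :
    PComp ord fun w v => ltAt w (f w v) (g w v) := by
  refine PComp.exists (p := fun w v i => (¬ SemiringMC.bitAt w (f w v) i ∧
    SemiringMC.bitAt w (g w v) i) ∧ ∀ j < w.length, i < j →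
    (SemiringMC.bitAt w (f w v) j ↔ SemiringMC.bitAt w (g w v) j)) .len ?_
  refine ((PComp.bitAt hf.weaken .last).not.and (.bitAt hg.weaken .last)).and ?_
  refine PComp.forall (p := fun w v j => v (Fin.last m) < j →
    (SemiringMC.bitAt w (f w (Fin.init v)) j ↔ SemiringMC.bitAt w (g w (Fin.init v)) j)) .len ?_
  exact (PComp.lt .prevLast .last).imp
    ((PComp.bitAt hf.weaken.weaken .last).iff (.bitAt hg.weaken.weaken .last))

theorem ent_le (w : List K) (p j : ℕ) : ent w p j ≤ p + j * (2 * w.length + 2) := by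
  induction j with
  | zero => simp [ent]
  | succ j ih =>
    rw [ent_succ, add_mul, one_mul]
    have : SemiringMC.numLen w (ent w p j + 1) ≤ w.length := least_le _ _
    omega

theorem NComp.ent (hf : NComp ord f) (hg : NComp ord g) :
    NComp ord fun w v => ent w (f w v) (g w v) := by
  refine NComp.recursion (F := fun w v i => SemiringMC.ent w (f w v) i) (f := f)
    (h := fun w v _ a => a + 2 * SemiringMC.numLen w (a + 1) + 2)
    (R := fun w v => f w v + g w v * (2 * w.length + 2))
    (fun _ _ => rfl) (fun w v i => ent_succ _ _ _) hg hf ?_ ?_ fun w v i hi =>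
      (ent_le _ _ _).trans (Nat.add_le_add_left (Nat.mul_le_mul_right _ hi) _)
  · exact (NComp.last.add ((NComp.const 2).mul (NComp.last.add (.const 1)).numLen)).add (.const 2)
  · exact (hf.add (hg.mul (((NComp.const 2).mul .len).add (.const 2)))).polyBdd

theorem NComp.cnt (hf : NComp ord f) : NComp ord fun w v => cnt w (f w v) :=
  NComp.least (p := fun w v j => letter w (SemiringMC.ent w (f w v) j) ≠ 1) .len
    (PComp.letter_eq (NComp.ent hf.weaken .last) 1).not

theorem NComp.fin (hf : NComp ord f) : NComp ord fun w v => fin w (f w v) :=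
  (NComp.ent hf hf.cnt).add (.const 1)

theorem PComp.okList (hf : NComp ord f) : PComp ord fun w v => okList w (f w v) := by
  have h1 := NComp.ent hf hf.cnt
  refine (PComp.lt h1 .len).and ((PComp.letter_eq h1 0).and ?_)
  exact PComp.forall (p := fun w v j => SemiringMC.okNat w (SemiringMC.ent w (f w v) j + 1)) hf.cnt
    (.okNat ((NComp.ent hf.weaken .last).add (.const 1)))

theorem NComp.pow (hf : NComp ord f) (r : ℕ) : NComp ord fun w v => f w v ^ r := by
  induction r with
  | zero => exact (NComp.const 1).congr fun _ _ => pow_zero _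
  | succ r ih => exact (ih.mul hf).congr fun _ _ => pow_succ _ _

theorem NComp.finSum {t : ℕ} {h : Fin t → List K → (Fin m → ℕ) → ℕ} (hh : ∀ i, NComp ord (h i)) :
    NComp ord fun w v => ∑ i, h i w v := by
  induction t with
  | zero => exact (NComp.const 0).congr fun _ _ => rfl
  | succ t ih =>
    exact ((hh 0).add (ih fun i => hh i.succ)).congr fun _ _ => Fin.sum_univ_succ _

theorem PComp.finForall {t : ℕ} {p : Fin t → List K → (Fin m → ℕ) → Prop}
    (hp : ∀ i, PComp ord (p i)) : PComp ord fun w v => ∀ i, p i w v := by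
  induction t with
  | zero => exact (PComp.eq (.const 0) (.const 0)).congr fun _ _ => by simp
  | succ t ih =>
    exact ((hp 0).and (ih fun i => hp i.succ)).congr fun _ _ => Fin.forall_fin_succ

end ParsingPrograms

/-! ### Codes of interpretations -/

section Blocks

variable {α : Type*} {β : Type*}

/-- The position of a tuple of numbers below `n` in the lexicographic order. -/
def lexIdx (n : ℕ) : (r : ℕ) → (Fin r → ℕ) → ℕ
  | 0, _ => 0
  | r + 1, t => t 0 * n ^ r + lexIdx n r (Fin.tail t)

/-- The length of the code of the positive, or of the negated, facts for one relation symbol. -/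
def blockLen (n r : ℕ) : ℕ := n ^ max r 1

theorem lexIdx_lt {n r : ℕ} {t : Fin r → ℕ} (ht : ∀ i, t i < n) : lexIdx n r t < n ^ r := by
  induction r with
  | zero => simp [lexIdx]
  | succ r ih =>
    have h1 := ih (t := Fin.tail t) fun i => ht i.succ
    have h2 := Nat.mul_le_mul_right (n ^ r) (Nat.succ_le_of_lt (ht 0))
    rw [Nat.succ_mul] at h2
    rw [lexIdx, pow_succ']
    omega

theorem length_tuples (l : List α) (r : ℕ) : (tuples l r).length = l.length ^ r := by
  induction r with
  | zero => rfl
  | succ r ih =>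
    simp only [tuples, List.length_flatMap, List.length_map, ih, List.map_const', List.sum_replicate,
      smul_eq_mul]
    ring

theorem nodup_tuples {l : List α} (hl : l.Nodup) (r : ℕ) : (tuples l r).Nodup := by
  induction r with
  | zero => exact List.nodup_singleton _
  | succ r ih =>
    refine List.nodup_flatMap.2 ⟨fun a _ => ih.map fun t t' h => (Fin.cons_inj.1 h).2, ?_⟩
    refine hl.imp fun {a b} hab => ?_
    simp only [Function.onFun, List.disjoint_left, List.mem_map]
    rintro _ ⟨t, -, rfl⟩ ⟨t', -, h⟩
    exact hab (Fin.cons_inj.1 h).1.symm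

theorem getElem?_flatMap_of_length {c : ℕ} (l : List α) (f : α → List β)
    (hf : ∀ a ∈ l, (f a).length = c) {i j : ℕ} (hi : i < l.length) (hj : j < c) :
    (l.flatMap f)[i * c + j]? = (f l[i])[j]? := by
  induction l generalizing i with
  | nil => exact absurd hi (Nat.not_lt_zero _)
  | cons a l ih =>
    have ha := hf a List.mem_cons_self
    rw [List.flatMap_cons]
    cases i with
    | zero => rw [List.getElem?_append_left (by omega)]; simp
    | succ i =>
      rw [add_mul, one_mul, List.getElem?_append_right (by omega),
        show i * c + c + j - (f a).length = i * c + j by omega,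
        ih (fun b hb => hf b (List.mem_cons_of_mem _ hb)) (Nat.lt_of_succ_lt_succ hi)]
      simp

theorem tuples_getElem? (l : List α) {r : ℕ} (t : Fin r → Fin l.length) :
    (tuples l r)[lexIdx l.length r fun i => t i]? = some fun i => l[t i] := by
  induction r with
  | zero =>
    simp only [lexIdx, tuples, List.getElem?_cons_zero]
    congr 1
    exact Subsingleton.elim _ _
  | succ r ih =>
    have hlt := lexIdx_lt (n := l.length) (t := fun i => (t i.succ : ℕ)) fun i => (t i.succ).2
    have ih := ih fun i => t i.succ
    rw [tuples, lexIdx]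
    refine (getElem?_flatMap_of_length l _ (fun a _ => by rw [List.length_map, length_tuples])
      (t 0).2 hlt).trans ?_
    rw [List.getElem?_map]
    refine (congrArg _ ih).trans ?_
    simp only [Option.map_some, Option.some.injEq]
    ext i
    cases i using Fin.cases <;> rfl

/-- A list of values indexed by a list without repetitions comes from a function. -/
theorem exists_map_eq [Nonempty β] {l : List α} (hl : l.Nodup) {b : List β}
    (h : b.length = l.length) : ∃ f : α → β, l.map f = b := by
  classical
  refine ⟨fun a => if h : l.idxOf a < b.length then b[l.idxOf a] else Classical.arbitrary β,
    List.ext_getElem (by simp [h]) fun i h1 h2 => ?_⟩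
  have h1 : i < l.length := by simpa using h1
  simp [hl.idxOf_getElem, h2]

/-- The position where part `R` begins, in a list made of parts with lengths `len`. -/
def offset {t : ℕ} (len : Fin t → ℕ) (R : Fin t) : ℕ := ∑ j, if j < R then len j else 0

theorem flatMap_finRange_succ {t : ℕ} (f : Fin (t + 1) → List β) :
    (List.finRange (t + 1)).flatMap f = f 0 ++ (List.finRange t).flatMap fun i => f i.succ := by
  rw [List.finRange_succ, List.flatMap_cons, List.flatMap_map]

theorem getElem?_flatMap_finRange {t : ℕ} {len : Fin t → ℕ} {f : Fin t → List β}
    (hf : ∀ i, (f i).length = len i) (R : Fin t) {x : ℕ} (hx : x < len R) :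
    ((List.finRange t).flatMap f)[offset len R + x]? = (f R)[x]? := by
  induction t with
  | zero => exact R.elim0
  | succ t ih =>
    rw [flatMap_finRange_succ]
    cases R using Fin.cases with
    | zero =>
      have : offset len 0 = 0 := by simp [offset]
      rw [this, zero_add, List.getElem?_append_left (by rwa [hf])]
    | succ R =>
      have : offset len R.succ = len 0 + offset (fun i => len i.succ) R := by
        simp [offset, Fin.sum_univ_succ]
      rw [List.getElem?_append_right (by rw [hf]; omega), hf, this,
        show len 0 + offset (fun i => len i.succ) R + x - len 0 =
          offset (fun i => len i.succ) R + x by omega]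
      exact ih (len := fun i => len i.succ) (fun i => hf i.succ) R hx

theorem length_flatMap_finRange {t : ℕ} {len : Fin t → ℕ} {f : Fin t → List β}
    (hf : ∀ i, (f i).length = len i) :
    ((List.finRange t).flatMap f).length = ∑ i, len i := by
  induction t with
  | zero => rfl
  | succ t ih =>
    rw [flatMap_finRange_succ, List.length_append, hf, Fin.sum_univ_succ,
      ih (len := fun i => len i.succ) fun i => hf i.succ]

theorem exists_flatMap_finRange {t : ℕ} {len : Fin t → ℕ} {u : List β} (hu : u.length = ∑ i, len i) :
    ∃ f : Fin t → List β, (∀ i, (f i).length = len i) ∧ (List.finRange t).flatMap f = u := by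
  induction t generalizing u with
  | zero => exact ⟨fun _ => [], fun i => i.elim0, (List.eq_nil_of_length_eq_zero hu).symm⟩
  | succ t ih =>
    rw [Fin.sum_univ_succ] at hu
    obtain ⟨f, hf, e⟩ := ih (len := fun i => len i.succ) (u := u.drop (len 0))
      (by rw [List.length_drop]; omega)
    refine ⟨Fin.cons (u.take (len 0)) f, fun i => ?_, ?_⟩
    · cases i using Fin.cases with
      | zero => simp [hu]
      | succ i => exact hf i
    · rw [flatMap_finRange_succ]
      simp only [Fin.cons_zero, Fin.cons_succ, e, List.take_append_drop]

end Blocks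

section Interp

variable {K : Type u} [CommSemiring K] {τ : Vocab} {A : Finset ℕ}

theorem length_elems (A : Finset ℕ) : (elems A).length = A.card := by
  simp [elems]

theorem nodup_elems (A : Finset ℕ) : (elems A).Nodup := Finset.sort_nodup _ _

theorem length_encBlock {β : Type*} (A : Finset ℕ) (r : ℕ) (f : (Fin r → A) → β) :
    (encBlock A r f).length = blockLen A.card r := by
  cases r with
  | zero => simp [encBlock, blockLen]
  | succ r => simp [encBlock, blockLen, length_tuples, length_elems]

theorem encBlock_getElem? {β : Type*} (hA : A.Nonempty) {r : ℕ} (f : (Fin r → A) → β)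
    (t : Fin r → Fin (elems A).length) :
    (encBlock A r f)[lexIdx A.card r fun i => t i]? = some (f fun i => (elems A)[t i]) := by
  cases r with
  | zero =>
    rw [encBlock, lexIdx, List.getElem?_replicate, if_pos hA.card_pos]
    congr 2
    exact Subsingleton.elim _ _
  | succ r =>
    rw [encBlock, List.getElem?_map, ← length_elems A, tuples_getElem?]
    rfl

/-- The lengths of the parts of the code of an interpretation. -/
def partLen (τ : Vocab) (n : ℕ) (R : Fin τ.num) : ℕ := 2 * blockLen n (τ.ar R)

/-- The position of a literal in the code of an interpretation over a universe with `n` elements,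
which are named by the numbers below `n`. -/
def litPos (n : ℕ) (R : Fin τ.num) (neg : Bool) (t : Fin (τ.ar R) → ℕ) : ℕ :=
  offset (partLen τ n) R + ((if neg then blockLen n (τ.ar R) else 0) + lexIdx n (τ.ar R) t)

/-- The literal with a given sign. -/
def Lit.ofSign (R : Fin τ.num) (neg : Bool) (a : Fin (τ.ar R) → A) : Lit τ A :=
  if neg then .neg R a else .pos R a

theorem length_part {β : Type*} (π : Lit τ A → β) (R : Fin τ.num) :
    (encBlock A (τ.ar R) (fun a => π (.pos R a)) ++
      encBlock A (τ.ar R) (fun a => π (.neg R a))).length = partLen τ A.card R := by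
  rw [List.length_append, length_encBlock, length_encBlock, partLen, two_mul]

theorem length_encInterp {β : Type*} (π : Lit τ A → β) :
    (encInterp A π).length = ∑ R, partLen τ A.card R :=
  length_flatMap_finRange (length_part π)

theorem lexIdx_lt_blockLen {n r : ℕ} {t : Fin r → ℕ} (hn : 0 < n) (ht : ∀ i, t i < n) :
    lexIdx n r t < blockLen n r :=
  (lexIdx_lt ht).trans_le (Nat.pow_le_pow_right hn (le_max_left _ _))

theorem encInterp_getD (hA : A.Nonempty) (π : Lit τ A → K) (R : Fin τ.num) (neg : Bool)
    (t : Fin (τ.ar R) → Fin (elems A).length) :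
    (encInterp A π).getD (litPos A.card R neg fun i => t i) 0 =
      π (.ofSign R neg fun i => (elems A)[t i]) := by
  have hlt := lexIdx_lt_blockLen (t := fun i => (t i : ℕ)) hA.card_pos
    fun i => (t i).2.trans_eq (length_elems A)
  rw [List.getD_eq_getElem?_getD, encInterp, litPos,
    getElem?_flatMap_finRange (length_part π) R (by rw [partLen]; split_ifs <;> omega)]
  cases neg with
  | false =>
    rw [if_neg Bool.false_ne_true, zero_add,
      List.getElem?_append_left (by rwa [length_encBlock]), encBlock_getElem? hA]
    rfl
  | true =>
    rw [if_pos rfl, List.getElem?_append_right (by rw [length_encBlock]; omega), length_encBlock,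
      Nat.add_sub_cancel_left, encBlock_getElem? hA]
    rfl

theorem exists_encBlock_eq (A : Finset ℕ) {r : ℕ} {b : List K} (hb : b.length = blockLen A.card r)
    (h0 : r = 0 → ∀ x < A.card, b[x]? = b[0]?) : ∃ f : (Fin r → A) → K, encBlock A r f = b := by
  cases r with
  | zero =>
    refine ⟨fun _ => b.getD 0 0, List.ext_getElem? fun i => ?_⟩
    have hb : b.length = A.card := by simpa [blockLen] using hb
    rw [encBlock, List.getElem?_replicate]
    split_ifs with hi
    · rw [h0 rfl i hi, List.getElem?_eq_getElem (by omega),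
        List.getD_eq_getElem _ _ (by omega)]
    · exact (List.getElem?_eq_none (by omega)).symm
  | succ r =>
    refine exists_map_eq (nodup_tuples (nodup_elems A) (r + 1)) ?_
    rw [hb, length_tuples, length_elems]
    simp [blockLen]

/-- The lists that are codes of interpretations are those of the right length for which the parts
belonging to relation symbols of arity `0` are constant. -/
theorem exists_encInterp_eq {u : List K} (hu : u.length = ∑ R, partLen τ A.card R)
    (h0 : ∀ R, τ.ar R = 0 → ∀ x < A.card,
      u.getD (offset (partLen τ A.card) R + x) 0 = u.getD (offset (partLen τ A.card) R) 0 ∧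
      u.getD (offset (partLen τ A.card) R + (A.card + x)) 0 =
        u.getD (offset (partLen τ A.card) R + A.card) 0) :
    ∃ π : Lit τ A → K, encInterp A π = u := by
  obtain ⟨g, hg, rfl⟩ := exists_flatMap_finRange hu
  have key : ∀ R x, x < partLen τ A.card R →
      ((List.finRange τ.num).flatMap g).getD (offset (partLen τ A.card) R + x) 0 =
        (g R).getD x 0 := fun R x hx => by
    rw [List.getD_eq_getElem?_getD, List.getD_eq_getElem?_getD, getElem?_flatMap_finRange hg R hx]
  have hlen : ∀ R, ((g R).take (blockLen A.card (τ.ar R))).length = blockLen A.card (τ.ar R) ∧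
      ((g R).drop (blockLen A.card (τ.ar R))).length = blockLen A.card (τ.ar R) := fun R => by
    rw [List.length_take, List.length_drop, hg, partLen]
    omega
  have h1 : ∀ R, ∃ f : (Fin (τ.ar R) → A) → K,
      encBlock A (τ.ar R) f = (g R).take (blockLen A.card (τ.ar R)) := fun R => by
    refine exists_encBlock_eq A (hlen R).1 fun hR x hx => ?_
    have hb : blockLen A.card (τ.ar R) = A.card := by simp [blockLen, hR]
    have := (h0 R hR x hx).1
    have e0 := key R 0
    rw [add_zero] at e0
    rw [key R x (by rw [partLen]; omega), e0 (by rw [partLen]; omega)] at this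
    have hl := hg R
    rw [partLen, hb] at hl
    rw [hb, List.getElem?_take_of_lt hx, List.getElem?_take_of_lt (by omega)]
    rw [List.getD_eq_getElem _ _ (by omega), List.getD_eq_getElem _ _ (by omega)] at this
    rw [List.getElem?_eq_getElem (by omega), List.getElem?_eq_getElem (by omega), this]
  have h2 : ∀ R, ∃ f : (Fin (τ.ar R) → A) → K,
      encBlock A (τ.ar R) f = (g R).drop (blockLen A.card (τ.ar R)) := fun R => by
    refine exists_encBlock_eq A (hlen R).2 fun hR x hx => ?_
    have hb : blockLen A.card (τ.ar R) = A.card := by simp [blockLen, hR]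
    have := (h0 R hR x hx).2
    rw [key R _ (by rw [partLen]; omega), key R _ (by rw [partLen]; omega)] at this
    have hl := hg R
    rw [partLen, hb] at hl
    rw [hb, List.getElem?_drop, List.getElem?_drop, add_zero]
    rw [List.getD_eq_getElem _ _ (by omega), List.getD_eq_getElem _ _ (by omega)] at this
    rw [List.getElem?_eq_getElem (by omega), List.getElem?_eq_getElem (by omega), this]
  choose f1 hf1 using h1
  choose f2 hf2 using h2
  refine ⟨fun l => match l with
    | .pos R a => f1 R a
    | .neg R a => f2 R a, ?_⟩
  rw [encInterp]
  congr 1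
  funext R
  rw [← List.take_append_drop (blockLen A.card (τ.ar R)) (g R), ← hf1, ← hf2]

/-- In the code of an interpretation, the parts belonging to relation symbols of arity `0` are
constant. -/
theorem encInterp_const (π : Lit τ A → K) (R : Fin τ.num) (hR : τ.ar R = 0) (x : ℕ)
    (hx : x < A.card) :
    (encInterp A π).getD (offset (partLen τ A.card) R + x) 0 =
      (encInterp A π).getD (offset (partLen τ A.card) R) 0 ∧
    (encInterp A π).getD (offset (partLen τ A.card) R + (A.card + x)) 0 =
      (encInterp A π).getD (offset (partLen τ A.card) R + A.card) 0 := by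
  have hb : blockLen A.card (τ.ar R) = A.card := by simp [blockLen, hR]
  have hc : ∀ (r : ℕ) (f : (Fin r → A) → K), r = 0 → ∃ c, encBlock A r f =
      List.replicate A.card c := by
    rintro _ f rfl
    exact ⟨_, rfl⟩
  obtain ⟨c, hc1⟩ := hc _ (fun a => π (.pos R a)) hR
  obtain ⟨c', hc2⟩ := hc _ (fun a => π (.neg R a)) hR
  have key : ∀ y < 2 * A.card, (encInterp A π).getD (offset (partLen τ A.card) R + y) 0 =
      (List.replicate A.card c ++ List.replicate A.card c').getD y 0 := fun y hy => by
    rw [List.getD_eq_getElem?_getD, encInterp, getElem?_flatMap_finRange (length_part π) R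
      (by rw [partLen, hb]; exact hy), hc1, hc2, ← List.getD_eq_getElem?_getD]
  have e0 := key 0 (by omega)
  rw [add_zero] at e0
  rw [key x (by omega), key (A.card + x) (by omega), key A.card (by omega), e0]
  simp only [List.getD_eq_getElem?_getD, List.getElem?_append, List.length_replicate,
    List.getElem?_replicate]
  constructor
  · simp [hx, Nat.zero_lt_of_lt hx]
  · simp [hx, Nat.zero_lt_of_lt hx]

end Interp

/-! ### Codes of instances -/

section Instances

variable {K : Type u} [CommSemiring K]

/-- The position of the code of the assignment. -/
noncomputable def asgPos (w : List K) : ℕ := fin w 0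

/-- The position of the code of the interpretation. -/
noncomputable def interpPos (w : List K) : ℕ := fin w (asgPos w)

/-- The number of elements of the universe. -/
noncomputable def univCard (w : List K) : ℕ := cnt w 0

/-- The value that the encoded interpretation gives to a literal. The elements of the universe are
named by their positions in the increasing order. -/
noncomputable def litVal (τ : Vocab) (w : List K) (R : Fin τ.num) (neg : Bool)
    (t : Fin (τ.ar R) → ℕ) : K :=
  letter w (interpPos w + litPos (univCard w) R neg t)

/-- The position, in the increasing order, of the value of the variable `i`. -/
noncomputable def asgIdx (w : List K) (i : ℕ) : ℕ :=
  least (univCard w) fun j => eqAt w (ent w 0 j + 1) (ent w (asgPos w) i + 1)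

/-- The word `w` is the code of an instance: the two lists are there, the first one is nonempty and
increasing, the second one has `k` entries, which are among those of the first one, and the rest has
the right length, and repeats the values for relation symbols of arity `0` as it should. -/
def Valid (τ : Vocab) (k : ℕ) (w : List K) : Prop :=
  okList w 0 ∧ okList w (asgPos w) ∧ 0 < univCard w ∧
    (∀ j < univCard w, ∀ i < j, ltAt w (ent w 0 i + 1) (ent w 0 j + 1)) ∧
    cnt w (asgPos w) = k ∧
    (∀ i < k, ∃ j < univCard w, eqAt w (ent w 0 j + 1) (ent w (asgPos w) i + 1)) ∧
    w.length = interpPos w + ∑ R, partLen τ (univCard w) R ∧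
    ∀ R, τ.ar R = 0 → ∀ x < univCard w,
      letter w (interpPos w + (offset (partLen τ (univCard w)) R + x)) =
        letter w (interpPos w + offset (partLen τ (univCard w)) R) ∧
      letter w (interpPos w + (offset (partLen τ (univCard w)) R + (univCard w + x))) =
        letter w (interpPos w + (offset (partLen τ (univCard w)) R + univCard w))

theorem map_elems (A : Finset ℕ) : (elems A).map (fun a : A => (a : ℕ)) = A.sort := by
  have := Finset.map_sort (Function.Embedding.subtype (· ∈ A)) Finset.univ (· ≤ ·) (· ≤ ·)
    fun _ _ _ _ => Iff.rfl
  rw [Finset.univ_eq_attach] at this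
  refine Eq.trans ?_ (this.trans ?_)
  · rfl
  · congr 1
    exact Finset.attach_map_val

variable {τ : Vocab} {k : ℕ} {A : Finset ℕ} {π : Lit τ A → K} {s : Fin k → A}

theorem drop_encInstance : (encInstance A π s).drop 0 =
    encNatList K ((elems A).map fun a : A => (a : ℕ)) ++ (encNatList K (List.ofFn fun i => (s i : ℕ)) ++ encInterp A π) := by
  rw [List.drop_zero, encInstance, List.append_assoc]

variable [Nontrivial K]

theorem univCard_encInstance : univCard (encInstance A π s) = A.card := by
  rw [univCard, cnt_eq drop_encInstance, List.length_map, length_elems]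

theorem drop_asgPos : (encInstance A π s).drop (asgPos (encInstance A π s)) =
    encNatList K (List.ofFn fun i => (s i : ℕ)) ++ encInterp A π :=
  drop_fin drop_encInstance

theorem drop_interpPos : (encInstance A π s).drop (interpPos (encInstance A π s)) =
    encInterp A π :=
  drop_fin drop_asgPos

theorem natAt_univ (j : Fin (elems A).length) :
    NatAt (encInstance A π s) (ent (encInstance A π s) 0 j + 1) ((elems A)[j] : A) := by
  have := natAt_ent (drop_encInstance (π := π) (s := s)) (j := j)
    (by rw [List.length_map]; exact j.2)
  simpa using this

theorem natAt_asg (i : Fin k) : NatAt (encInstance A π s)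
    (ent (encInstance A π s) (asgPos (encInstance A π s)) i + 1) (s i) := by
  have := natAt_ent (drop_asgPos (π := π) (s := s)) (j := i) (by rw [List.length_ofFn]; exact i.2)
  simpa using this

theorem litVal_encInstance (hA : A.Nonempty) (R : Fin τ.num) (neg : Bool)
    (t : Fin (τ.ar R) → Fin (elems A).length) :
    litVal τ (encInstance A π s) R neg (fun i => t i) =
      π (.ofSign R neg fun i => (elems A)[t i]) := by
  rw [litVal, letter_add drop_interpPos, univCard_encInstance, encInterp_getD hA]

theorem eqAt_iff (j : Fin (elems A).length) (i : Fin k) :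
    eqAt (encInstance A π s) (ent (encInstance A π s) 0 j + 1)
      (ent (encInstance A π s) (asgPos (encInstance A π s)) i + 1) ↔ (elems A)[j] = s i := by
  rw [(natAt_univ j).eqAt_iff (natAt_asg i), Subtype.ext_iff]

theorem exists_eqAt (i : Fin k) : ∃ j < (elems A).length, eqAt (encInstance A π s)
    (ent (encInstance A π s) 0 j + 1)
      (ent (encInstance A π s) (asgPos (encInstance A π s)) i + 1) := by
  obtain ⟨j, hj, e⟩ := List.getElem_of_mem
    (show s i ∈ elems A from (Finset.mem_sort _).2 (Finset.mem_univ _))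
  exact ⟨j, hj, (eqAt_iff ⟨j, hj⟩ i).2 e⟩

theorem exists_asgIdx (i : Fin k) : ∃ j : Fin (elems A).length,
    asgIdx (encInstance A π s) i = j ∧ (elems A)[j] = s i := by
  have h := least_lt_iff.2 (exists_eqAt (π := π) (s := s) i)
  have e : asgIdx (encInstance A π s) i = least (elems A).length fun j => eqAt (encInstance A π s)
    (ent (encInstance A π s) 0 j + 1)
      (ent (encInstance A π s) (asgPos (encInstance A π s)) i + 1) := by
    rw [asgIdx, univCard_encInstance, length_elems]
  exact ⟨⟨_, h⟩, e, (eqAt_iff ⟨_, h⟩ i).1 (least_spec h)⟩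

theorem valid_encInstance (hA : A.Nonempty) : Valid τ k (encInstance A π s) := by
  have hn := univCard_encInstance (π := π) (s := s)
  have hl := length_elems A
  refine ⟨okList_of_drop drop_encInstance, okList_of_drop drop_asgPos, hn ▸ hA.card_pos,
    fun j hj i hij => ?_, ?_, fun i hi => ?_, ?_, fun R hR x hx => ?_⟩
  · rw [hn, ← hl] at hj
    rw [(natAt_univ ⟨i, hij.trans hj⟩).ltAt_iff (natAt_univ ⟨j, hj⟩)]
    have : (elems A).Pairwise (· < ·) := (Finset.sortedLT_sort _).pairwise
    exact List.pairwise_iff_getElem.1 this i j (hij.trans hj) hj hij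
  · rw [cnt_eq drop_asgPos, List.length_ofFn]
  · rw [hn, ← hl]
    exact exists_eqAt ⟨i, hi⟩
  · have h1 := congrArg List.length (drop_interpPos (π := π) (s := s))
    have h2 : interpPos (encInstance A π s) ≤ (encInstance A π s).length :=
      (okList_of_drop drop_asgPos).1
    rw [List.length_drop, length_encInterp] at h1
    rw [hn, ← h1]
    omega
  · rw [hn] at hx ⊢
    simp only [letter_add drop_interpPos]
    exact encInterp_const π R hR x hx

/-- The validity check accepts nothing but codes of instances. -/
theorem Valid.exists_eq {w : List K} (h : Valid τ k w) :
    ∃ (A : Finset ℕ) (_ : A.Nonempty) (π : Lit τ A → K) (s : Fin k → A), w = encInstance A π s := by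
  obtain ⟨h1, h2, h3, h4, h5, h6, h7, h8⟩ := h
  obtain ⟨l, hl⟩ := h1.exists_eq
  obtain ⟨l', hl'⟩ := h2.exists_eq
  have hn : univCard w = l.length := cnt_eq hl
  obtain rfl : l'.length = k := (cnt_eq hl').symm.trans h5
  have hlt : l.Pairwise (· < ·) := List.pairwise_iff_getElem.2 fun i j hi hj hij =>
    ((natAt_ent hl hi).ltAt_iff (natAt_ent hl hj)).1 (h4 j (hn ▸ hj) i hij)
  have hnd : l.Nodup := hlt.imp fun h => h.ne
  have hsort : l.toFinset.sort = l := (List.toFinset_sort (· ≤ ·) hnd).2 (hlt.imp fun h => h.le)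
  have hcard : l.toFinset.card = l.length := List.toFinset_card_of_nodup hnd
  have hmem : ∀ i : Fin l'.length, l'[i] ∈ l.toFinset := fun i => by
    obtain ⟨j, hj, hij⟩ := h6 i i.2
    rw [hn] at hj
    have := ((natAt_ent hl hj).eqAt_iff (natAt_ent hl' i.2)).1 hij
    rw [List.mem_toFinset]
    exact this ▸ List.getElem_mem hj
  have hu : (w.drop (interpPos w)).length = ∑ R, partLen τ l.toFinset.card R := by
    rw [List.length_drop, hcard, ← hn]
    omega
  obtain ⟨π, hπ⟩ := exists_encInterp_eq (A := l.toFinset) (τ := τ) hu fun R hR x hx => by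
    rw [hcard, ← hn] at hx ⊢
    simp only [← letter_add (w := w) (q := interpPos w) rfl]
    exact h8 R hR x hx
  refine ⟨l.toFinset, ?_, π, fun i => ⟨l'[i], hmem i⟩, ?_⟩
  · rw [← Finset.card_pos, hcard, ← hn]
    exact h3
  · rw [encInstance, map_elems, hsort, hπ]
    simp only [Fin.getElem_fin, List.ofFn_getElem]
    rw [List.append_assoc]
    refine (List.drop_zero (l := w)).symm.trans (hl.trans ?_)
    congr 1

end Instances

/-! ### Evaluation of formulas -/

section Evaluation

variable {K : Type u} [CommSemiring K] {τ : Vocab} {O : Set Cmp}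

/-- The value of a formula over the universe `{0, …, n - 1}`, where `π R neg t` are the values of the
literals. -/
noncomputable def FO.val (n : ℕ) (π : (R : Fin τ.num) → Bool → (Fin (τ.ar R) → ℕ) → K) :
    {k : ℕ} → FO τ k → (Fin k → ℕ) → K
  | _, .eq x y, v => truth K (v x = v y)
  | _, .ne x y, v => truth K (v x ≠ v y)
  | _, .rel R x, v => π R false fun i => v (x i)
  | _, .negRel R x, v => π R true fun i => v (x i)
  | _, .and α β, v => α.val n π v * β.val n π v
  | _, .or α β, v => α.val n π v + β.val n π v
  | _, .ex α, v => ∑ a ∈ Finset.range n, α.val n π (Fin.snoc v a)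
  | _, .all α, v => ∏ a ∈ Finset.range n, α.val n π (Fin.snoc v a)

/-- The analogue of `FO.val` for formulas with comparisons. -/
noncomputable def FOCmp.val (ord : Option (SemiringOrder K)) (n : ℕ)
    (π : (R : Fin τ.num) → Bool → (Fin (τ.ar R) → ℕ) → K) :
    {k : ℕ} → FOCmp O τ k → (Fin k → ℕ) → K
  | _, .base α, v => α.val n π v
  | _, .cmp c _ α β, v => truth K (c.holds ord (α.val n π v) (β.val n π v))
  | _, .and φ ψ, v => φ.val ord n π v * ψ.val ord n π v
  | _, .or φ ψ, v => φ.val ord n π v + ψ.val ord n π v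
  | _, .ex φ, v => ∑ a ∈ Finset.range n, φ.val ord n π (Fin.snoc v a)
  | _, .all φ, v => ∏ a ∈ Finset.range n, φ.val ord n π (Fin.snoc v a)

section Semantics

variable {A : Type*} {l : List A}

theorem snoc_getElem {k : ℕ} (v : Fin k → Fin l.length) (j : Fin l.length) :
    (Fin.snoc (fun i => l[v i]) l[j] : Fin (k + 1) → A) =
      fun i => l[(Fin.snoc v j : Fin (k + 1) → Fin l.length) i] := by
  ext i
  cases i using Fin.lastCases <;> simp

theorem snoc_val {k n : ℕ} (v : Fin k → Fin n) (j : Fin n) :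
    (Fin.snoc (fun i => (v i : ℕ)) (j : ℕ) : Fin (k + 1) → ℕ) =
      fun i => ((Fin.snoc v j : Fin (k + 1) → Fin n) i : ℕ) := by
  ext i
  cases i using Fin.lastCases <;> simp

theorem bijective_getElem (hl : l.Nodup) (hl' : ∀ a, a ∈ l) :
    Function.Bijective fun i : Fin l.length => l[i] :=
  ⟨fun _ _ h => Fin.ext ((hl.getElem_inj_iff).1 h), fun a =>
    let ⟨i, hi, e⟩ := List.getElem_of_mem (hl' a)
    ⟨⟨i, hi⟩, e⟩⟩

variable [Fintype A] {π : Lit τ A → K} {π' : (R : Fin τ.num) → Bool → (Fin (τ.ar R) → ℕ) → K}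

theorem FO.eval_eq_val (hl : l.Nodup) (hl' : ∀ a, a ∈ l)
    (hπ : ∀ R (t : Fin (τ.ar R) → Fin l.length), π' R false (fun i => t i) =
      π (.pos R fun i => l[t i]) ∧ π' R true (fun i => t i) = π (.neg R fun i => l[t i]))
    {k : ℕ} (α : FO τ k) (v : Fin k → Fin l.length) :
    α.eval π (fun i => l[v i]) = α.val l.length π' fun i => v i := by
  have hb := bijective_getElem hl hl'
  induction α with
  | eq x y => simp only [eval, val, hb.1.eq_iff (a := v x) (b := v y), Fin.ext_iff]
  | ne x y => simp only [eval, val, ne_eq, hb.1.eq_iff (a := v x) (b := v y), Fin.ext_iff]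
  | rel R x => exact ((hπ R _).1).symm
  | negRel R x => exact ((hπ R _).2).symm
  | and α β ihα ihβ => rw [eval, val, ihα, ihβ]
  | or α β ihα ihβ => rw [eval, val, ihα, ihβ]
  | ex α ih =>
    rw [eval, val, Finset.sum_range, ← hb.sum_comp]
    exact Finset.sum_congr rfl fun j _ => by rw [snoc_getElem, ih, snoc_val]
  | all α ih =>
    rw [eval, val, Finset.prod_range, ← hb.prod_comp]
    exact Finset.prod_congr rfl fun j _ => by rw [snoc_getElem, ih, snoc_val]

theorem FOCmp.eval_eq_val {ord : Option (SemiringOrder K)} (hl : l.Nodup) (hl' : ∀ a, a ∈ l)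
    (hπ : ∀ R (t : Fin (τ.ar R) → Fin l.length), π' R false (fun i => t i) =
      π (.pos R fun i => l[t i]) ∧ π' R true (fun i => t i) = π (.neg R fun i => l[t i]))
    {k : ℕ} (φ : FOCmp O τ k) (v : Fin k → Fin l.length) :
    φ.eval ord π (fun i => l[v i]) = φ.val ord l.length π' fun i => v i := by
  have hb := bijective_getElem hl hl'
  induction φ with
  | base α => exact α.eval_eq_val hl hl' hπ v
  | cmp c _ α β => rw [eval, val, α.eval_eq_val hl hl' hπ v, β.eval_eq_val hl hl' hπ v]
  | and φ ψ ihφ ihψ => rw [eval, val, ihφ, ihψ]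
  | or φ ψ ihφ ihψ => rw [eval, val, ihφ, ihψ]
  | ex φ ih =>
    rw [eval, val, Finset.sum_range, ← hb.sum_comp]
    exact Finset.sum_congr rfl fun j _ => by rw [snoc_getElem, ih, snoc_val]
  | all φ ih =>
    rw [eval, val, Finset.prod_range, ← hb.prod_comp]
    exact Finset.prod_congr rfl fun j _ => by rw [snoc_getElem, ih, snoc_val]

end Semantics

section Programs

variable {ord : Option (SemiringOrder K)} {m : ℕ}

theorem KComp.truth {p : List K → (Fin m → ℕ) → Prop} (hp : PComp ord p) :
    KComp ord fun w v => truth K (p w v) := by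
  classical
  exact (KComp.ite hp (.const 1) (.const 0)).congr fun w v => by
    by_cases h : p w v <;> simp [SemiringMC.truth, h]

theorem PComp.cmp (c : Cmp) {f g : List K → (Fin m → ℕ) → K} (hf : KComp ord f)
    (hg : KComp ord g) : PComp ord fun w v => c.holds ord (f w v) (g w v) := by
  have hF : PComp ord fun (_ : List K) (_ : Fin m → ℕ) => False :=
    (PComp.lt (.const 0) (.const 0)).congr fun _ _ => by simp
  cases c with
  | eq => exact .keq hf hg
  | ne => exact (PComp.keq hf hg).not
  | le =>
    cases ord with
    | none => exact hF
    | some o => exact .krel hf hg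
  | nle =>
    cases ord with
    | none => exact hF
    | some o => exact (PComp.krel hf hg).not

theorem NComp.lexIdx {n : List K → (Fin m → ℕ) → ℕ} (hn : NComp ord n) {r : ℕ}
    {t : Fin r → List K → (Fin m → ℕ) → ℕ} (ht : ∀ i, NComp ord (t i)) :
    NComp ord fun w v => lexIdx (n w v) r fun i => t i w v := by
  induction r with
  | zero => exact .const 0
  | succ r ih => exact ((ht 0).mul (hn.pow r)).add (ih fun i => ht i.succ)

theorem NComp.asgPos : NComp ord fun (w : List K) (_ : Fin m → ℕ) => asgPos w :=
  NComp.fin (.const 0)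

theorem NComp.interpPos : NComp ord fun (w : List K) (_ : Fin m → ℕ) => interpPos w :=
  NComp.fin .asgPos

theorem NComp.univCard : NComp ord fun (w : List K) (_ : Fin m → ℕ) => univCard w :=
  NComp.cnt (.const 0)

theorem NComp.partLen (R : Fin τ.num) :
    NComp ord fun (w : List K) (_ : Fin m → ℕ) =>
      SemiringMC.partLen τ (SemiringMC.univCard w) R :=
  (NComp.const 2).mul (NComp.univCard.pow _)

theorem NComp.offset (R : Fin τ.num) :
    NComp ord fun (w : List K) (_ : Fin m → ℕ) =>
      SemiringMC.offset (SemiringMC.partLen τ (SemiringMC.univCard w)) R := by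
  refine NComp.finSum (h := fun j w _ => if j < R then SemiringMC.partLen τ
    (SemiringMC.univCard w) j else 0) fun j => ?_
  split_ifs
  · exact .partLen j
  · exact .const 0

theorem KComp.litVal (R : Fin τ.num) (neg : Bool) {t : Fin (τ.ar R) → List K → (Fin m → ℕ) → ℕ}
    (ht : ∀ i, NComp ord (t i)) : KComp ord fun w v => litVal τ w R neg fun i => t i w v := by
  refine KComp.letter (NComp.interpPos.add ((NComp.offset R).add
    (NComp.add ?_ (NComp.lexIdx .univCard ht))))
  cases neg
  · exact .const 0
  · exact NComp.univCard.pow _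

theorem NComp.env_snoc {k : ℕ} {env : Fin k → List K → (Fin m → ℕ) → ℕ}
    (henv : ∀ i, NComp ord (env i)) (i : Fin (k + 1)) :
    NComp ord fun w (v : Fin (m + 1) → ℕ) =>
      (Fin.snoc (fun i => env i w (Fin.init v)) (v (Fin.last m)) : Fin (k + 1) → ℕ) i := by
  cases i using Fin.lastCases with
  | last => exact NComp.last.congr fun _ _ => by simp
  | cast i => exact (henv i).weaken.congr fun _ _ => by simp

/-- The value of a formula can be computed. The variables may be given by any computable functions of
further arguments; for quantifiers, one argument is added. -/
theorem FO.kComp {k : ℕ} (α : FO τ k) {m : ℕ} {env : Fin k → List K → (Fin m → ℕ) → ℕ}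
    (henv : ∀ i, NComp ord (env i)) :
    KComp ord fun w v => α.val (univCard w) (litVal τ w) fun i => env i w v := by
  induction α generalizing m with
  | eq x y => exact .truth (.eq (henv x) (henv y))
  | ne x y => exact .truth (PComp.eq (henv x) (henv y)).not
  | rel R x => exact .litVal R false fun i => henv (x i)
  | negRel R x => exact .litVal R true fun i => henv (x i)
  | and α β ihα ihβ => exact (ihα henv).mul (ihβ henv)
  | or α β ihα ihβ => exact (ihα henv).add (ihβ henv)
  | ex α ih =>
    exact KComp.sum (g := fun w v a => α.val (univCard w) (litVal τ w)
      (Fin.snoc (fun i => env i w v) a)) .univCard (ih (NComp.env_snoc henv))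
  | all α ih =>
    exact KComp.prod (g := fun w v a => α.val (univCard w) (litVal τ w)
      (Fin.snoc (fun i => env i w v) a)) .univCard (ih (NComp.env_snoc henv))

theorem FOCmp.kComp {k : ℕ} (φ : FOCmp O τ k) {m : ℕ} {env : Fin k → List K → (Fin m → ℕ) → ℕ}
    (henv : ∀ i, NComp ord (env i)) :
    KComp ord fun w v => φ.val ord (univCard w) (litVal τ w) fun i => env i w v := by
  induction φ generalizing m with
  | base α => exact α.kComp henv
  | cmp c _ α β => exact .truth (.cmp c (α.kComp henv) (β.kComp henv))
  | and φ ψ ihφ ihψ => exact (ihφ henv).mul (ihψ henv)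
  | or φ ψ ihφ ihψ => exact (ihφ henv).add (ihψ henv)
  | ex φ ih =>
    exact KComp.sum (g := fun w v a => φ.val ord (univCard w) (litVal τ w)
      (Fin.snoc (fun i => env i w v) a)) .univCard (ih (NComp.env_snoc henv))
  | all φ ih =>
    exact KComp.prod (g := fun w v a => φ.val ord (univCard w) (litVal τ w)
      (Fin.snoc (fun i => env i w v) a)) .univCard (ih (NComp.env_snoc henv))

theorem NComp.asgIdx (i : ℕ) : NComp ord fun (w : List K) (_ : Fin m → ℕ) => asgIdx w i :=
  NComp.least (p := fun w _ j => SemiringMC.eqAt w (SemiringMC.ent w 0 j + 1)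
    (SemiringMC.ent w (SemiringMC.asgPos w) i + 1)) .univCard
    (.eqAt ((NComp.ent (.const 0) .last).add (.const 1))
      ((NComp.ent .asgPos (.const i)).add (.const 1)))

theorem PComp.valid (τ : Vocab) (k : ℕ) :
    PComp ord fun (w : List K) (_ : Fin m → ℕ) => Valid τ k w := by
  refine (PComp.okList (.const 0)).and ((PComp.okList .asgPos).and
    ((PComp.lt (.const 0) .univCard).and (PComp.and ?_ ((PComp.eq (.cnt .asgPos) (.const k)).and
    (PComp.and ?_ (PComp.and ?_ ?_))))))
  · refine PComp.forall (p := fun w _ j => ∀ i < j, SemiringMC.ltAt w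
      (SemiringMC.ent w 0 i + 1) (SemiringMC.ent w 0 j + 1)) .univCard ?_
    refine PComp.forall (p := fun w v i => SemiringMC.ltAt w
      (SemiringMC.ent w 0 i + 1) (SemiringMC.ent w 0 (v (Fin.last m)) + 1)) .last ?_
    exact .ltAt ((NComp.ent (.const 0) .last).add (.const 1))
      ((NComp.ent (.const 0) .prevLast).add (.const 1))
  · refine PComp.forall (p := fun w _ i => ∃ j < SemiringMC.univCard w, SemiringMC.eqAt w
      (SemiringMC.ent w 0 j + 1) (SemiringMC.ent w (SemiringMC.asgPos w) i + 1)) (.const k) ?_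
    refine PComp.exists (p := fun w v j => SemiringMC.eqAt w
      (SemiringMC.ent w 0 j + 1) (SemiringMC.ent w (SemiringMC.asgPos w) (v (Fin.last m)) + 1))
      .univCard ?_
    exact .eqAt ((NComp.ent (.const 0) .last).add (.const 1))
      ((NComp.ent .asgPos .prevLast).add (.const 1))
  · exact .eq .len (NComp.interpPos.add (.finSum fun R => .partLen R))
  · refine PComp.finForall (p := fun R w _ => τ.ar R = 0 → ∀ x < SemiringMC.univCard w, _)
      fun R => ?_
    refine (PComp.eq (.const (τ.ar R)) (.const 0)).imp
      (PComp.forall (p := fun w _ x => _ ∧ _) .univCard (PComp.and ?_ ?_))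
    · exact .keq (.letter (NComp.interpPos.add ((NComp.offset R).add .last)))
        (.letter (NComp.interpPos.add (.offset R)))
    · exact .keq (.letter (NComp.interpPos.add ((NComp.offset R).add (NComp.univCard.add .last))))
        (.letter (NComp.interpPos.add ((NComp.offset R).add .univCard)))

end Programs

/-- The model checking problem in terms of what loop programs compute. -/
theorem mem_MC_iff [Nontrivial K] {ord : Option (SemiringOrder K)} {k : ℕ} (φ : FOCmp O τ k)
    (w : List K) : w ∈ MC ord φ ↔
      Valid τ k w ∧ φ.val ord (univCard w) (litVal τ w) (fun i => asgIdx w i) ≠ 0 := by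
  have key : ∀ (A : Finset ℕ) (_ : A.Nonempty) (π : Lit τ A → K) (s : Fin k → A),
      φ.val ord (univCard (encInstance A π s)) (litVal τ (encInstance A π s))
        (fun i => asgIdx (encInstance A π s) i) = φ.eval ord π s := by
    intro A hA π s
    choose v hv hv' using exists_asgIdx (π := π) (s := s)
    obtain rfl : (fun i => (elems A)[v i]) = s := funext hv'
    simp only [hv]
    rw [univCard_encInstance, ← length_elems]
    exact (φ.eval_eq_val (nodup_elems A) (fun a => (Finset.mem_sort _).2 (Finset.mem_univ a))
      (fun R t => ⟨litVal_encInstance hA R false t, litVal_encInstance hA R true t⟩) v).symm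
  constructor
  · rintro ⟨A, hA, π, s, rfl, h⟩
    exact ⟨valid_encInstance hA, by rwa [key A hA]⟩
  · rintro ⟨hw, h⟩
    obtain ⟨A, hA, π, s, rfl⟩ := hw.exists_eq
    exact ⟨A, hA, π, s, rfl, by rwa [key A hA] at h⟩

end Evaluation

end SemiringMC

/-- For every nontrivial commutative semiring `K`, with or without an order, every set `O` of
comparison symbols (containing `≤` or `≰` only if `K` is ordered) and every fixed formula `φ` of
`FO(O)`, the model checking problem for `φ` belongs to `P_K`. -/
theorem mainTheorem3 {K : Type*} [CommSemiring K] [Nontrivial K]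
    (ord : Option (SemiringMC.SemiringOrder K))
    (O : Set SemiringMC.Cmp)
    (hO : SemiringMC.Cmp.le ∈ O ∨ SemiringMC.Cmp.nle ∈ O → ord.isSome)
    (τ : SemiringMC.Vocab) (k : ℕ) (φ : SemiringMC.FOCmp O τ k) :
    SemiringMC.MC ord φ ∈ SemiringMC.PClass ord :=
  open SemiringMC in
  (((PComp.valid τ k).and (PComp.keq (φ.kComp fun i => NComp.asgIdx i) (.const 0)).not).congr
    fun w _ => mem_MC_iff φ w).mem_PClass
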